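/- Let $d_1,d_2\ge 1$, $p\in[1,\infty]$ and let $K\in C^\infty(\mathbf R^{d_2}\times\mathbf R^{d_1})$ be complex-valued. Below, $(f_{1,j}\otimes f_{2,j})(x_2,x_1)=f_{1,j}(x_1)f_{2,j}(x_2)$ for $(x_2,x_1)\in\mathbf R^{d_2}\times\mathbf R^{d_1}$, derivatives $D^\beta$ are taken in the sense of distributions, and $\|x^\alpha D^\beta f\|_{L^p}=\infty$ if $D^\beta f$ is not a locally integrable function or $x^\alpha D^\beta f\notin L^p$. Consider, for a given $N$, the conditions $$ \sup_{j\ge 1}\big(j^N\lambda_j\big)<\infty\quad\text{and}\quad \sup_{j\ge 1}\big(j^N\|x^\alpha D^\beta f_{k,j}\|_{L^p(\mathbf R^{d_k})}\big)<\infty \quad\text{for } k=1,2 \text{ and all multi-indices } \alpha,\beta\in\mathbf N^{d_k}. \tag{$*$} $$ (1) If $K\in\mathscr S(\mathbf R^{d_2}\times\mathbf R^{d_1})$, then there are numbers $\lambda_j\ge 0$ and functions $f_{k,j}\in\mathscr S(\mathbf R^{d_k})\setminus\{0\}$, $j\ge 1$, $k=1,2$, such that for each $k$ the sequence $\{f_{k,j}\}_{j\ge1}$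 is orthogonal in $L^2(\mathbf R^{d_k})$ (not necessarily normalized), such that $$K=\sum_{j=1}^\infty\lambda_j\, f_{1,j}\otimes f_{2,j}$$ with unconditional convergence at every point and convergence in $L^2(\mathbf R^{d_2}\times\mathbf R^{d_1})$, and such that $(*)$ holds for every integer $N\ge 0$. Moreover, either $\lambda_j>0$ for all $j$, or there is an $n\ge 0$ such that $\lambda_j>0$ for $j\le n$ and $\lambda_j=0$ for $j>n$; the latter can occur only if $K$ is a finite sum of products of a function of $x_1$ and a function of $x_2$. (2) Conversely, let $\lambda_j\ge 0$ and let $f_{k,j}$ be locally integrable functions on $\mathbf R^{d_k}$, $j\ge 1$, $k=1,2$ (not assumed to be orthogonal), such that $K=\sum_{j=1}^\infty\lambda_j\, f_{1,j}\otimes f_{2,j}$ with convergence in the sense of distributions, and such that $(*)$ holds for every integer $N\ge 1$. Then $K\in\mathscr S(\mathbf R^{d_2}\times\mathbf R^{d_1})$. -/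

import Mathlib

open MeasureTheory Filter Topology SchwartzMap
open scoped ENNReal ContDiff

noncomputable section

namespace KernelExpansion

/-- The Euclidean space `ℝ^d`. -/
abbrev E (d : ℕ) : Type := EuclideanSpace ℝ (Fin d)

/-- Orthogonal sequences in `L²(ℝ^d)`: all members are nonzero (but not necessarily normalized),
and any two different members are orthogonal. -/
def IsOG {d : ℕ} (u : ℕ → Lp ℂ 2 (volume : Measure (E d))) : Prop :=
  (∀ j, u j ≠ 0) ∧ ∀ i j, i ≠ j → inner ℂ (u i) (u j) = 0

/-- The classical partial derivative `∂φ/∂x_i`. -/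
def partialDeriv {d : ℕ} (i : Fin d) (φ : E d → ℂ) : E d → ℂ :=
  fun x => fderiv ℝ φ x (EuclideanSpace.single i 1)

/-- The classical derivative `∂^β φ = ∂_1^{β_1} ⋯ ∂_d^{β_d} φ` (applied to smooth `φ` only). -/
def multiDeriv {d : ℕ} (β : Fin d → ℕ) (φ : E d → ℂ) : E d → ℂ :=
  (List.finRange d).foldr (fun i ψ => (partialDeriv i)^[β i] ψ) φ

/-- The monomial `x^α`. -/
def monomial {d : ℕ} (α : Fin d → ℕ) (x : E d) : ℝ :=
  ∏ i, x i ^ α i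

/-- `g` is the weak (distributional) derivative `∂^β f`, with `f` and `g` locally integrable. -/
def HasWeakDeriv {d : ℕ} (β : Fin d → ℕ) (f g : E d → ℂ) : Prop :=
  LocallyIntegrable f volume ∧ LocallyIntegrable g volume ∧
    ∀ φ : E d → ℂ, ContDiff ℝ ∞ φ → HasCompactSupport φ →
      ∫ x, g x * φ x = (-1 : ℂ) ^ (∑ i, β i) * ∫ x, f x * multiDeriv β φ x

/-- `‖x^α D^β f‖_{L^p(ℝ^d)}` for the weak derivative `D^β f`. The weak derivative is unique up to
null sets, so the infimum is over equal values; it is `∞` if there is no locally integrable weak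
derivative. (The unimodular factor in `D^β = (-i)^{|β|} ∂^β` does not affect the norm.) -/
def weightedDerivNorm {d : ℕ} (p : ℝ≥0∞) (α β : Fin d → ℕ) (f : E d → ℂ) : ℝ≥0∞ :=
  ⨅ (g : E d → ℂ) (_ : HasWeakDeriv β f g), eLpNorm (fun x => (monomial α x : ℂ) * g x) p volume

/-- `sup_{j ≥ 1} j^N λ_j < ∞`; the member with number `j + 1` is stored at index `j : ℕ`. -/
def CoeffBound (N : ℕ) (lam : ℕ → ℝ) : Prop :=
  BddAbove (Set.range fun j : ℕ => ((j : ℝ) + 1) ^ N * lam j)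

/-- `sup_{j ≥ 1} j^N ‖x^α D^β f_j‖_{L^p} < ∞` for all multi-indices `α`, `β`;
the member with number `j + 1` is stored at index `j : ℕ`. -/
def FunBound {d : ℕ} (p : ℝ≥0∞) (N : ℕ) (f : ℕ → E d → ℂ) : Prop :=
  ∀ α β : Fin d → ℕ, ⨆ j : ℕ, ((j : ℝ≥0∞) + 1) ^ N * weightedDerivNorm p α β (f j) < ⊤

/-- The tensor product `f₁ ⊗ f₂` as a function of `(x₂, x₁) ∈ ℝ^{d₂} × ℝ^{d₁}`. -/
def tensor {d₁ d₂ : ℕ} (f₁ : E d₁ → ℂ) (f₂ : E d₂ → ℂ) : E d₂ × E d₁ → ℂ :=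
  fun x => f₁ x.2 * f₂ x.1

/-- `K = ∑_j λ_j f_{1,j} ⊗ f_{2,j}` with convergence in the sense of distributions. -/
def HasExpansion {d₁ d₂ : ℕ} (K : E d₂ × E d₁ → ℂ) (lam : ℕ → ℝ)
    (f₁ : ℕ → E d₁ → ℂ) (f₂ : ℕ → E d₂ → ℂ) : Prop :=
  ∀ φ : E d₂ × E d₁ → ℂ, ContDiff ℝ ∞ φ → HasCompactSupport φ →
    Tendsto (fun n : ℕ => ∑ j ∈ Finset.range n, (lam j : ℂ) * ∫ x, tensor (f₁ j) (f₂ j) x * φ x)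
      atTop (𝓝 (∫ x, K x * φ x))

/-- `K = ∑_j λ_j f_{1,j} ⊗ f_{2,j}` with unconditional convergence at every point and convergence
of the partial sums in `L²`. -/
def HasStrongExpansion {d₁ d₂ : ℕ} (K : E d₂ × E d₁ → ℂ) (lam : ℕ → ℝ)
    (f₁ : ℕ → E d₁ → ℂ) (f₂ : ℕ → E d₂ → ℂ) : Prop :=
  (∀ x, HasSum (fun j => (lam j : ℂ) * tensor (f₁ j) (f₂ j) x) (K x)) ∧
    Tendsto (fun n : ℕ => eLpNorm
      (fun x => K x - ∑ j ∈ Finset.range n, (lam j : ℂ) * tensor (f₁ j) (f₂ j) x) 2 volume)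
      atTop (𝓝 0)

/-- `K` belongs to the Schwartz space `𝓢(ℝ^{d₂} × ℝ^{d₁})`. -/
def IsSchwartz {d₁ d₂ : ℕ} (K : E d₂ × E d₁ → ℂ) : Prop :=
  ∃ S : 𝓢(E d₂ × E d₁, ℂ), ⇑S = K

end KernelExpansion

end

/-! Direct part. The integral operator `A` with kernel `K` is continuous from `L²` into the Schwartz
space, and so is its adjoint `B`, whose kernel is again Schwartz. `A` is Hilbert–Schmidt, so it has
a singular system `A v_j = s_j u_j`, `B u_j = s_j v_j`. The vectors can be taken in the Schwartz
space; those with `s_j = 0` are arbitrary Schwartz directions, available because the dimensions are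
positive.

Everything then rests on growth bounds in terms of `s_j`. Writing `v_j = s_j⁻¹ B u_j` gives `‖L v_j‖
≤ C / s_j` in `L²` for every continuous operator `L` on the Schwartz space. If `L` has a formal
adjoint `L'`, then `‖L v_j‖² = ⟨v_j, L' L v_j⟩ ≤ ‖L' L v_j‖`, which halves the exponent of `1 /
s_j`. Iteration gives `‖L v_j‖ ≤ C s_j ^ (-2⁻ʳ)` for every `r` (`formalAdjoint_growth`), and a
Sobolev inequality turns this into bounds for all Schwartz seminorms (`seminorm_growth`). An
orthonormal family on which a suitable weighted Fourier norm is at most `M` has at most `C M²`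
members (`exists_card_le_of_orthonormal`). Applied to `v_0, …, v_j`, this shows that `s_j` decays
faster than any power of `j`. Finally `s_j = s_j^(1/2) · s_j^(1/4) · s_j^(1/4)`: the first factor is
the coefficient and the other two are absorbed by `conj v_j` and `u_j`, whose seminorms grow more
slowly than `s_j^(-1/4)`.

Converse. Only summability of the coefficients and uniform bounds on the factors are used. By
Hölder, monomial weights in `L^p` control weighted `L¹` norms of the weak derivatives. Moving
derivatives between `K` and a test function `ψ` yields `|∫ ∂K ψ| ≤ C sup |ψ| / (1 + |y|)^k` for
every partial derivative of `K` (`exists_dual_bound`). Pointwise decay follows by averaging at scale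
`t`: the averages are `O(t^(-n))` in dimension `n`, their `t`-derivatives are averages of further
partial derivatives with the same growth, and each integration in `t` gains one power until the
averages stay bounded as `t → 0` (`exists_pointwise_bound_of_dual_bound`). -/

namespace KernelExpansion

open FourierTransform LineDeriv

/-! ### Polynomial weights on Schwartz functions -/

section Bracket

variable {V : Type*} [NormedAddCommGroup V] [InnerProductSpace ℝ V]

/-- Multiplication by `(1 + |x|²)^r` on Schwartz functions. -/
noncomputable def bracketCLM (V : Type*) [NormedAddCommGroup V] [InnerProductSpace ℝ V] (r : ℝ) :
    𝓢(V, ℂ) →L[ℂ] 𝓢(V, ℂ) :=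
  smulLeftCLM ℂ (fun x => (((1 + ‖x‖ ^ 2) ^ r : ℝ) : ℂ))

theorem bracketCLM_apply (r : ℝ) (f : 𝓢(V, ℂ)) (x : V) :
    bracketCLM V r f x = (((1 + ‖x‖ ^ 2) ^ r : ℝ) : ℂ) * f x := by
  rw [bracketCLM, smulLeftCLM_apply_apply, smul_eq_mul]
  exact Function.Complex.hasTemperateGrowth_ofReal.comp (Function.hasTemperateGrowth_one_add_norm_sq_rpow V r)

theorem bracketCLM_neg_bracketCLM (r : ℝ) (f : 𝓢(V, ℂ)) :
    bracketCLM V (-r) (bracketCLM V r f) = f := by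
  ext x
  rw [bracketCLM_apply, bracketCLM_apply, ← mul_assoc, ← Complex.ofReal_mul,
    ← Real.rpow_add (by positivity)]
  simp

end Bracket

/-! ### Formal adjoints and a weighted Sobolev inequality -/

section Adjoints

variable {V : Type*} [NormedAddCommGroup V] [InnerProductSpace ℝ V] [FiniteDimensional ℝ V]
  [MeasurableSpace V] [BorelSpace V]

/-- `L` has a formal adjoint on Schwartz functions with respect to the `L²` inner product. -/
def HasFormalAdjoint (L : 𝓢(V, ℂ) →L[ℂ] 𝓢(V, ℂ)) : Prop :=
  ∃ L' : 𝓢(V, ℂ) →L[ℂ] 𝓢(V, ℂ), ∀ f g : 𝓢(V, ℂ),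
    inner ℂ ((L f).toLp 2 volume) (g.toLp 2 volume) =
      inner ℂ (f.toLp 2 volume) ((L' g).toLp 2 volume)

theorem formalAdjoint_symm {L L' : 𝓢(V, ℂ) →L[ℂ] 𝓢(V, ℂ)}
    (h : ∀ f g : 𝓢(V, ℂ), inner ℂ ((L f).toLp 2 volume) (g.toLp 2 volume) =
      inner ℂ (f.toLp 2 volume) ((L' g).toLp 2 volume)) (f g : 𝓢(V, ℂ)) :
    inner ℂ ((L' f).toLp 2 volume) (g.toLp 2 volume) =
      inner ℂ (f.toLp 2 volume) ((L g).toLp 2 volume) := by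
  rw [← inner_conj_symm, ← h, inner_conj_symm]

theorem HasFormalAdjoint.comp {L M : 𝓢(V, ℂ) →L[ℂ] 𝓢(V, ℂ)} (hL : HasFormalAdjoint L)
    (hM : HasFormalAdjoint M) : HasFormalAdjoint (L ∘L M) := by
  obtain ⟨L', hL⟩ := hL
  obtain ⟨M', hM⟩ := hM
  exact ⟨M' ∘L L', fun f g => by simp only [ContinuousLinearMap.comp_apply]; rw [hL, hM]⟩

theorem hasFormalAdjoint_id : HasFormalAdjoint (ContinuousLinearMap.id ℂ 𝓢(V, ℂ)) :=
  ⟨ContinuousLinearMap.id ℂ _, fun _ _ => rfl⟩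

theorem hasFormalAdjoint_fourier : HasFormalAdjoint (fourierCLM ℂ 𝓢(V, ℂ)) := by
  refine ⟨fourierInvCLM ℂ 𝓢(V, ℂ), fun f g => ?_⟩
  have := inner_fourier_toL2_eq f (𝓕⁻ g)
  rw [fourier_fourierInv_eq] at this
  exact this

theorem inner_smulLeftCLM {w : V → ℝ} (hw : w.HasTemperateGrowth) (f g : 𝓢(V, ℂ)) :
    inner ℂ ((smulLeftCLM ℂ (fun x => (w x : ℂ)) f).toLp 2 volume) (g.toLp 2 volume) =
      inner ℂ (f.toLp 2 volume) ((smulLeftCLM ℂ (fun x => (w x : ℂ)) g).toLp 2 volume) := by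
  have hw' : Function.HasTemperateGrowth (fun x => (w x : ℂ)) :=
    Function.Complex.hasTemperateGrowth_ofReal.comp hw
  rw [inner_toL2_toL2_eq _ _ volume, inner_toL2_toL2_eq _ _ volume]
  congr 1 with x
  rw [smulLeftCLM_apply_apply hw', smulLeftCLM_apply_apply hw', inner_smul_left, inner_smul_right]
  simp

theorem hasFormalAdjoint_lineDeriv (v : V) :
    HasFormalAdjoint (lineDerivOpCLM ℂ 𝓢(V, ℂ) v) := by
  refine ⟨-lineDerivOpCLM ℂ 𝓢(V, ℂ) v, fun f g => ?_⟩
  have := integral_bilinear_lineDerivOp_right_eq_neg_left (μ := volume) f g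
    ((ContinuousLinearMap.mul ℝ ℂ).comp (Complex.conjCLE : ℂ →L[ℝ] ℂ)) v
  have h2 : (-lineDerivOpCLM ℂ 𝓢(V, ℂ) v) g = -(∂_{v} g) := rfl
  rw [h2, inner_toL2_toL2_eq _ _ volume, inner_toL2_toL2_eq _ _ volume]
  simp only [ContinuousLinearMap.comp_apply, ContinuousLinearMap.mul_apply',
    ContinuousLinearEquiv.coe_coe, Complex.conjCLE_apply] at this
  simp only [RCLike.inner_apply', lineDerivOpCLM_apply, neg_apply, mul_neg, integral_neg]
  rw [this, neg_neg]

theorem inner_bracketCLM (r : ℝ) (f g : 𝓢(V, ℂ)) :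
    inner ℂ ((bracketCLM V r f).toLp 2 volume) (g.toLp 2 volume) =
      inner ℂ (f.toLp 2 volume) ((bracketCLM V r g).toLp 2 volume) :=
  inner_smulLeftCLM (Function.hasTemperateGrowth_one_add_norm_sq_rpow V r) f g

theorem hasFormalAdjoint_bracketCLM (r : ℝ) : HasFormalAdjoint (bracketCLM V r) :=
  ⟨bracketCLM V r, inner_bracketCLM r⟩

/-- A negative power of the bracket that is square integrable. -/
theorem exists_memLp_bracket_neg (V : Type*) [NormedAddCommGroup V] [InnerProductSpace ℝ V]
    [FiniteDimensional ℝ V] [MeasurableSpace V] [BorelSpace V] :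
    ∃ r : ℝ, MemLp (fun x : V => (1 + ‖x‖ ^ 2) ^ (-r)) 2 volume := by
  obtain ⟨k, hk⟩ := (inferInstance : (volume : Measure V).HasTemperateGrowth).exists_eLpNorm_lt_top 2
  refine ⟨k, ?_⟩
  have hm : AEStronglyMeasurable (fun x : V => (1 + ‖x‖ ^ 2) ^ (-(k : ℝ))) volume := by
    refine Continuous.aestronglyMeasurable ?_
    exact .rpow_const (by fun_prop) fun x => .inl (by positivity)
  have h1 : MemLp (fun x : V => (1 + ‖x‖) ^ (-(k : ℝ))) 2 volume := by
    refine ⟨Continuous.aestronglyMeasurable ?_, hk⟩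
    exact .rpow_const (by fun_prop) fun x => .inl (by positivity)
  -- The factor `2 ^ k` comes from `1 + ‖x‖ ≤ 2 * (1 + ‖x‖ ^ 2)`.
  refine MemLp.of_le_mul (c := 2 ^ k) h1 hm (ae_of_all _ fun x => ?_)
  rw [Real.norm_of_nonneg (by positivity), Real.norm_of_nonneg (by positivity),
    Real.rpow_neg (by positivity), Real.rpow_neg (by positivity), Real.rpow_natCast,
    Real.rpow_natCast, ← div_eq_mul_inv, inv_eq_one_div, div_le_div_iff₀ (by positivity)
    (by positivity), one_mul, ← mul_pow]
  gcongr
  nlinarith [sq_nonneg (‖x‖ - 1), norm_nonneg x, sq_nonneg ‖x‖]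

/-- The decay exponent used in all weighted estimates. -/
noncomputable def decayExp (V : Type*) [NormedAddCommGroup V] [InnerProductSpace ℝ V]
    [FiniteDimensional ℝ V] [MeasurableSpace V] [BorelSpace V] : ℝ :=
  (exists_memLp_bracket_neg V).choose

theorem memLp_bracket_neg (V : Type*) [NormedAddCommGroup V] [InnerProductSpace ℝ V]
    [FiniteDimensional ℝ V] [MeasurableSpace V] [BorelSpace V] :
    MemLp (fun x : V => (1 + ‖x‖ ^ 2) ^ (-decayExp V)) 2 volume :=
  (exists_memLp_bracket_neg V).choose_spec

/-- Cauchy–Schwarz after splitting off a square-integrable negative power of the bracket. -/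
theorem norm_toLp_one_le (g : 𝓢(V, ℂ)) :
    ‖g.toLp 1 volume‖ ≤ (eLpNorm (fun x : V => (1 + ‖x‖ ^ 2) ^ (-decayExp V)) 2 volume).toReal *
      ‖(bracketCLM V (decayExp V) g).toLp 2 volume‖ := by
  rw [norm_toLp, norm_toLp, ← ENNReal.toReal_mul]
  refine ENNReal.toReal_mono (ENNReal.mul_ne_top (memLp_bracket_neg V).2.ne
    (eLpNorm_lt_top _ _ _).ne) ?_
  have : (g : V → ℂ) = (fun x : V => (1 + ‖x‖ ^ 2) ^ (-decayExp V)) •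
      (bracketCLM V (decayExp V) g : V → ℂ) := by
    ext x
    rw [Pi.smul_apply', bracketCLM_apply, Complex.real_smul, ← mul_assoc, ← Complex.ofReal_mul,
    ← Real.rpow_add (by positivity)]
    simp
  conv_lhs => rw [this]
  exact eLpNorm_smul_le_mul_eLpNorm (SchwartzMap.memLp _ 2 _).1 (memLp_bracket_neg V).1

theorem norm_fourierInv_apply_le (g : 𝓢(V, ℂ)) (x : V) : ‖(𝓕⁻ g) x‖ ≤ ‖g.toLp 1 volume‖ := by
  rw [fourierInv_apply_eq]
  exact norm_fourier_apply_le_toLp_one g _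

/-- A Sobolev inequality: weighted sup norms are controlled by `L²` norms. -/
theorem exists_pow_mul_norm_le (k : ℕ) :
    ∃ L : 𝓢(V, ℂ) →L[ℂ] 𝓢(V, ℂ), HasFormalAdjoint L ∧ ∃ C, 0 ≤ C ∧ ∀ (f : 𝓢(V, ℂ)) (x : V),
      ‖x‖ ^ k * ‖f x‖ ≤ C * ‖(L f).toLp 2 volume‖ := by
  -- The sup norm of a weighted function is at most the `L¹` norm of its Fourier transform, and this
  -- is at most an `L²` norm with one more weight. All three factors have formal adjoints.
  refine ⟨bracketCLM V (decayExp V) ∘L fourierCLM ℂ 𝓢(V, ℂ) ∘L bracketCLM V k,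
    (hasFormalAdjoint_bracketCLM _).comp
      (hasFormalAdjoint_fourier.comp (hasFormalAdjoint_bracketCLM _)),
    (eLpNorm (fun x : V => (1 + ‖x‖ ^ 2) ^ (-decayExp V)) 2 volume).toReal,
    ENNReal.toReal_nonneg, fun f x => ?_⟩
  refine le_trans ?_ (norm_toLp_one_le (𝓕 (bracketCLM V k f)))
  refine le_trans ?_ (norm_fourierInv_apply_le _ x)
  rw [fourierInv_fourier_eq, bracketCLM_apply, norm_mul, Complex.norm_real,
    Real.norm_of_nonneg (by positivity), Real.rpow_natCast]
  gcongr
  nlinarith [sq_nonneg (‖x‖ - 1), norm_nonneg x, sq_nonneg ‖x‖]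

end Adjoints

end KernelExpansion

/-! ### Interpolation: growth of singular vectors in Schwartz seminorms -/

namespace KernelExpansion

open FourierTransform LineDeriv

/-- The derivative of order `n + 1` is controlled by the derivatives of order `n` of the first
partial derivatives with respect to a basis. -/
theorem exists_norm_iteratedFDeriv_succ_le {W ι : Type*} [NormedAddCommGroup W] [NormedSpace ℝ W]
    [FiniteDimensional ℝ W] [Fintype ι] (b : Module.Basis ι ℝ W) :
    ∃ C, 0 ≤ C ∧ ∀ f : W → ℂ, ContDiff ℝ ∞ f → ∀ (n : ℕ) (x : W),
      ‖iteratedFDeriv ℝ (n + 1) f x‖ ≤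
        C * ∑ i, ‖iteratedFDeriv ℝ n (fun y => fderiv ℝ f y (b i)) x‖ := by
  let T : ι → ℂ →L[ℝ] (W →L[ℝ] ℂ) := fun i =>
    ContinuousLinearMap.smulRightL ℝ W ℂ (LinearMap.toContinuousLinearMap (b.coord i))
  refine ⟨∑ i, ‖T i‖, by positivity, fun f hf n x => ?_⟩
  have hd : ∀ i, ContDiff ℝ ∞ (fun y => fderiv ℝ f y (b i)) := fun i =>
    (hf.fderiv_right (m := ∞) (by simp)).clm_apply contDiff_const
  have key : fderiv ℝ f = fun y => ∑ i, (T i ∘ fun y => fderiv ℝ f y (b i)) y := by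
    ext y v
    conv_lhs => rw [← b.sum_repr v, map_sum]
    simp [T]
  rw [← norm_iteratedFDeriv_fderiv]
  conv_lhs => rw [key]
  rw [iteratedFDeriv_fun_sum_apply
    (fun i _ => (((T i).contDiff.comp (hd i)).of_le (by exact_mod_cast le_top)).contDiffAt)]
  refine (norm_sum_le _ _).trans ?_
  rw [Finset.sum_mul_sum]
  refine Finset.sum_le_sum fun i _ => ?_
  refine ((T i).norm_iteratedFDeriv_comp_left (hd i).contDiffAt
    (by exact_mod_cast le_top)).trans ?_
  exact Finset.single_le_sum (f := fun j => ‖T i‖ *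
    ‖iteratedFDeriv ℝ n (fun y => fderiv ℝ f y (b j)) x‖) (fun j _ => by positivity)
    (Finset.mem_univ i)

section Interpolation

variable {V : Type*} [NormedAddCommGroup V] [InnerProductSpace ℝ V] [FiniteDimensional ℝ V]
  [MeasurableSpace V] [BorelSpace V]

/-- Since `v i` is normalized, `‖L v‖² = ⟨v, L' L v⟩ ≤ ‖L' L v‖`. The operator `L' L` again has a
formal adjoint, so the bound for it may be fed back, and each round halves the exponent of `1 / s
i`. -/
theorem formalAdjoint_growth {ι : Type*} {v : ι → 𝓢(V, ℂ)} {s : ι → ℝ} (hs : ∀ i, 0 < s i)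
    (hv : ∀ i, ‖(v i).toLp 2 volume‖ = 1)
    (h : ∀ L : 𝓢(V, ℂ) →L[ℂ] 𝓢(V, ℂ), ∃ C, ∀ i, ‖(L (v i)).toLp 2 volume‖ ≤ C / s i) (r : ℕ) :
    ∀ L : 𝓢(V, ℂ) →L[ℂ] 𝓢(V, ℂ), HasFormalAdjoint L →
      ∃ C, 0 ≤ C ∧ ∀ i, ‖(L (v i)).toLp 2 volume‖ ≤ C * s i ^ (-(1 / 2 : ℝ) ^ r) := by
  induction r with
  | zero =>
    intro L _
    obtain ⟨C, hC⟩ := h L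
    refine ⟨|C|, abs_nonneg C, fun i => (hC i).trans ?_⟩
    rw [pow_zero, Real.rpow_neg_one, ← div_eq_mul_inv]
    have := hs i
    gcongr
    exact le_abs_self C
  | succ r ih =>
    intro L hL
    obtain ⟨L', hL'⟩ := hL
    obtain ⟨C, hC0, hC⟩ := ih (L' ∘L L)
      (HasFormalAdjoint.comp ⟨L, formalAdjoint_symm hL'⟩ ⟨L', hL'⟩)
    refine ⟨√C, Real.sqrt_nonneg C, fun i => ?_⟩
    have hsi := hs i
    refine le_of_sq_le_sq ?_ (by positivity)
    calc ‖(L (v i)).toLp 2 volume‖ ^ 2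
        = ‖(inner ℂ ((L (v i)).toLp 2 volume) ((L (v i)).toLp 2 volume) : ℂ)‖ := by
          rw [inner_self_eq_norm_sq_to_K]; simp
      _ = ‖(inner ℂ ((v i).toLp 2 volume) ((L' (L (v i))).toLp 2 volume) : ℂ)‖ := by rw [hL']
      _ ≤ ‖(v i).toLp 2 volume‖ * ‖(L' (L (v i))).toLp 2 volume‖ := norm_inner_le_norm _ _
      _ ≤ C * s i ^ (-(1 / 2 : ℝ) ^ r) := by rw [hv, one_mul]; exact hC i
      _ = (√C * s i ^ (-(1 / 2 : ℝ) ^ (r + 1))) ^ 2 := by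
          rw [mul_pow, Real.sq_sqrt hC0, ← Real.rpow_natCast (s i ^ _), ← Real.rpow_mul hsi.le]
          congr 2
          push_cast
          ring

/-- If an `L²`-normalized family is bounded by `C / s i` in every continuous norm, then all its
Schwartz seminorms are bounded by arbitrarily small negative powers of `s i`. -/
theorem seminorm_growth {ι : Type*} {v : ι → 𝓢(V, ℂ)} {s : ι → ℝ} (hs : ∀ i, 0 < s i)
    (hv : ∀ i, ‖(v i).toLp 2 volume‖ = 1)
    (h : ∀ L : 𝓢(V, ℂ) →L[ℂ] 𝓢(V, ℂ), ∃ C, ∀ i, ‖(L (v i)).toLp 2 volume‖ ≤ C / s i) (r k n : ℕ) :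
    ∃ C, 0 ≤ C ∧ ∀ i, SchwartzMap.seminorm ℝ k n (v i) ≤ C * s i ^ (-(1 / 2 : ℝ) ^ r) := by
  -- Strengthened to all `L` with a formal adjoint, because the induction on the order of
  -- differentiation replaces `L` by a directional derivative of it.
  suffices H : ∀ L : 𝓢(V, ℂ) →L[ℂ] 𝓢(V, ℂ), HasFormalAdjoint L → ∃ C, 0 ≤ C ∧ ∀ i,
      SchwartzMap.seminorm ℝ k n (L (v i)) ≤ C * s i ^ (-(1 / 2 : ℝ) ^ r) from
    by
      obtain ⟨C, h0, hC⟩ := H _ hasFormalAdjoint_id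
      exact ⟨C, h0, hC⟩
  induction n with
  | zero =>
    intro L hL
    obtain ⟨M, hM, C, hC0, hC⟩ := exists_pow_mul_norm_le (V := V) k
    obtain ⟨C', hC'0, hC'⟩ := formalAdjoint_growth hs hv h r (M ∘L L) (hM.comp hL)
    refine ⟨C * C', by positivity, fun i => ?_⟩
    have hsi := hs i
    refine seminorm_le_bound ℝ k 0 _ (by positivity) fun x => ?_
    rw [norm_iteratedFDeriv_zero, mul_assoc]
    exact (hC _ x).trans (by gcongr; exact hC' i)
  | succ n ih =>
    intro L hL
    let b := (stdOrthonormalBasis ℝ V).toBasis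
    obtain ⟨C, hC0, hC⟩ := exists_norm_iteratedFDeriv_succ_le b
    choose C' hC'0 hC' using fun j =>
      ih (lineDerivOpCLM ℂ 𝓢(V, ℂ) (b j) ∘L L) ((hasFormalAdjoint_lineDeriv (b j)).comp hL)
    refine ⟨C * ∑ j, C' j, mul_nonneg hC0 (Finset.sum_nonneg fun j _ => hC'0 j), fun i => ?_⟩
    have hsi := hs i
    have hC'' := Finset.sum_nonneg fun j (_ : j ∈ Finset.univ) => hC'0 j
    refine seminorm_le_bound ℝ k (n + 1) _ (by positivity) fun x => ?_
    calc ‖x‖ ^ k * ‖iteratedFDeriv ℝ (n + 1) (L (v i)) x‖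
        ≤ ‖x‖ ^ k * (C * ∑ j, ‖iteratedFDeriv ℝ n
            (fun y => fderiv ℝ (L (v i)) y (b j)) x‖) := by
          gcongr
          exact hC _ ((L (v i)).smooth ⊤) n x
      _ = C * ∑ j, ‖x‖ ^ k * ‖iteratedFDeriv ℝ n (∂_{b j} (L (v i)) : 𝓢(V, ℂ)) x‖ := by
          rw [mul_left_comm, Finset.mul_sum]; rfl
      _ ≤ C * ∑ j, C' j * s i ^ (-(1 / 2 : ℝ) ^ r) := by
          refine mul_le_mul_of_nonneg_left (Finset.sum_le_sum fun j _ => ?_) hC0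
          exact (le_seminorm ℝ k n _ x).trans (hC' j i)
      _ = _ := by rw [← Finset.sum_mul, mul_assoc]

end Interpolation

/-! ### Counting orthonormal families with bounded weighted Fourier norm -/

section Counting

variable {V : Type*} [NormedAddCommGroup V] [InnerProductSpace ℝ V] [FiniteDimensional ℝ V]
  [MeasurableSpace V] [BorelSpace V]

/-- The representing vector is the weight times the character of frequency `ξ`. Its norm does not
depend on `ξ`, which makes the Bessel estimate below uniform in the frequency. -/
theorem exists_fourier_eq_inner (ξ : V) : ∃ h : Lp ℂ 2 (volume : Measure V),
    ‖h‖ = (eLpNorm (fun x : V => (1 + ‖x‖ ^ 2) ^ (-decayExp V)) 2 volume).toReal ∧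
    ∀ f : 𝓢(V, ℂ), 𝓕 (bracketCLM V (-decayExp V) f) ξ = inner ℂ h (f.toLp 2 volume) := by
  let w : V → ℝ := fun x => (1 + ‖x‖ ^ 2) ^ (-decayExp V)
  let e : V → ℂ := fun x => Complex.exp (((2 * Real.pi * inner ℝ x ξ : ℝ) : ℂ) * Complex.I)
  have hwc : Continuous w := .rpow_const (by fun_prop) fun x => .inl (by positivity)
  have hn : ∀ x, ‖e x * w x‖ = ‖w x‖ := fun x => by
    rw [norm_mul, Complex.norm_exp_ofReal_mul_I, one_mul, Complex.norm_real]
  have hmem : MemLp (fun x => e x * w x) 2 volume :=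
    (memLp_bracket_neg V).of_le (Continuous.aestronglyMeasurable (by fun_prop))
      (ae_of_all _ fun x => (hn x).le)
  refine ⟨hmem.toLp, ?_, fun f => ?_⟩
  · rw [Lp.norm_toLp, eLpNorm_congr_norm_ae (ae_of_all _ hn)]
  · rw [fourier_coe, Real.fourier_eq', L2.inner_def]
    refine integral_congr_ae ?_
    filter_upwards [hmem.coeFn_toLp, f.coeFn_toLp 2 volume] with x h1 h2
    rw [h1, h2, bracketCLM_apply, RCLike.inner_apply', map_mul, Complex.conj_ofReal,
      ← Complex.exp_conj, map_mul, Complex.conj_I, Complex.conj_ofReal, smul_eq_mul, ← mul_assoc]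
    congr 3
    push_cast
    ring

/-- Weight, Fourier transform, weight is a Hilbert–Schmidt operator: Bessel's inequality holds at
each frequency, and the outer weight makes it integrable over the frequencies. -/
theorem sum_norm_sq_le_of_orthonormal {ι : Type*} (t : Finset ι) {v : ι → 𝓢(V, ℂ)}
    (hv : Orthonormal ℂ fun i => (v i).toLp 2 volume) :
    ∑ i ∈ t, ‖(bracketCLM V (-decayExp V) (𝓕 (bracketCLM V (-decayExp V) (v i)))).toLp 2 volume‖ ^ 2
      ≤ (eLpNorm (fun x : V => (1 + ‖x‖ ^ 2) ^ (-decayExp V)) 2 volume).toReal ^ 2 *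
        ∫ x : V, ((1 + ‖x‖ ^ 2) ^ (-decayExp V)) ^ 2 := by
  have hsq : ∀ g : 𝓢(V, ℂ), ‖g.toLp 2 volume‖ ^ 2 = ∫ x, ‖g x‖ ^ 2 := fun g => by
    rw [norm_toLp' (by simp) (by simp), ← Real.rpow_natCast, ← Real.rpow_mul
      (integral_nonneg fun x => by positivity)]
    simp
  have hint : ∀ g : 𝓢(V, ℂ), Integrable (fun x => ‖g x‖ ^ 2) := fun g =>
    (SchwartzMap.memLp g 2 volume).integrable_norm_pow (by simp)
  have hwint : Integrable (fun x : V => ((1 + ‖x‖ ^ 2) ^ (-decayExp V)) ^ 2) :=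
    (memLp_bracket_neg V).integrable_sq
  simp_rw [hsq]
  rw [← integral_finsetSum _ fun i _ => hint _, ← integral_const_mul]
  refine integral_mono (integrable_finsetSum _ fun i _ => hint _) (hwint.const_mul _) fun ξ => ?_
  obtain ⟨h, hh, hF⟩ := exists_fourier_eq_inner ξ
  have := hv.sum_inner_products_le h (s := t)
  simp only [bracketCLM_apply _ (𝓕 _), norm_mul, mul_pow, hF, Complex.norm_real]
  rw [← Finset.mul_sum, mul_comm, Real.norm_of_nonneg (by positivity), ← hh]
  gcongr
  refine le_trans (le_of_eq ?_) this
  exact Finset.sum_congr rfl fun i _ => by rw [norm_inner_symm]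

/-- An `L²`-orthonormal family with bounded weighted Fourier norms has few members. -/
theorem exists_card_le_of_orthonormal : ∃ L : 𝓢(V, ℂ) →L[ℂ] 𝓢(V, ℂ), HasFormalAdjoint L ∧
    ∃ C, 0 ≤ C ∧ ∀ {ι : Type} (t : Finset ι) (v : ι → 𝓢(V, ℂ)) (M : ℝ),
      Orthonormal ℂ (fun i => (v i).toLp 2 volume) →
      (∀ i ∈ t, ‖(L (v i)).toLp 2 volume‖ ≤ M) → (t.card : ℝ) ≤ C * M ^ 2 := by
  set r := decayExp V with hr
  refine ⟨bracketCLM V r ∘L fourierCLM ℂ 𝓢(V, ℂ) ∘L bracketCLM V r,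
    (hasFormalAdjoint_bracketCLM _).comp
      (hasFormalAdjoint_fourier.comp (hasFormalAdjoint_bracketCLM _)),
    (eLpNorm (fun x : V => (1 + ‖x‖ ^ 2) ^ (-r)) 2 volume).toReal ^ 2 *
        ∫ x : V, ((1 + ‖x‖ ^ 2) ^ (-r)) ^ 2,
    mul_nonneg (by positivity) (integral_nonneg fun x => by positivity), fun t v M hv hM => ?_⟩
  have hone : ∀ i ∈ t, (1 : ℝ) ≤
      ‖(bracketCLM V (-r) (𝓕 (bracketCLM V (-r) (v i)))).toLp 2 volume‖ ^ 2 * M ^ 2 := by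
    intro i hi
    have hcancel : ∀ f g : 𝓢(V, ℂ), inner ℂ ((bracketCLM V (-r) f).toLp 2 volume)
        ((bracketCLM V r g).toLp 2 volume) = inner ℂ (f.toLp 2 volume) (g.toLp 2 volume) :=
      fun f g => by rw [inner_bracketCLM, bracketCLM_neg_bracketCLM]
    -- Opposite weights cancel in the pairing and Plancherel removes the Fourier transform, so `1 =
    -- ‖v i‖²` is split into a Hilbert–Schmidt factor and one bounded by `M`. Squaring and summing
    -- over `t` counts its members.
    have h1 : inner ℂ ((bracketCLM V (-r) (𝓕 (bracketCLM V (-r) (v i)))).toLp 2 volume)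
        ((bracketCLM V r (𝓕 (bracketCLM V r (v i)))).toLp 2 volume) = 1 := by
      rw [hcancel, inner_fourier_toL2_eq, hcancel, inner_self_eq_norm_sq_to_K, hv.1 i]
      simp
    have h2 := norm_inner_le_norm (𝕜 := ℂ)
      ((bracketCLM V (-r) (𝓕 (bracketCLM V (-r) (v i)))).toLp 2 volume)
      ((bracketCLM V r (𝓕 (bracketCLM V r (v i)))).toLp 2 volume)
    rw [h1, norm_one] at h2
    rw [← mul_pow]
    refine one_le_pow₀ (h2.trans ?_)
    gcongr
    exact hM i hi
  calc (t.card : ℝ) = ∑ i ∈ t, (1 : ℝ) := by simp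
    _ ≤ ∑ i ∈ t, ‖(bracketCLM V (-r) (𝓕 (bracketCLM V (-r) (v i)))).toLp 2 volume‖ ^ 2 * M ^ 2 :=
      Finset.sum_le_sum hone
    _ ≤ _ := by
      rw [← Finset.sum_mul]
      gcongr
      exact sum_norm_sq_le_of_orthonormal t hv

end Counting

end KernelExpansion

/-! ### Integral operators with Schwartz kernel, from `L²` to the Schwartz space -/

namespace KernelExpansion

open LineDeriv

theorem rpow_neg_le_one_add_norm {V : Type*} [NormedAddCommGroup V] (r : ℝ) :
    ∃ k : ℕ, ∀ x : V, (1 + ‖x‖ ^ 2) ^ r ≤ (1 + ‖x‖) ^ k := by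
  obtain ⟨m, hm⟩ := exists_nat_ge r
  refine ⟨2 * m, fun x => ?_⟩
  have h0 := norm_nonneg x
  calc (1 + ‖x‖ ^ 2) ^ r ≤ (1 + ‖x‖ ^ 2) ^ (m : ℝ) :=
        Real.rpow_le_rpow_of_exponent_le (by nlinarith) hm
    _ = (1 + ‖x‖ ^ 2) ^ m := Real.rpow_natCast _ _
    _ ≤ ((1 + ‖x‖) ^ 2) ^ m := by gcongr; nlinarith
    _ = _ := by rw [← pow_mul]

section Kernel

variable {V₁ V₂ : Type*} [NormedAddCommGroup V₁] [InnerProductSpace ℝ V₁] [FiniteDimensional ℝ V₁]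
  [MeasurableSpace V₁] [BorelSpace V₁]
  [NormedAddCommGroup V₂] [InnerProductSpace ℝ V₂]

/-- The decay in `y` is fixed, just enough to pair with `L²` functions, while the decay in `x` is
arbitrary. General values `F` allow `K` to be replaced by its derivative. -/
theorem exists_kernel_bound {F : Type*} [NormedAddCommGroup F] [NormedSpace ℝ F]
    (K : 𝓢(V₂ × V₁, F)) (ρ : ℝ) : ∃ C, 0 ≤ C ∧ ∀ (x : V₂) (y : V₁),
      ‖K (x, y)‖ ≤ C * (1 + ‖x‖ ^ 2) ^ (-ρ) * (1 + ‖y‖ ^ 2) ^ (-decayExp V₁) := by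
  obtain ⟨k, hk⟩ := rpow_neg_le_one_add_norm (V := V₂) ρ
  obtain ⟨m, hm⟩ := rpow_neg_le_one_add_norm (V := V₁) (decayExp V₁)
  refine ⟨2 ^ (k + m) * ((Finset.Iic (k + m, 0)).sup fun m => SchwartzMap.seminorm ℝ m.1 m.2) K,
    by positivity, fun x y => ?_⟩
  have h := one_add_le_sup_seminorm_apply (𝕜 := ℝ) (m := (k + m, 0)) le_rfl le_rfl K (x, y)
  rw [norm_iteratedFDeriv_zero] at h
  rw [Real.rpow_neg (by positivity), Real.rpow_neg (by positivity), ← div_eq_mul_inv,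
    ← div_eq_mul_inv, div_div, le_div_iff₀ (by positivity)]
  refine le_trans ?_ h
  rw [mul_comm, pow_add]
  gcongr
  · exact (hk x).trans (by gcongr; exact le_max_left _ _)
  · exact (hm y).trans (by gcongr; exact le_max_right _ _)

theorem memLp_kernel (K : 𝓢(V₂ × V₁, ℂ)) (x : V₂) :
    MemLp (fun y => (starRingEnd ℂ) (K (x, y))) 2 volume := by
  obtain ⟨C, -, hC⟩ := exists_kernel_bound K 0
  refine (memLp_bracket_neg V₁).of_le_mul (c := C)
    (Continuous.aestronglyMeasurable (by fun_prop)) (ae_of_all _ fun y => ?_)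
  rw [RCLike.norm_conj, Real.norm_of_nonneg (by positivity)]
  simpa using hC x y

/-- The function `y ↦ conj K(x, y)` as an element of `L²`. -/
noncomputable def kernelSlice (K : 𝓢(V₂ × V₁, ℂ)) (x : V₂) : Lp ℂ 2 (volume : Measure V₁) :=
  (memLp_kernel K x).toLp

theorem norm_kernelSlice_le (K : 𝓢(V₂ × V₁, ℂ)) (ρ : ℝ) :
    ∃ C, 0 ≤ C ∧ ∀ x, ‖kernelSlice K x‖ ≤ C * (1 + ‖x‖ ^ 2) ^ (-ρ) := by
  obtain ⟨C, hC0, hC⟩ := exists_kernel_bound K ρ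
  refine ⟨C * (eLpNorm (fun y : V₁ => (1 + ‖y‖ ^ 2) ^ (-decayExp V₁)) 2 volume).toReal,
    by positivity, fun x => ?_⟩
  have h : eLpNorm (fun y => (starRingEnd ℂ) (K (x, y))) 2 volume ≤
      ENNReal.ofReal (C * (1 + ‖x‖ ^ 2) ^ (-ρ)) *
        eLpNorm (fun y : V₁ => (1 + ‖y‖ ^ 2) ^ (-decayExp V₁)) 2 volume := by
    refine eLpNorm_le_mul_eLpNorm_of_ae_le_mul (ae_of_all _ fun y => ?_) 2
    rw [RCLike.norm_conj, Real.norm_of_nonneg (by positivity)]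
    exact hC x y
  rw [kernelSlice, Lp.norm_toLp]
  refine (ENNReal.toReal_mono
    (ENNReal.mul_ne_top ENNReal.ofReal_ne_top (memLp_bracket_neg V₁).2.ne) h).trans ?_
  rw [ENNReal.toReal_mul, ENNReal.toReal_ofReal (by positivity)]
  apply le_of_eq
  ring

/-- The integral operator with kernel `K`, as a function. -/
noncomputable def integralOp (K : 𝓢(V₂ × V₁, ℂ)) (u : Lp ℂ 2 (volume : Measure V₁)) (x : V₂) : ℂ :=
  ∫ y, K (x, y) * u y

theorem integralOp_eq_inner (K : 𝓢(V₂ × V₁, ℂ)) (u : Lp ℂ 2 (volume : Measure V₁)) (x : V₂) :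
    integralOp K u x = inner ℂ (kernelSlice K x) u := by
  rw [integralOp, L2.inner_def]
  refine integral_congr_ae ?_
  filter_upwards [(memLp_kernel K x).coeFn_toLp] with y hy
  rw [kernelSlice, hy, RCLike.inner_apply', Complex.conj_conj]

theorem integrable_bracket_mul (u : Lp ℂ 2 (volume : Measure V₁)) :
    Integrable fun y => (1 + ‖y‖ ^ 2) ^ (-decayExp V₁) * ‖u y‖ :=
  (memLp_bracket_neg V₁).integrable_mul (Lp.memLp u).norm

variable [FiniteDimensional ℝ V₂]

/-- Differentiation under the integral: the derivative of the kernel has a majorant in `y`, uniform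
in `x`, whose product with `‖u y‖` is integrable. -/
theorem hasFDerivAt_integralOp (K : 𝓢(V₂ × V₁, ℂ)) (u : Lp ℂ 2 (volume : Measure V₁)) (x : V₂) :
    HasFDerivAt (integralOp K u)
      (∫ y, u y • (fderiv ℝ K (x, y)).comp (ContinuousLinearMap.inl ℝ V₂ V₁)) x := by
  obtain ⟨C, hC0, hC⟩ := exists_kernel_bound (fderivCLM ℝ (V₂ × V₁) ℂ K) 0
  obtain ⟨C', hC'0, hC'⟩ := exists_kernel_bound K 0
  have hu := (Lp.aestronglyMeasurable u)
  have hfc : Continuous fun y : V₁ => fderiv ℝ K (x, y) :=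
    (fderivCLM ℝ (V₂ × V₁) ℂ K).continuous.comp (by fun_prop)
  refine hasFDerivAt_integral_of_dominated_of_fderiv_le (s := Set.univ)
    (F := fun x y => K (x, y) * u y)
    (F' := fun x y => u y • (fderiv ℝ K (x, y)).comp (ContinuousLinearMap.inl ℝ V₂ V₁))
    (bound := fun y => (C * ‖ContinuousLinearMap.inl ℝ V₂ V₁‖) *
      ((1 + ‖y‖ ^ 2) ^ (-decayExp V₁) * ‖u y‖)) univ_mem
    (Eventually.of_forall fun x => ?_) ?_ ?_ (ae_of_all _ fun y x _ => ?_)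
    ((integrable_bracket_mul u).const_mul _) (ae_of_all _ fun y x _ => ?_)
  · exact (Continuous.aestronglyMeasurable (by fun_prop)).mul hu
  · refine Integrable.mono' ((integrable_bracket_mul u).const_mul C')
      ((Continuous.aestronglyMeasurable (by fun_prop)).mul hu) (ae_of_all _ fun y => ?_)
    rw [norm_mul, ← mul_assoc]
    gcongr
    simpa using hC' x y
  · exact hu.smul (Continuous.aestronglyMeasurable (by fun_prop))
  · rw [norm_smul]
    calc ‖u y‖ * ‖(fderiv ℝ K (x, y)).comp (ContinuousLinearMap.inl ℝ V₂ V₁)‖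
        ≤ ‖u y‖ * (‖fderiv ℝ K (x, y)‖ * ‖ContinuousLinearMap.inl ℝ V₂ V₁‖) := by
          gcongr; exact ContinuousLinearMap.opNorm_comp_le _ _
      _ ≤ ‖u y‖ * ((C * (1 + ‖y‖ ^ 2) ^ (-decayExp V₁)) * ‖ContinuousLinearMap.inl ℝ V₂ V₁‖) := by
          gcongr; simpa using hC x y
      _ = _ := by ring
  · have h1 : HasFDerivAt (fun x : V₂ => K (x, y))
        ((fderiv ℝ K (x, y)).comp (ContinuousLinearMap.inl ℝ V₂ V₁)) x :=
      (K.hasFDerivAt (x, y)).comp x (hasFDerivAt_prodMk_left x y)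
    exact h1.mul_const (u y)

theorem integrable_smul_fderiv (K : 𝓢(V₂ × V₁, ℂ)) (u : Lp ℂ 2 (volume : Measure V₁)) (x : V₂) :
    Integrable fun y => u y • (fderiv ℝ K (x, y)).comp (ContinuousLinearMap.inl ℝ V₂ V₁) := by
  obtain ⟨C, hC0, hC⟩ := exists_kernel_bound (fderivCLM ℝ (V₂ × V₁) ℂ K) 0
  have hfc : Continuous fun y : V₁ => fderiv ℝ K (x, y) :=
    (fderivCLM ℝ (V₂ × V₁) ℂ K).continuous.comp (by fun_prop)
  refine Integrable.mono' ((integrable_bracket_mul u).const_mul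
    (C * ‖ContinuousLinearMap.inl ℝ V₂ V₁‖))
    ((Lp.aestronglyMeasurable u).smul (Continuous.aestronglyMeasurable (by fun_prop)))
    (ae_of_all _ fun y => ?_)
  rw [norm_smul]
  calc ‖u y‖ * ‖(fderiv ℝ K (x, y)).comp (ContinuousLinearMap.inl ℝ V₂ V₁)‖
      ≤ ‖u y‖ * (‖fderiv ℝ K (x, y)‖ * ‖ContinuousLinearMap.inl ℝ V₂ V₁‖) := by
        gcongr; exact ContinuousLinearMap.opNorm_comp_le _ _
    _ ≤ ‖u y‖ * ((C * (1 + ‖y‖ ^ 2) ^ (-decayExp V₁)) * ‖ContinuousLinearMap.inl ℝ V₂ V₁‖) := by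
        gcongr; simpa using hC x y
    _ = _ := by ring

/-- A derivative of the output is an output for another Schwartz kernel. Hence smoothness and all
seminorm bounds follow by induction on the order, with `K` varying. -/
theorem fderiv_integralOp_apply (K : 𝓢(V₂ × V₁, ℂ)) (u : Lp ℂ 2 (volume : Measure V₁))
    (x v : V₂) : fderiv ℝ (integralOp K u) x v =
      integralOp (∂_{((v, 0) : V₂ × V₁)} K) u x := by
  rw [(hasFDerivAt_integralOp K u x).fderiv, ContinuousLinearMap.integral_apply
    (integrable_smul_fderiv K u x)]
  congr 1 with y
  rw [lineDerivOp_apply_eq_fderiv]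
  simp [mul_comm]

theorem contDiff_integralOp (u : Lp ℂ 2 (volume : Measure V₁)) (K : 𝓢(V₂ × V₁, ℂ)) :
    ContDiff ℝ ∞ (integralOp K u) := by
  rw [contDiff_infty]
  intro n
  induction n generalizing K with
  | zero =>
    rw [Nat.cast_zero, contDiff_zero]
    exact continuous_iff_continuousAt.2 fun x => (hasFDerivAt_integralOp K u x).continuousAt
  | succ n ih =>
    rw [Nat.cast_succ, contDiff_succ_iff_fderiv_apply]
    refine ⟨fun x => (hasFDerivAt_integralOp K u x).differentiableAt, by simp, fun v => ?_⟩
    simp_rw [fderiv_integralOp_apply]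
    exact ih _

theorem exists_integralOp_bound (k n : ℕ) (K : 𝓢(V₂ × V₁, ℂ)) :
    ∃ C, 0 ≤ C ∧ ∀ (u : Lp ℂ 2 (volume : Measure V₁)) (x : V₂),
      ‖x‖ ^ k * ‖iteratedFDeriv ℝ n (integralOp K u) x‖ ≤ C * ‖u‖ := by
  induction n generalizing K with
  | zero =>
    obtain ⟨C, hC0, hC⟩ := norm_kernelSlice_le K k
    refine ⟨C, hC0, fun u x => ?_⟩
    rw [norm_iteratedFDeriv_zero, integralOp_eq_inner]
    have hx : ‖x‖ ^ k ≤ (1 + ‖x‖ ^ 2) ^ (k : ℝ) := by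
      rw [Real.rpow_natCast]
      gcongr
      nlinarith [sq_nonneg (‖x‖ - 1), norm_nonneg x]
    have h1 := (norm_inner_le_norm (𝕜 := ℂ) (kernelSlice K x) u)
    have h2 := hC x
    rw [Real.rpow_neg (by positivity), ← div_eq_mul_inv, le_div_iff₀ (by positivity)] at h2
    calc ‖x‖ ^ k * ‖inner ℂ (kernelSlice K x) u‖
        ≤ (1 + ‖x‖ ^ 2) ^ (k : ℝ) * (‖kernelSlice K x‖ * ‖u‖) := by gcongr
      _ = (‖kernelSlice K x‖ * (1 + ‖x‖ ^ 2) ^ (k : ℝ)) * ‖u‖ := by ring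
      _ ≤ C * ‖u‖ := by gcongr
  | succ n ih =>
    let b := (stdOrthonormalBasis ℝ V₂).toBasis
    obtain ⟨C, hC0, hC⟩ := exists_norm_iteratedFDeriv_succ_le b
    choose C' hC'0 hC' using fun j => ih (∂_{((b j, 0) : V₂ × V₁)} K)
    refine ⟨C * ∑ j, C' j, mul_nonneg hC0 (Finset.sum_nonneg fun j _ => hC'0 j), fun u x => ?_⟩
    calc ‖x‖ ^ k * ‖iteratedFDeriv ℝ (n + 1) (integralOp K u) x‖
        ≤ ‖x‖ ^ k * (C * ∑ j, ‖iteratedFDeriv ℝ n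
            (fun y => fderiv ℝ (integralOp K u) y (b j)) x‖) := by
          gcongr
          exact hC _ (contDiff_integralOp u K) n x
      _ = C * ∑ j, ‖x‖ ^ k * ‖iteratedFDeriv ℝ n
            (integralOp (∂_{((b j, 0) : V₂ × V₁)} K) u) x‖ := by
          rw [mul_left_comm, Finset.mul_sum]
          simp_rw [fderiv_integralOp_apply]
      _ ≤ C * ∑ j, C' j * ‖u‖ :=
          mul_le_mul_of_nonneg_left (Finset.sum_le_sum fun j _ => hC' j u x) hC0
      _ = _ := by rw [← Finset.sum_mul, mul_assoc]

/-- The integral operator with Schwartz kernel `K` as a linear map from `L²` to Schwartz space. -/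
noncomputable def kernelLM (K : 𝓢(V₂ × V₁, ℂ)) :
    Lp ℂ 2 (volume : Measure V₁) →ₗ[ℂ] 𝓢(V₂, ℂ) where
  toFun u :=
    { toFun := integralOp K u
      smooth' := contDiff_integralOp u K
      decay' := fun k n => by
        obtain ⟨C, -, hC⟩ := exists_integralOp_bound k n K
        exact ⟨_, hC u⟩ }
  map_add' u v := by
    ext x
    change integralOp K (u + v) x = integralOp K u x + integralOp K v x
    simp_rw [integralOp_eq_inner, inner_add_right]
  map_smul' c u := by
    ext x
    change integralOp K (c • u) x = c • integralOp K u x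
    simp_rw [integralOp_eq_inner, inner_smul_right]
    rfl

/-- The integral operator with Schwartz kernel `K` maps `L²` continuously into Schwartz space. -/
noncomputable def kernelCLM (K : 𝓢(V₂ × V₁, ℂ)) :
    Lp ℂ 2 (volume : Measure V₁) →L[ℂ] 𝓢(V₂, ℂ) :=
  ⟨kernelLM K, (schwartz_withSeminorms ℂ V₂ ℂ).continuous_normedSpace_dom _ _ fun i => by
    obtain ⟨C, hC0, hC⟩ := exists_integralOp_bound i.1 i.2 K
    exact ⟨⟨C, hC0⟩, fun u => seminorm_le_bound ℂ i.1 i.2 _ (mul_nonneg hC0 (norm_nonneg u))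
      fun x => hC u x⟩⟩

theorem kernelCLM_apply (K : 𝓢(V₂ × V₁, ℂ)) (u : Lp ℂ 2 (volume : Measure V₁)) (x : V₂) :
    kernelCLM K u x = inner ℂ (kernelSlice K x) u :=
  integralOp_eq_inner K u x

end Kernel

/-! ### Hilbert–Schmidt bound and the adjoint operator -/

section L2Theory

variable {V₁ V₂ : Type*} [NormedAddCommGroup V₁] [InnerProductSpace ℝ V₁] [FiniteDimensional ℝ V₁]
  [MeasurableSpace V₁] [BorelSpace V₁]
  [NormedAddCommGroup V₂] [InnerProductSpace ℝ V₂] [FiniteDimensional ℝ V₂]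
  [MeasurableSpace V₂] [BorelSpace V₂]

/-- Integral operators with Schwartz kernel are Hilbert-Schmidt. -/
theorem exists_sum_norm_sq_kernelCLM_le (K : 𝓢(V₂ × V₁, ℂ)) :
    ∃ C, ∀ {ι : Type} (t : Finset ι) (e : ι → Lp ℂ 2 (volume : Measure V₁)), Orthonormal ℂ e →
      ∑ i ∈ t, ‖(kernelCLM K (e i)).toLp 2 volume‖ ^ 2 ≤ C := by
  obtain ⟨C, hC0, hC⟩ := norm_kernelSlice_le K (decayExp V₂)
  refine ⟨∫ x : V₂, C ^ 2 * ((1 + ‖x‖ ^ 2) ^ (-decayExp V₂)) ^ 2, fun t e he => ?_⟩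
  have hsq : ∀ g : 𝓢(V₂, ℂ), ‖g.toLp 2 volume‖ ^ 2 = ∫ x, ‖g x‖ ^ 2 := fun g => by
    rw [norm_toLp' (by simp) (by simp), ← Real.rpow_natCast, ← Real.rpow_mul
      (integral_nonneg fun x => by positivity)]
    simp
  have hint : ∀ g : 𝓢(V₂, ℂ), Integrable (fun x => ‖g x‖ ^ 2) := fun g =>
    (SchwartzMap.memLp g 2 volume).integrable_norm_pow (by simp)
  simp_rw [hsq]
  rw [← integral_finsetSum _ fun i _ => hint _]
  refine integral_mono (integrable_finsetSum _ fun i _ => hint _)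
    -- At each fixed `x` the values are inner products with the kernel slice, so Bessel bounds the
    -- sum of their squares by the squared norm of the slice, which is integrable in `x`.
    ((memLp_bracket_neg V₂).integrable_sq.const_mul _) fun x => ?_
  have := he.sum_inner_products_le (kernelSlice K x) (s := t)
  simp only [kernelCLM_apply]
  rw [← mul_pow]
  refine le_trans (le_of_eq ?_) (this.trans (pow_le_pow_left₀ (norm_nonneg _) (hC x) 2))
  exact Finset.sum_congr rfl fun i _ => by rw [norm_inner_symm]

/-- Complex conjugation on Schwartz functions. -/
noncomputable def conjCLM (W : Type*) [NormedAddCommGroup W] [NormedSpace ℝ W] :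
    𝓢(W, ℂ) →L[ℝ] 𝓢(W, ℂ) :=
  postcompCLM (Complex.conjCLE : ℂ →L[ℝ] ℂ)

theorem conjCLM_apply {W : Type*} [NormedAddCommGroup W] [NormedSpace ℝ W] (f : 𝓢(W, ℂ)) (x : W) :
    conjCLM W f x = (starRingEnd ℂ) (f x) := rfl

/-- The kernel of the adjoint operator. -/
noncomputable def adjointKernel {V₁ V₂ : Type*} [NormedAddCommGroup V₁] [InnerProductSpace ℝ V₁]
    [NormedAddCommGroup V₂] [InnerProductSpace ℝ V₂] (K : 𝓢(V₂ × V₁, ℂ)) : 𝓢(V₁ × V₂, ℂ) :=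
  conjCLM _ (compCLMOfContinuousLinearEquiv ℝ (ContinuousLinearEquiv.prodComm ℝ V₁ V₂) K)

theorem adjointKernel_apply {V₁ V₂ : Type*} [NormedAddCommGroup V₁] [InnerProductSpace ℝ V₁]
    [NormedAddCommGroup V₂] [InnerProductSpace ℝ V₂] (K : 𝓢(V₂ × V₁, ℂ)) (y : V₁) (x : V₂) :
    adjointKernel K (y, x) = (starRingEnd ℂ) (K (x, y)) := rfl

theorem inner_kernelCLM (K : 𝓢(V₂ × V₁, ℂ)) (u : Lp ℂ 2 (volume : Measure V₂))
    (v : Lp ℂ 2 (volume : Measure V₁)) :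
    inner ℂ u ((kernelCLM K v).toLp 2 volume) =
      inner ℂ ((kernelCLM (adjointKernel K) u).toLp 2 volume) v := by
  obtain ⟨C, hC0, hC⟩ := exists_kernel_bound K (decayExp V₂)
  have h1 : inner ℂ u ((kernelCLM K v).toLp 2 volume) =
      ∫ x, ∫ y, (starRingEnd ℂ) (u x) * K (x, y) * v y := by
    rw [L2.inner_def]
    refine integral_congr_ae ?_
    filter_upwards [(kernelCLM K v).coeFn_toLp 2 volume] with x hx
    rw [hx, RCLike.inner_apply']
    simp_rw [mul_assoc]
    rw [integral_const_mul]
    rfl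
  have h2 : inner ℂ ((kernelCLM (adjointKernel K) u).toLp 2 volume) v =
      ∫ y, ∫ x, (starRingEnd ℂ) (u x) * K (x, y) * v y := by
    rw [L2.inner_def]
    refine integral_congr_ae ?_
    filter_upwards [(kernelCLM (adjointKernel K) u).coeFn_toLp 2 volume] with y hy
    rw [hy, RCLike.inner_apply', integral_mul_const]
    congr 1
    change (starRingEnd ℂ) (∫ x, adjointKernel K (y, x) * u x) = _
    rw [← integral_conj]
    congr 1 with x
    rw [adjointKernel_apply, map_mul, Complex.conj_conj, mul_comm]
  rw [h1, h2]
  refine integral_integral_swap ?_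
  refine Integrable.mono' (((integrable_bracket_mul u).mul_prod (integrable_bracket_mul v)).const_mul
    C) ?_ (ae_of_all _ fun z => ?_)
  · exact (((Complex.continuous_conj.comp_aestronglyMeasurable
      (Lp.aestronglyMeasurable u)).comp_fst).mul
      K.continuous.aestronglyMeasurable).mul (Lp.aestronglyMeasurable v).comp_snd
  · obtain ⟨x, y⟩ := z
    simp only [Function.uncurry, norm_mul, RCLike.norm_conj]
    calc ‖u x‖ * ‖K (x, y)‖ * ‖v y‖ ≤ ‖u x‖ * (C * (1 + ‖x‖ ^ 2) ^ (-decayExp V₂) *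
          (1 + ‖y‖ ^ 2) ^ (-decayExp V₁)) * ‖v y‖ := by gcongr; exact hC x y
      _ = _ := by ring

end L2Theory

end KernelExpansion

/-! ### Singular value decomposition of Hilbert–Schmidt operators -/

namespace KernelExpansion

/-- Dependent choice along initial segments. -/
theorem exists_seq_of_forall_prefix {α : Type*} [Nonempty α] (Q : ℕ → (ℕ → α) → α → Prop)
    (hcongr : ∀ n f g y, (∀ m < n, f m = g m) → Q n f y → Q n g y)
    (h : ∀ n f, (∀ m < n, Q m f (f m)) → ∃ y, Q n f y) : ∃ f : ℕ → α, ∀ n, Q n f (f n) := by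
  classical
  let c : ℕ → (ℕ → α) → α := fun n f => if h : ∃ y, Q n f y then h.choose else Classical.arbitrary α
  let F : ℕ → ℕ → α := fun n => Nat.rec (fun _ => Classical.arbitrary α) (fun n f => Function.update f n (c n f)) n
  have hF : ∀ n, F (n + 1) = Function.update (F n) n (c n (F n)) := fun n => rfl
  have hstab : ∀ n m k, m < n → F (n + k) m = F n m := by
    intro n m k hm
    induction k with
    | zero => rfl
    | succ k ih => rw [← add_assoc, hF, Function.update_of_ne (by omega), ih]
  have hagree : ∀ n m, m < n → F n m = F (m + 1) m := by
    intro n m hm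
    obtain ⟨k, rfl⟩ := Nat.exists_eq_add_of_lt hm
    rw [show m + k + 1 = (m + 1) + k by ring]
    exact hstab _ _ _ (Nat.lt_succ_self m)
  refine ⟨fun n => F (n + 1) n, fun n => ?_⟩
  induction n using Nat.strong_induction_on with
  | _ n ih =>
    have hex : ∃ y, Q n (F n) y := by
      refine h n (F n) fun m hm => ?_
      rw [hagree n m hm]
      exact hcongr m _ _ _ (fun k hk => (hagree n k (hk.trans hm)).symm) (ih m hm)
    have hval : F (n + 1) n = hex.choose := by
      rw [hF, Function.update_self]
      exact dif_pos hex
    change Q n _ (F (n + 1) n)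
    rw [hval]
    exact hcongr n _ _ _ (fun m hm => hagree n m hm) hex.choose_spec

section SVD

variable {H₁ H₂ : Type*} [NormedAddCommGroup H₁] [InnerProductSpace ℂ H₁]
  [NormedAddCommGroup H₂] [InnerProductSpace ℂ H₂]

/-- Otherwise one could keep choosing unit vectors orthogonal to the earlier ones with image longer
than `ε`, and the resulting orthonormal sequence would violate the Hilbert–Schmidt bound. -/
theorem exists_finiteDimensional_norm_le {A : H₁ →L[ℂ] H₂} {C : ℝ}
    (hA : ∀ (t : Finset ℕ) (e : ℕ → H₁), Orthonormal ℂ e → ∑ i ∈ t, ‖A (e i)‖ ^ 2 ≤ C)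
    {ε : ℝ} (hε : 0 < ε) :
    ∃ F : Finset H₁, ∀ x, (∀ y ∈ F, inner ℂ y x = 0) → ‖A x‖ ≤ ε * ‖x‖ := by
  by_contra! hcon
  obtain ⟨e, he, horth⟩ := exists_seq_of_forall_finset_exists
    (fun x : H₁ => ‖x‖ = 1 ∧ ε < ‖A x‖) (fun x y => inner ℂ x y = 0) (fun F _ => by
      obtain ⟨x, hx, hlt⟩ := hcon F
      have hx0 : 0 < ‖x‖ := by
        rw [norm_pos_iff]
        rintro rfl
        simp at hlt
      refine ⟨((‖x‖⁻¹ : ℝ) : ℂ) • x, ⟨?_, ?_⟩, fun y hy => ?_⟩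
      · rw [norm_smul, Complex.norm_real, norm_inv, norm_norm, inv_mul_cancel₀ hx0.ne']
      · rw [map_smul, norm_smul, Complex.norm_real, norm_inv, norm_norm, inv_mul_eq_div,
          lt_div_iff₀ hx0]
        exact hlt
      · rw [inner_smul_right, hx y hy, mul_zero])
  have hon : Orthonormal ℂ e := by
    refine ⟨fun i => (he i).1, fun i j hij => ?_⟩
    rcases lt_or_gt_of_ne hij with h | h
    · exact horth i j h
    · exact inner_eq_zero_symm.1 (horth j i h)
  obtain ⟨n, hn⟩ := exists_nat_gt (C / ε ^ 2)
  have h1 := hA (Finset.range n) e hon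
  have h2 : ∑ i ∈ Finset.range n, ε ^ 2 ≤ ∑ i ∈ Finset.range n, ‖A (e i)‖ ^ 2 :=
    Finset.sum_le_sum fun i _ => by gcongr; exact (he i).2.le
  rw [Finset.sum_const, Finset.card_range, nsmul_eq_mul] at h2
  rw [div_lt_iff₀ (by positivity)] at hn
  linarith

/-- Finitely many linear conditions cannot be injective on an infinite-dimensional space. This
supplies singular vectors after the singular values have become zero. -/
theorem exists_mem_norm_eq_one_orthogonal {D : Submodule ℂ H₁} (hD : ¬ FiniteDimensional ℂ D)
    (n : ℕ) (f : ℕ → H₁) : ∃ v ∈ D, ‖v‖ = 1 ∧ ∀ m < n, inner ℂ (f m) v = 0 := by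
  let ℓ : D →ₗ[ℂ] (Fin n → ℂ) :=
    LinearMap.pi fun m => ((innerSL ℂ (f m)).toLinearMap).comp D.subtype
  have hℓ : ¬ Function.Injective ℓ := fun h => hD (FiniteDimensional.of_injective ℓ h)
  rw [← LinearMap.ker_eq_bot, Submodule.eq_bot_iff] at hℓ
  push Not at hℓ
  obtain ⟨x, hx, hx0⟩ := hℓ
  have hx0' : ‖(x : H₁)‖ ≠ 0 := by simpa using hx0
  refine ⟨((‖(x : H₁)‖⁻¹ : ℝ) : ℂ) • (x : H₁), D.smul_mem _ x.2, ?_, fun m hm => ?_⟩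
  · rw [norm_smul, Complex.norm_real, norm_inv, norm_norm, inv_mul_cancel₀ hx0']
  · have h1 : inner ℂ (f m) (x : H₁) = 0 := congrFun (LinearMap.mem_ker.1 hx) ⟨m, hm⟩
    rw [inner_smul_right, h1, mul_zero]

/-- A nonzero compact operator attains its norm at a singular vector. -/
theorem exists_norm_eq_one_and_comp_eq {T : H₁ →L[ℂ] H₂} {T' : H₂ →L[ℂ] H₁}
    (hT' : ∀ u v, inner ℂ u (T v) = inner ℂ (T' u) v) (hT : IsCompactOperator T) (h0 : T ≠ 0) :
    ∃ x, ‖x‖ = 1 ∧ T' (T x) = ((‖T‖ ^ 2 : ℝ) : ℂ) • x := by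
  set s := ‖T‖ with hs
  have hs0 : 0 < s := norm_pos_iff.2 h0
  have hT'le : ∀ y, ‖T' y‖ ≤ s * ‖y‖ := by
    intro y
    by_cases hy : ‖T' y‖ = 0
    · rw [hy]; positivity
    have h1 : ‖T' y‖ ^ 2 ≤ ‖y‖ * (s * ‖T' y‖) := by
      calc ‖T' y‖ ^ 2 = ‖(inner ℂ (T' y) (T' y) : ℂ)‖ := by
            rw [inner_self_eq_norm_sq_to_K]; simp
        _ = ‖(inner ℂ y (T (T' y)) : ℂ)‖ := by rw [hT']
        _ ≤ ‖y‖ * ‖T (T' y)‖ := norm_inner_le_norm _ _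
        _ ≤ _ := by gcongr; exact T.le_opNorm _
    have h2 : 0 < ‖T' y‖ := lt_of_le_of_ne (norm_nonneg _) (Ne.symm hy)
    nlinarith
  -- Quantitative form of the fact that maximizers of `‖T x‖` on the unit ball are eigenvectors of
  -- `T' T`: near-maximizers are approximate eigenvectors.
  have hkey : ∀ x, ‖x‖ ≤ 1 → ‖T' (T x) - ((s ^ 2 : ℝ) : ℂ) • x‖ ^ 2 ≤ s ^ 2 * (s ^ 2 - ‖T x‖ ^ 2) := by
    intro x hx
    have h1 : RCLike.re (inner ℂ (T' (T x)) (((s ^ 2 : ℝ) : ℂ) • x) : ℂ) = s ^ 2 * ‖T x‖ ^ 2 := by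
      rw [inner_smul_right, ← hT', inner_self_eq_norm_sq_to_K]
      simp only [← Complex.ofReal_pow, ← Complex.ofReal_mul, Complex.coe_algebraMap]
      exact Complex.ofReal_re _
    rw [@norm_sub_sq ℂ, h1, norm_smul, Complex.norm_real, Real.norm_of_nonneg (by positivity)]
    have h2 : ‖T' (T x)‖ ^ 2 ≤ (s * ‖T x‖) ^ 2 := by gcongr; exact hT'le _
    have h3 : (s ^ 2 * ‖x‖) ^ 2 ≤ s ^ 4 := by
      rw [mul_pow, ← pow_mul]
      exact mul_le_of_le_one_right (by positivity) (pow_le_one₀ (norm_nonneg x) hx)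
    nlinarith
  have hex : ∀ n : ℕ, ∃ x, ‖x‖ ≤ 1 ∧ s - 1 / ((n : ℝ) + 1) < ‖T x‖ := fun n => by
    obtain ⟨x, hx, hlt⟩ := T.exists_lt_apply_of_lt_opNorm
      (show s - 1 / ((n : ℝ) + 1) < ‖T‖ by rw [← hs]; linarith [Nat.one_div_pos_of_nat (α := ℝ) (n := n)])
    exact ⟨x, hx.le, hlt⟩
  choose x hx1 hxlt using hex
  have hTx : Tendsto (fun n => ‖T (x n)‖) atTop (𝓝 s) := by
    refine tendsto_of_tendsto_of_tendsto_of_le_of_le (g := fun n : ℕ => s - 1 / ((n : ℝ) + 1))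
      (h := fun _ => s) ?_ tendsto_const_nhds (fun n => (hxlt n).le) fun n => ?_
    · simpa using tendsto_const_nhds.sub (tendsto_one_div_add_atTop_nhds_zero_nat (𝕜 := ℝ))
    · exact (T.le_opNorm _).trans (mul_le_of_le_one_right hs0.le (hx1 n))
  obtain ⟨S, hS, hTS⟩ := hT.image_closedBall_subset_compact (1 : ℝ)
  obtain ⟨y, -, φ, hφ, hy⟩ := hS.tendsto_subseq (x := fun n => T (x n)) fun n =>
    hTS ⟨x n, by simpa using hx1 n, rfl⟩
  have hdiff : Tendsto (fun n => T' (T (x n)) - ((s ^ 2 : ℝ) : ℂ) • x n) atTop (𝓝 0) := by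
    rw [tendsto_zero_iff_norm_tendsto_zero]
    have h1 : Tendsto (fun n => s ^ 2 * (s ^ 2 - ‖T (x n)‖ ^ 2)) atTop (𝓝 0) := by
      have h2 := ((tendsto_const_nhds (x := s ^ 2)).sub (hTx.pow 2)).const_mul (s ^ 2)
      rwa [sub_self, mul_zero] at h2
    have h2 := squeeze_zero (fun n => by positivity) (fun n => hkey (x n) (hx1 n)) h1
    have h3 := h2.sqrt
    simpa using h3
  have hsne : ((s ^ 2 : ℝ) : ℂ) ≠ 0 := by exact_mod_cast (pow_pos hs0 2).ne'
  -- Compactness only makes `T (x n)` converge along `φ`. Since `s ^ 2 • x n` is close to `T' (T (x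
  -- n))`, the vectors `x (φ n)` themselves converge, without completeness of `H₁`.
  have hlim : Tendsto (fun n => x (φ n)) atTop (𝓝 (((s ^ 2 : ℝ) : ℂ)⁻¹ • T' y)) := by
    have h1 := (((T'.continuous.tendsto y).comp hy).sub
      (hdiff.comp hφ.tendsto_atTop)).const_smul (((s ^ 2 : ℝ) : ℂ)⁻¹)
    rw [sub_zero] at h1
    refine h1.congr fun n => ?_
    simp only [Function.comp_apply, sub_sub_cancel]
    rw [smul_smul, inv_mul_cancel₀ hsne, one_smul]
  set z := ((s ^ 2 : ℝ) : ℂ)⁻¹ • T' y with hz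
  have hTz : Tendsto (fun n => T (x (φ n))) atTop (𝓝 (T z)) := (T.continuous.tendsto z).comp hlim
  have hTzn : ‖T z‖ = s :=
    tendsto_nhds_unique hTz.norm (hTx.comp hφ.tendsto_atTop)
  refine ⟨z, le_antisymm ?_ ?_, ?_⟩
  · exact le_of_tendsto hlim.norm (Eventually.of_forall fun n => hx1 _)
  · have h1 := T.le_opNorm z
    rw [hTzn, ← hs] at h1
    nlinarith
  · have hyz : y = T z := tendsto_nhds_unique hy hTz
    rw [← hyz, hz, smul_smul, mul_inv_cancel₀ hsne, one_smul]

/-- `A` is a norm limit of its compositions with projections onto finite-dimensional subspaces,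
because it is small on the orthogonal complement of such a subspace. -/
theorem isCompactOperator_of_sum_norm_sq_le [CompleteSpace H₂] {A : H₁ →L[ℂ] H₂} {C : ℝ}
    (hA : ∀ (t : Finset ℕ) (e : ℕ → H₁), Orthonormal ℂ e → ∑ i ∈ t, ‖A (e i)‖ ^ 2 ≤ C) :
    IsCompactOperator A := by
  suffices A ∈ closure {f : H₁ →L[ℂ] H₂ | IsCompactOperator f} by
    rwa [isClosed_setOfPred_isCompactOperator.closure_eq] at this
  rw [Metric.mem_closure_iff]
  intro ε hε
  obtain ⟨F, hF⟩ := exists_finiteDimensional_norm_le hA (half_pos hε)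
  let U : Submodule ℂ H₁ := Submodule.span ℂ (F : Set H₁)
  have : FiniteDimensional ℂ U := FiniteDimensional.span_finset ℂ F
  refine ⟨A ∘L U.starProjection, ?_, ?_⟩
  · have h1 : IsCompactOperator (A ∘L U.subtypeL) := by
      have : ProperSpace U := FiniteDimensional.proper ℂ U
      exact isCompactOperator_of_locallyCompactSpace_rng _
    exact h1.comp_clm U.orthogonalProjectionOnto
  · rw [dist_eq_norm]
    refine lt_of_le_of_lt (ContinuousLinearMap.opNorm_le_bound _ (half_pos hε).le fun x => ?_)
      (half_lt_self hε)
    have hx : x - U.starProjection x ∈ Uᗮ := U.sub_starProjection_mem_orthogonal x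
    have h2 := hF (x - U.starProjection x) fun y hy =>
      (Submodule.mem_orthogonal U _).1 hx y (Submodule.subset_span hy)
    have h3 : ‖x - U.starProjection x‖ ≤ ‖x‖ := by
      have h4 := Submodule.norm_sq_eq_add_norm_sq_starProjection x U
      rw [Submodule.starProjection_orthogonal_val] at h4
      refine le_of_sq_le_sq ?_ (norm_nonneg x)
      nlinarith [sq_nonneg ‖U.starProjection x‖]
    simp only [sub_apply, ContinuousLinearMap.comp_apply]
    rw [← map_sub]
    exact h2.trans (by gcongr)

/-- The defining properties of the next triple `(v, u, s)` of a singular value decomposition of `A`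
(with adjoint `B`) after the first `n` triples of the sequence `f`. -/
structure IsNextTriple (A : H₁ →L[ℂ] H₂) (B : H₂ →L[ℂ] H₁) (D₁ : Submodule ℂ H₁)
    (D₂ : Submodule ℂ H₂) (n : ℕ) (f : ℕ → H₁ × H₂ × ℝ) (y : H₁ × H₂ × ℝ) : Prop where
  mem₁ : y.1 ∈ D₁
  mem₂ : y.2.1 ∈ D₂
  norm₁ : ‖y.1‖ = 1
  norm₂ : ‖y.2.1‖ = 1
  orth₁ : ∀ m < n, inner ℂ (f m).1 y.1 = 0
  orth₂ : ∀ m < n, inner ℂ (f m).2.1 y.2.1 = 0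
  nonneg : 0 ≤ y.2.2
  map₁ : A y.1 = (y.2.2 : ℂ) • y.2.1
  map₂ : B y.2.1 = (y.2.2 : ℂ) • y.1
  max : ∀ x, (∀ m < n, inner ℂ (f m).1 x = 0) → ‖A x‖ ≤ y.2.2 * ‖x‖

/-- Either `A` vanishes on the orthogonal complement of the earlier `v`s, and any new unit vectors
from `D₁` and `D₂` serve with singular value `0`, or the restriction of `A` to that complement
attains its norm. In the second case both vectors are multiples of values of `B` and `A`, hence lie
in the prescribed subspaces. -/
theorem exists_isNextTriple {A : H₁ →L[ℂ] H₂} {B : H₂ →L[ℂ] H₁}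
    (hAB : ∀ u v, inner ℂ u (A v) = inner ℂ (B u) v) (hA : IsCompactOperator A)
    {D₁ : Submodule ℂ H₁} {D₂ : Submodule ℂ H₂} (hD₁ : ¬ FiniteDimensional ℂ D₁)
    (hD₂ : ¬ FiniteDimensional ℂ D₂) (hAD : ∀ x, A x ∈ D₂) (hBD : ∀ y, B y ∈ D₁) (n : ℕ)
    (f : ℕ → H₁ × H₂ × ℝ) (hf : ∀ m < n, IsNextTriple A B D₁ D₂ m f (f m)) :
    ∃ y, IsNextTriple A B D₁ D₂ n f y := by
  have hBA : ∀ u v, inner ℂ u (B v) = inner ℂ (A u) v := fun u v => by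
    rw [← inner_conj_symm, ← hAB, inner_conj_symm]
  let U : Submodule ℂ H₁ := Submodule.span ℂ ((fun m => (f m).1) '' (Finset.range n : Set ℕ))
  have : FiniteDimensional ℂ U :=
    FiniteDimensional.span_of_finite ℂ ((Finset.range n).finite_toSet.image _)
  have hU : ∀ x, x ∈ Uᗮ ↔ ∀ m < n, inner ℂ (f m).1 x = 0 := by
    intro x
    rw [Submodule.mem_orthogonal]
    constructor
    · exact fun h m hm => h _ (Submodule.subset_span ⟨m, by simpa using hm, rfl⟩)
    · intro h u hu
      induction hu using Submodule.span_induction with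
      | mem u hu =>
        obtain ⟨m, hm, rfl⟩ := hu
        exact h m (by simpa using hm)
      | zero => simp
      | add u v _ _ h1 h2 => rw [inner_add_left, h1, h2, add_zero]
      | smul c u _ h1 => rw [inner_smul_left, h1, mul_zero]
  have hPx : ∀ x ∈ Uᗮ, Uᗮ.starProjection x = x := fun x hx =>
    Submodule.starProjection_eq_self_iff.2 hx
  by_cases h0 : A ∘L Uᗮ.starProjection = 0
  · have hA0 : ∀ x ∈ Uᗮ, A x = 0 := fun x hx => by
      have := congrArg (fun T : H₁ →L[ℂ] H₂ => T x) h0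
      simpa [hPx x hx] using this
    obtain ⟨v, hvD, hv1, hv⟩ := exists_mem_norm_eq_one_orthogonal hD₁ n fun m => (f m).1
    obtain ⟨u, huD, hu1, hu⟩ := exists_mem_norm_eq_one_orthogonal hD₂ n fun m => (f m).2.1
    refine ⟨(v, u, 0), hvD, huD, hv1, hu1, hv, hu, le_rfl, ?_, ?_, fun x hx => ?_⟩
    · simp [hA0 v ((hU v).2 hv)]
    · have hBu : B u ∈ Uᗮ := (hU _).2 fun m hm => by
        rw [hBA, (hf m hm).map₁, inner_smul_left, hu m hm, mul_zero]
      -- Orthogonality of `u` to the earlier left vectors puts `B u` into the complement on which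
      -- `A` vanishes, so `‖B u‖² = ⟨u, A (B u)⟩ = 0`.
      have : inner ℂ (B u) (B u) = 0 := by rw [← hAB, hA0 _ hBu, inner_zero_right]
      simpa using this
    · simp [hA0 x ((hU x).2 hx)]
  · have hadj : ∀ u v, inner ℂ u ((A ∘L Uᗮ.starProjection) v) =
        inner ℂ ((Uᗮ.starProjection ∘L B) u) v := fun u v => by
      simp only [ContinuousLinearMap.comp_apply]
      rw [hAB, Submodule.inner_starProjection_left_eq_right]
    obtain ⟨x, hx1, hx⟩ := exists_norm_eq_one_and_comp_eq hadj (hA.comp_clm _) h0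
    set s := ‖A ∘L Uᗮ.starProjection‖ with hs
    have hs0 : 0 < s := norm_pos_iff.2 h0
    have hsne : (s : ℂ) ≠ 0 := by exact_mod_cast hs0.ne'
    have hsne2 : ((s ^ 2 : ℝ) : ℂ) ≠ 0 := by exact_mod_cast (pow_pos hs0 2).ne'
    have hxU : x ∈ Uᗮ := by
      have h1 : x = ((s ^ 2 : ℝ) : ℂ)⁻¹ • ((s ^ 2 : ℝ) : ℂ) • x := by
        rw [smul_smul, inv_mul_cancel₀ hsne2, one_smul]
      rw [h1, ← hx]
      exact Uᗮ.smul_mem _ (Submodule.starProjection_apply_mem _ _)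
    -- The projection in the eigenvalue equation can be dropped, because `B A` leaves the orthogonal
    -- complement of the earlier vectors invariant.
    have hBAx : B (A x) = ((s ^ 2 : ℝ) : ℂ) • x := by
      simp only [ContinuousLinearMap.comp_apply, hPx x hxU] at hx
      rw [← hx, hPx]
      refine (hU _).2 fun m hm => ?_
      rw [hBA, (hf m hm).map₁, inner_smul_left, hAB, (hf m hm).map₂, inner_smul_left,
        (hU x).1 hxU m hm, mul_zero, mul_zero]
    have hAx : ‖A x‖ = s := by
      have h1 : (inner ℂ (A x) (A x) : ℂ) = ((s ^ 2 : ℝ) : ℂ) := by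
        rw [hAB, hBAx, inner_smul_left, inner_self_eq_norm_sq_to_K, hx1]
        simp
      rw [inner_self_eq_norm_sq_to_K] at h1
      have h2 : ‖A x‖ ^ 2 = s ^ 2 := by
        have h3 : ((‖A x‖ ^ 2 : ℝ) : ℂ) = ((s ^ 2 : ℝ) : ℂ) := by rw [← h1]; simp
        exact_mod_cast h3
      exact (sq_eq_sq₀ (norm_nonneg _) hs0.le).1 h2
    refine ⟨(x, (s : ℂ)⁻¹ • A x, s), ?_, D₂.smul_mem _ (hAD x), hx1, ?_, (hU x).1 hxU,
      fun m hm => ?_, hs0.le, ?_, ?_, fun w hw => ?_⟩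
    · have h1 : x = ((s ^ 2 : ℝ) : ℂ)⁻¹ • B (A x) := by
        rw [hBAx, smul_smul, inv_mul_cancel₀ hsne2, one_smul]
      change x ∈ D₁
      rw [h1]
      exact D₁.smul_mem _ (hBD _)
    · change ‖(s : ℂ)⁻¹ • A x‖ = 1
      rw [norm_smul, norm_inv, Complex.norm_real, Real.norm_of_nonneg hs0.le, hAx,
        inv_mul_cancel₀ hs0.ne']
    · change inner ℂ (f m).2.1 ((s : ℂ)⁻¹ • A x) = 0
      rw [inner_smul_right, hAB, (hf m hm).map₂, inner_smul_left, (hU x).1 hxU m hm, mul_zero,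
        mul_zero]
    · change A x = (s : ℂ) • (s : ℂ)⁻¹ • A x
      rw [smul_smul, mul_inv_cancel₀ hsne, one_smul]
    · change B ((s : ℂ)⁻¹ • A x) = (s : ℂ) • x
      rw [map_smul, hBAx, smul_smul]
      congr 1
      push_cast
      field_simp
    · have h1 := (A ∘L Uᗮ.starProjection).le_opNorm w
      simpa [hPx w ((hU w).2 hw)] using h1

/-- Singular value decomposition of a Hilbert-Schmidt operator `A` with adjoint `B`, with singular
vectors in prescribed subspaces that contain the ranges of `A` and `B`. -/
theorem exists_singular_value_decomposition [CompleteSpace H₂] {A : H₁ →L[ℂ] H₂} {B : H₂ →L[ℂ] H₁}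
    (hAB : ∀ u v, inner ℂ u (A v) = inner ℂ (B u) v) {C : ℝ}
    (hA : ∀ (t : Finset ℕ) (e : ℕ → H₁), Orthonormal ℂ e → ∑ i ∈ t, ‖A (e i)‖ ^ 2 ≤ C)
    {D₁ : Submodule ℂ H₁} {D₂ : Submodule ℂ H₂} (hD₁ : ¬ FiniteDimensional ℂ D₁)
    (hD₂ : ¬ FiniteDimensional ℂ D₂) (hAD : ∀ x, A x ∈ D₂) (hBD : ∀ y, B y ∈ D₁) :
    ∃ (v : ℕ → H₁) (u : ℕ → H₂) (s : ℕ → ℝ), (∀ j, v j ∈ D₁) ∧ (∀ j, u j ∈ D₂) ∧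
      Orthonormal ℂ v ∧ Orthonormal ℂ u ∧ (∀ j, 0 ≤ s j) ∧ Antitone s ∧
      (∀ j, A (v j) = (s j : ℂ) • u j) ∧ (∀ j, B (u j) = (s j : ℂ) • v j) ∧
      ∀ x, (∀ j, inner ℂ (v j) x = 0) → A x = 0 := by
  obtain ⟨f, hf⟩ := exists_seq_of_forall_prefix (IsNextTriple A B D₁ D₂)
    (fun n f g y hfg h => ⟨h.mem₁, h.mem₂, h.norm₁, h.norm₂,
      fun m hm => by rw [← hfg m hm]; exact h.orth₁ m hm,
      fun m hm => by rw [← hfg m hm]; exact h.orth₂ m hm, h.nonneg, h.map₁, h.map₂,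
      fun x hx => h.max x fun m hm => by rw [hfg m hm]; exact hx m hm⟩)
    (exists_isNextTriple hAB (isCompactOperator_of_sum_norm_sq_le hA) hD₁ hD₂ hAD hBD)
  have hv : Orthonormal ℂ fun j => (f j).1 := by
    refine ⟨fun i => (hf i).norm₁, fun i j hij => ?_⟩
    rcases lt_or_gt_of_ne hij with h | h
    · exact (hf j).orth₁ i h
    · exact inner_eq_zero_symm.1 ((hf i).orth₁ j h)
  have hu : Orthonormal ℂ fun j => (f j).2.1 := by
    refine ⟨fun i => (hf i).norm₂, fun i j hij => ?_⟩
    rcases lt_or_gt_of_ne hij with h | h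
    · exact (hf j).orth₂ i h
    · exact inner_eq_zero_symm.1 ((hf i).orth₂ j h)
  have hAv : ∀ j, ‖A (f j).1‖ = (f j).2.2 := fun j => by
    rw [(hf j).map₁, norm_smul, (hf j).norm₂, mul_one, Complex.norm_real,
      Real.norm_of_nonneg (hf j).nonneg]
  refine ⟨fun j => (f j).1, fun j => (f j).2.1, fun j => (f j).2.2, fun j => (hf j).mem₁,
    fun j => (hf j).mem₂, hv, hu, fun j => (hf j).nonneg, antitone_nat_of_succ_le fun j => ?_,
    fun j => (hf j).map₁, fun j => (hf j).map₂, fun x hx => ?_⟩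
  · have h1 := (hf j).max (f (j + 1)).1 fun m hm => (hf (j + 1)).orth₁ m (by omega)
    rwa [hAv, (hf (j + 1)).norm₁, mul_one] at h1
  · by_contra hne
    have hAx : 0 < ‖A x‖ := norm_pos_iff.2 hne
    have hx0 : 0 < ‖x‖ := by
      rw [norm_pos_iff]
      rintro rfl
      simp at hne
    -- A vector orthogonal to all `v j` competes in every maximization, so `A x ≠ 0` would keep all
    -- singular values away from zero, against the Hilbert–Schmidt bound.
    have hlow : ∀ j, ‖A x‖ / ‖x‖ ≤ ‖A (f j).1‖ := fun j => by
      rw [hAv, div_le_iff₀ hx0]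
      exact (hf j).max x fun m _ => hx m
    obtain ⟨n, hn⟩ := exists_nat_gt (C / (‖A x‖ / ‖x‖) ^ 2)
    have h1 := hA (Finset.range n) _ hv
    have h2 : ∑ i ∈ Finset.range n, (‖A x‖ / ‖x‖) ^ 2 ≤ ∑ i ∈ Finset.range n, ‖A (f i).1‖ ^ 2 :=
      Finset.sum_le_sum fun i _ => by gcongr; exact hlow i
    rw [Finset.sum_const, Finset.card_range, nsmul_eq_mul] at h2
    rw [div_lt_iff₀ (by positivity)] at hn
    linarith

end SVD

end KernelExpansion

/-! ### Rapidly decaying sequences of numbers and of Schwartz functions -/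

namespace KernelExpansion

/-- A nonnegative sequence that decays faster than every power of `j + 1`. -/
def RapidDecay (a : ℕ → ℝ) : Prop :=
  ∀ N : ℕ, ∃ C, 0 ≤ C ∧ ∀ j : ℕ, ((j : ℝ) + 1) ^ N * a j ≤ C

theorem RapidDecay.rpow {s : ℕ → ℝ} (hs : RapidDecay s) (h0 : ∀ j, 0 ≤ s j) {a : ℝ} (ha : 0 < a) :
    RapidDecay fun j => s j ^ a := by
  intro N
  obtain ⟨m, hm⟩ := exists_nat_ge (N / a)
  obtain ⟨C, hC0, hC⟩ := hs m
  refine ⟨C ^ a, by positivity, fun j => ?_⟩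
  have hj : (0 : ℝ) < (j : ℝ) + 1 := by positivity
  have hs0 := h0 j
  calc ((j : ℝ) + 1) ^ N * s j ^ a = (((j : ℝ) + 1) ^ (N / a) * s j) ^ a := by
        rw [Real.mul_rpow (by positivity) hs0, ← Real.rpow_mul hj.le, div_mul_cancel₀ _ ha.ne',
          Real.rpow_natCast]
    _ ≤ (((j : ℝ) + 1) ^ (m : ℝ) * s j) ^ a := by
        gcongr
        linarith [(Nat.cast_nonneg j : (0 : ℝ) ≤ j)]
    _ ≤ C ^ a := by
        rw [Real.rpow_natCast]
        gcongr
        exact hC j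

theorem summable_of_sq_mul_le {a : ℕ → ℝ} (h0 : ∀ j, 0 ≤ a j) {C : ℝ}
    (h : ∀ j : ℕ, ((j : ℝ) + 1) ^ 2 * a j ≤ C) : Summable a := by
  have h1 : Summable fun j : ℕ => 1 / ((j : ℝ) + 1) ^ 2 := by
    have := (summable_nat_add_iff 1).2 (Real.summable_one_div_nat_pow.2 (le_refl 2))
    simpa using this
  refine Summable.of_nonneg_of_le h0 (fun j => ?_) (h1.mul_left C)
  rw [mul_one_div, le_div_iff₀ (by positivity), mul_comm]
  exact h j

section Seminorms

variable {V : Type*} [NormedAddCommGroup V] [NormedSpace ℝ V]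

/-- A sequence of Schwartz functions all of whose seminorms decay rapidly. -/
def SchwartzRapidDecay (f : ℕ → 𝓢(V, ℂ)) : Prop :=
  ∀ k n : ℕ, RapidDecay fun j => SchwartzMap.seminorm ℝ k n (f j)

theorem exists_pos_schwartzRapidDecay (v : ℕ → 𝓢(V, ℂ)) :
    ∃ ε : ℕ → ℝ, (∀ j, 0 < ε j) ∧ ∀ k n : ℕ,
      RapidDecay fun j => ε j * SchwartzMap.seminorm ℝ k n (v j) := by
  let q : ℕ → ℝ := fun j => (Finset.Iic (j, j)).sup (schwartzSeminormFamily ℝ V ℂ) (v j)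
  have hq0 : ∀ j, 0 ≤ q j := fun j => by positivity
  -- Diagonal choice: once `j ≥ k + n + N`, the factor `(j + 1) ^ j` beats `(j + 1) ^ N` and `q j`
  -- dominates the `(k, n)` seminorm, so the term is at most `1`. The finitely many earlier terms
  -- are added to the constant.
  refine ⟨fun j => 1 / (((j : ℝ) + 1) ^ j * (1 + q j)), fun j => ?_, fun k n N => ?_⟩
  · have := hq0 j
    positivity
  set t : ℕ → ℝ := fun j => ((j : ℝ) + 1) ^ N *
    (1 / (((j : ℝ) + 1) ^ j * (1 + q j)) * SchwartzMap.seminorm ℝ k n (v j)) with ht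
  have ht0 : ∀ j, 0 ≤ t j := fun j => by
    have := hq0 j
    simp only [ht]
    positivity
  refine ⟨1 + ∑ j ∈ Finset.range (k + n + N), t j,
    add_nonneg zero_le_one (Finset.sum_nonneg fun j _ => ht0 j), fun j => ?_⟩
  change t j ≤ _
  rcases lt_or_ge j (k + n + N) with h | h
  · have := Finset.single_le_sum (fun j _ => ht0 j) (Finset.mem_range.2 h)
    linarith
  · have h1 : SchwartzMap.seminorm ℝ k n (v j) ≤ q j := by
      have h2 : schwartzSeminormFamily ℝ V ℂ (k, n) ≤
          (Finset.Iic (j, j)).sup (schwartzSeminormFamily ℝ V ℂ) :=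
        Finset.le_sup (Finset.mem_Iic.2 ⟨by simp only; omega, by simp only; omega⟩)
      exact h2 (v j)
    have h3 : t j ≤ 1 := by
      have h4 := hq0 j
      simp only [ht]
      rw [one_div_mul_eq_div, mul_div_assoc', div_le_one (by positivity)]
      have h5 : ((j : ℝ) + 1) ^ N ≤ ((j : ℝ) + 1) ^ j :=
        pow_le_pow_right₀ (by linarith [(Nat.cast_nonneg j : (0 : ℝ) ≤ j)]) (by omega)
      gcongr
      linarith
    have := Finset.sum_nonneg fun j (_ : j ∈ Finset.range (k + n + N)) => ht0 j
    linarith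

theorem SchwartzRapidDecay.exists_bound {f : ℕ → 𝓢(V, ℂ)} (hf : SchwartzRapidDecay f) (m N : ℕ) :
    ∃ C, 0 ≤ C ∧ ∀ (j : ℕ) (x : V), ((j : ℝ) + 1) ^ N * ((1 + ‖x‖) ^ m * ‖f j x‖) ≤ C := by
  obtain ⟨C₀, hC₀0, hC₀⟩ := hf 0 0 N
  obtain ⟨C₁, hC₁0, hC₁⟩ := hf m 0 N
  refine ⟨2 ^ (m - 1) * (C₀ + C₁), by positivity, fun j x => ?_⟩
  have h1 := add_pow_le zero_le_one (norm_nonneg x) m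
  have h2 := norm_le_seminorm ℝ (f j) x
  have h3 := norm_pow_mul_le_seminorm ℝ (f j) m x
  calc ((j : ℝ) + 1) ^ N * ((1 + ‖x‖) ^ m * ‖f j x‖)
      ≤ ((j : ℝ) + 1) ^ N * ((2 ^ (m - 1) * (1 ^ m + ‖x‖ ^ m)) * ‖f j x‖) := by gcongr
    _ = 2 ^ (m - 1) * (((j : ℝ) + 1) ^ N * ‖f j x‖ +
          ((j : ℝ) + 1) ^ N * (‖x‖ ^ m * ‖f j x‖)) := by rw [one_pow]; ring
    _ ≤ 2 ^ (m - 1) * (C₀ + C₁) := by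
        gcongr
        · exact le_trans (by gcongr) (hC₀ j)
        · exact le_trans (by gcongr) (hC₁ j)

theorem seminorm_conjCLM_le (k n : ℕ) (f : 𝓢(V, ℂ)) :
    SchwartzMap.seminorm ℝ k n (conjCLM V f) ≤ SchwartzMap.seminorm ℝ k n f := by
  refine seminorm_le_bound ℝ k n _ (by positivity) fun x => ?_
  have h : ‖iteratedFDeriv ℝ n (Complex.conjLIE ∘ f) x‖ = ‖iteratedFDeriv ℝ n f x‖ :=
    Complex.conjLIE.norm_iteratedFDeriv_comp_left f x n
  change ‖x‖ ^ k * ‖iteratedFDeriv ℝ n (Complex.conjLIE ∘ f) x‖ ≤ _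
  rw [h]
  exact le_seminorm ℝ k n f x

theorem SchwartzRapidDecay.conj {f : ℕ → 𝓢(V, ℂ)} (hf : SchwartzRapidDecay f) :
    SchwartzRapidDecay fun j => conjCLM V (f j) := by
  intro k n N
  obtain ⟨C, hC0, hC⟩ := hf k n N
  refine ⟨C, hC0, fun j => le_trans ?_ (hC j)⟩
  gcongr
  exact seminorm_conjCLM_le k n (f j)

end Seminorms

/-! ### Singular systems of Schwartz kernels and decay of the singular values -/

section SingularSystem

variable {V₁ V₂ : Type*} [NormedAddCommGroup V₁] [InnerProductSpace ℝ V₁] [FiniteDimensional ℝ V₁]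
  [MeasurableSpace V₁] [BorelSpace V₁]
  [NormedAddCommGroup V₂] [InnerProductSpace ℝ V₂] [FiniteDimensional ℝ V₂]
  [MeasurableSpace V₂] [BorelSpace V₂]

/-- Bumps of radius `1 / 2` around the points `n • e`, with `e` a unit vector, are separated by
evaluation at these points. This is where positive dimension is needed. -/
theorem not_finiteDimensional_range_toLpCLM [Nontrivial V₁] :
    ¬ FiniteDimensional ℂ (LinearMap.range
      (toLpCLM ℂ ℂ 2 (volume : Measure V₁)).toLinearMap) := by
  intro hfin
  obtain ⟨e, he⟩ := exists_norm_eq V₁ (zero_le_one' ℝ)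
  let b : ∀ n : ℕ, ContDiffBump ((n : ℝ) • e) := fun n => ⟨1 / 4, 1 / 2, by norm_num, by norm_num⟩
  have hc : ∀ n, HasCompactSupport fun x => ((b n x : ℝ) : ℂ) := fun n =>
    (b n).hasCompactSupport.comp_left (g := Complex.ofReal) Complex.ofReal_zero
  have hd : ∀ n, ContDiff ℝ ∞ fun x => ((b n x : ℝ) : ℂ) := fun n =>
    Complex.ofRealCLM.contDiff.comp (b n).contDiff
  let f : ℕ → 𝓢(V₁, ℂ) := fun n => (hc n).toSchwartzMap (hd n)
  let ev : 𝓢(V₁, ℂ) →ₗ[ℂ] (ℕ → ℂ) :=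
    { toFun := fun g n => g ((n : ℝ) • e)
      map_add' := fun _ _ => rfl
      map_smul' := fun _ _ => rfl }
  have hev : ∀ n, ev (f n) = Pi.single n 1 := by
    intro n
    ext m
    change ((b n ((m : ℝ) • e) : ℝ) : ℂ) = _
    rcases eq_or_ne m n with rfl | hmn
    · rw [Pi.single_eq_same, (b m).one_of_mem_closedBall (Metric.mem_closedBall_self (by norm_num [b]))]
      simp
    · rw [Pi.single_eq_of_ne hmn, (b n).zero_of_le_dist]
      · simp
      · rw [dist_eq_norm, ← sub_smul, norm_smul, he, mul_one]
        have h1 : (1 : ℝ) ≤ |(m : ℝ) - n| := by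
          have : (1 : ℤ) ≤ |(m : ℤ) - n| := Int.one_le_abs (by omega)
          exact_mod_cast this
        change (1 / 2 : ℝ) ≤ _
        rw [Real.norm_eq_abs]
        linarith
  have hlin : LinearIndependent ℂ f := by
    refine LinearIndependent.of_comp ev ?_
    have : (ev ∘ f) = fun n => Pi.single n (1 : ℂ) := funext hev
    rw [this]
    exact Pi.linearIndependent_single_one ℕ ℂ
  have hlin2 : LinearIndependent ℂ
      ((toLpCLM ℂ ℂ 2 (volume : Measure V₁)).toLinearMap.rangeRestrict ∘ f) := by
    refine hlin.map' _ (LinearMap.ker_eq_bot.2 fun x y hxy => ?_)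
    exact injective_toLp 2 volume (congrArg Subtype.val hxy)
  exact not_finite_iff_infinite.2 inferInstance hlin2.finite

/-- A singular system of the integral operator with Schwartz kernel `K`. -/
structure IsSingularSystem (K : 𝓢(V₂ × V₁, ℂ)) (v : ℕ → 𝓢(V₁, ℂ)) (u : ℕ → 𝓢(V₂, ℂ))
    (s : ℕ → ℝ) : Prop where
  orthonormal₁ : Orthonormal ℂ fun j => (v j).toLp 2 volume
  orthonormal₂ : Orthonormal ℂ fun j => (u j).toLp 2 volume
  nonneg : ∀ j, 0 ≤ s j
  antitone : Antitone s
  map₁ : ∀ j, kernelCLM K ((v j).toLp 2 volume) = (s j : ℂ) • u j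
  map₂ : ∀ j, kernelCLM (adjointKernel K) ((u j).toLp 2 volume) = (s j : ℂ) • v j
  map_eq_zero : ∀ x, (∀ j, inner ℂ ((v j).toLp 2 volume) x = 0) → kernelCLM K x = 0

theorem exists_isSingularSystem [Nontrivial V₁] [Nontrivial V₂] (K : 𝓢(V₂ × V₁, ℂ)) :
    ∃ v u s, IsSingularSystem K v u s := by
  obtain ⟨C, hC⟩ := exists_sum_norm_sq_kernelCLM_le K
  obtain ⟨v', u', s, hv', hu', hv, hu, hs0, hs, hAv, hBu, hker⟩ :=
    exists_singular_value_decomposition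
      (A := toLpCLM ℂ ℂ 2 (volume : Measure V₂) ∘L kernelCLM K)
      (B := toLpCLM ℂ ℂ 2 (volume : Measure V₁) ∘L kernelCLM (adjointKernel K))
      (inner_kernelCLM K) (C := C) (fun t e he => hC t e he)
      (not_finiteDimensional_range_toLpCLM (V₁ := V₁))
      (not_finiteDimensional_range_toLpCLM (V₁ := V₂))
      (fun x => ⟨_, rfl⟩) (fun y => ⟨_, rfl⟩)
  choose v hv'' using hv'
  choose u hu'' using hu'
  obtain rfl : (fun j => (v j).toLp 2 volume) = v' := funext hv''
  obtain rfl : (fun j => (u j).toLp 2 volume) = u' := funext hu''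
  exact ⟨v, u, s, hv, hu, hs0, hs, fun j => injective_toLp 2 volume (hAv j),
    fun j => injective_toLp 2 volume (hBu j),
    fun x hx => injective_toLp 2 volume ((hker x hx).trans
      (map_zero (toLpCLM ℂ ℂ 2 (volume : Measure V₂))).symm)⟩

namespace IsSingularSystem

variable {K : 𝓢(V₂ × V₁, ℂ)} {v : ℕ → 𝓢(V₁, ℂ)} {u : ℕ → 𝓢(V₂, ℂ)} {s : ℕ → ℝ}

/-- `s j • L (v j)` is the image of the unit vector `u j` under a bounded operator on `L²`, because
the adjoint kernel operator is continuous into the Schwartz space. -/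
theorem exists_bound_left (h : IsSingularSystem K v u s) (L : 𝓢(V₁, ℂ) →L[ℂ] 𝓢(V₁, ℂ)) :
    ∃ C, ∀ i : {j // 0 < s j}, ‖(L (v i)).toLp 2 volume‖ ≤ C / s i := by
  let T := toLpCLM ℂ ℂ 2 (volume : Measure V₁) ∘L L ∘L kernelCLM (adjointKernel K)
  refine ⟨‖T‖, fun ⟨j, hj⟩ => ?_⟩
  have h1 := T.le_opNorm ((u j).toLp 2 volume)
  have h2 : T ((u j).toLp 2 volume) = (s j : ℂ) • (L (v j)).toLp 2 volume := by
    change toLpCLM ℂ ℂ 2 volume (L (kernelCLM (adjointKernel K) ((u j).toLp 2 volume))) = _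
    rw [h.map₂, map_smul, map_smul]
    rfl
  rw [h2, norm_smul, Complex.norm_real, Real.norm_of_nonneg hj.le, h.orthonormal₂.1, mul_one] at h1
  rw [le_div_iff₀ hj, mul_comm]
  exact h1

theorem exists_bound_right (h : IsSingularSystem K v u s) (L : 𝓢(V₂, ℂ) →L[ℂ] 𝓢(V₂, ℂ)) :
    ∃ C, ∀ i : {j // 0 < s j}, ‖(L (u i)).toLp 2 volume‖ ≤ C / s i := by
  let T := toLpCLM ℂ ℂ 2 (volume : Measure V₂) ∘L L ∘L kernelCLM K
  refine ⟨‖T‖, fun ⟨j, hj⟩ => ?_⟩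
  have h1 := T.le_opNorm ((v j).toLp 2 volume)
  have h2 : T ((v j).toLp 2 volume) = (s j : ℂ) • (L (u j)).toLp 2 volume := by
    change toLpCLM ℂ ℂ 2 volume (L (kernelCLM K ((v j).toLp 2 volume))) = _
    rw [h.map₁, map_smul, map_smul]
    rfl
  rw [h2, norm_smul, Complex.norm_real, Real.norm_of_nonneg hj.le, h.orthonormal₁.1, mul_one] at h1
  rw [le_div_iff₀ hj, mul_comm]
  exact h1

/-- The singular values of an integral operator with Schwartz kernel decay rapidly. -/
theorem rapidDecay (h : IsSingularSystem K v u s) : RapidDecay s := by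
  intro N
  obtain ⟨L, hL, C, hC0, hC⟩ := exists_card_le_of_orthonormal (V := V₁)
  -- The counting bound squares the growth, so order `N + 1` yields the exponent `2⁻ᴺ`.
  obtain ⟨C', hC'0, hC'⟩ := formalAdjoint_growth (v := fun i : {j // 0 < s j} => v i)
    (s := fun i => s i) (fun i => i.2) (fun i => h.orthonormal₁.1 i) h.exists_bound_left (N + 1) L hL
  refine ⟨(C * C' ^ 2) ^ (2 ^ N), by positivity, fun j => ?_⟩
  rcases (h.nonneg j).eq_or_lt with h0 | hj
  · rw [← h0, mul_zero]
    positivity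
  have h1 := hC (Finset.range (j + 1)) v (C' * s j ^ (-(1 / 2 : ℝ) ^ (N + 1))) h.orthonormal₁
    fun i hi => by
      -- By monotonicity the growth bound at `j` serves for all of the `j + 1` vectors `v 0, …, v j`
      -- at once.
      have hij : s j ≤ s i := h.antitone (by simpa [Nat.lt_succ_iff] using hi)
      refine (hC' ⟨i, hj.trans_le hij⟩).trans ?_
      refine mul_le_mul_of_nonneg_left ?_ hC'0
      exact Real.rpow_le_rpow_of_nonpos hj hij (by simp)
  have h2 : ((j : ℝ) + 1) * s j ^ ((1 / 2 : ℝ) ^ N) ≤ C * C' ^ 2 := by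
    have h3 : (s j ^ (-(1 / 2 : ℝ) ^ (N + 1))) ^ 2 = (s j ^ ((1 / 2 : ℝ) ^ N))⁻¹ := by
      rw [← Real.rpow_natCast (s j ^ _), ← Real.rpow_mul hj.le, ← Real.rpow_neg hj.le]
      congr 1
      push_cast
      ring
    rw [mul_pow, h3, ← mul_assoc, ← div_eq_mul_inv, le_div_iff₀ (by positivity)] at h1
    simpa using h1
  have hN : (N : ℕ) ≤ 2 ^ N := Nat.lt_two_pow_self.le
  calc ((j : ℝ) + 1) ^ N * s j ≤ ((j : ℝ) + 1) ^ (2 ^ N) * s j := by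
        gcongr
        linarith [(Nat.cast_nonneg j : (0 : ℝ) ≤ j)]
    _ = (((j : ℝ) + 1) * s j ^ ((1 / 2 : ℝ) ^ N)) ^ (2 ^ N) := by
        rw [mul_pow, ← Real.rpow_natCast (s j ^ _), ← Real.rpow_mul hj.le]
        congr 1
        push_cast
        rw [← mul_pow]
        norm_num
    _ ≤ _ := by gcongr

end IsSingularSystem

/-- Rescaling by `s j ^ (1 / 4)` where `s j > 0`, and by suitable positive constants elsewhere,
makes the singular vectors decay rapidly. -/
theorem exists_scaling {s : ℕ → ℝ} (hs : ∀ j, 0 ≤ s j) (hrapid : RapidDecay s)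
    {v : ℕ → 𝓢(V₁, ℂ)} (hv : ∀ j, ‖(v j).toLp 2 volume‖ = 1)
    (hb : ∀ L : 𝓢(V₁, ℂ) →L[ℂ] 𝓢(V₁, ℂ), ∃ C, ∀ i : {j // 0 < s j},
      ‖(L (v i)).toLp 2 volume‖ ≤ C / s i) :
    ∃ c : ℕ → ℝ, (∀ j, 0 < c j) ∧ (∀ j, 0 < s j → c j = s j ^ (1 / 4 : ℝ)) ∧
      SchwartzRapidDecay fun j => (c j : ℂ) • v j := by
  obtain ⟨ε, hε0, hε⟩ := exists_pos_schwartzRapidDecay v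
  refine ⟨fun j => if 0 < s j then s j ^ (1 / 4 : ℝ) else ε j, fun j => ?_,
    fun j hj => if_pos hj, fun k n N => ?_⟩
  · dsimp only
    split_ifs with hj
    · positivity
    · exact hε0 j
  · obtain ⟨C, hC0, hC⟩ := hε k n N
    -- Three halvings bound the seminorms by a multiple of `s j ^ (-1 / 8)`. Against the scaling `s
    -- j ^ (1 / 4)` this leaves `s j ^ (1 / 8)`, which still decays rapidly.
    obtain ⟨C', hC'0, hC'⟩ := seminorm_growth (v := fun i : {j // 0 < s j} => v i)
      (s := fun i => s i) (fun i => i.2) (fun i => hv i) hb 3 k n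
    obtain ⟨C'', hC''0, hC''⟩ := hrapid.rpow hs (show (0 : ℝ) < 1 / 8 by norm_num) N
    refine ⟨C + C'' * C', by positivity, fun j => ?_⟩
    have hsm : ∀ c : ℝ, 0 < c → SchwartzMap.seminorm ℝ k n ((c : ℂ) • v j) =
        c * SchwartzMap.seminorm ℝ k n (v j) := fun c hc => by
      have : ((c : ℂ) • v j) = c • v j := by ext x; simp
      rw [this, map_smul_eq_mul, Real.norm_of_nonneg hc.le]
    dsimp only
    split_ifs with hj
    · rw [hsm _ (by positivity)]
      calc ((j : ℝ) + 1) ^ N * (s j ^ (1 / 4 : ℝ) * SchwartzMap.seminorm ℝ k n (v j))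
          ≤ ((j : ℝ) + 1) ^ N * (s j ^ (1 / 4 : ℝ) * (C' * s j ^ (-(1 / 2 : ℝ) ^ 3))) := by
            gcongr
            exact hC' ⟨j, hj⟩
        _ = (((j : ℝ) + 1) ^ N * s j ^ (1 / 8 : ℝ)) * C' := by
            have : s j ^ (1 / 8 : ℝ) = s j ^ (1 / 4 : ℝ) * s j ^ (-(1 / 2 : ℝ) ^ 3) := by
              rw [← Real.rpow_add hj]
              norm_num
            rw [this]
            ring
        _ ≤ C'' * C' := by gcongr; exact hC'' j
        _ ≤ _ := by linarith
    · rw [hsm _ (hε0 j)]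
      exact (hC j).trans (by have := mul_nonneg hC''0 hC'0; linarith)

end SingularSystem

end KernelExpansion

/-! ### Pointwise convergence of the singular value expansion -/

namespace KernelExpansion

/-- A vector that is orthogonal to the orthogonal complement of an orthonormal sequence is the sum
of its Fourier series, provided that the latter converges absolutely. -/
theorem hasSum_of_orthonormal {H : Type*} [NormedAddCommGroup H] [InnerProductSpace ℂ H]
    [CompleteSpace H] {v : ℕ → H} (hv : Orthonormal ℂ v) {k : H}
    (hk : ∀ x, (∀ j, inner ℂ (v j) x = 0) → inner ℂ k x = 0)
    (hs : Summable fun j => ‖(inner ℂ (v j) k : ℂ)‖) :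
    HasSum (fun j => (inner ℂ (v j) k : ℂ) • v j) k := by
  have hs' : Summable fun j => (inner ℂ (v j) k : ℂ) • v j := by
    refine Summable.of_norm (hs.congr fun j => ?_)
    rw [norm_smul, hv.1 j, mul_one]
  obtain ⟨w, hw⟩ := hs'
  -- The defect `k - w` is orthogonal to every `v i`, hence to `k` by `hk` and to the sum `w`, and
  -- therefore to itself.
  have horth : ∀ i, inner ℂ (v i) (k - w) = 0 := fun i => by
    have h1 := hw.mapL (innerSL ℂ (v i))
    have h2 : HasSum (fun j => innerSL ℂ (v i) ((inner ℂ (v j) k : ℂ) • v j)) (inner ℂ (v i) k) := by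
      convert hasSum_ite_eq i (inner ℂ (v i) k : ℂ) using 2 with j
      rw [innerSL_apply_apply, inner_smul_right, orthonormal_iff_ite.1 hv]
      by_cases h : i = j
      · simp [h]
      · simp [h, Ne.symm h]
    rw [inner_sub_right, sub_eq_zero]
    exact h2.unique h1
  have h1 : inner ℂ w (k - w) = 0 := by
    have h2 := hw.mapL (innerSL ℂ (k - w))
    have h3 : ∀ j, innerSL ℂ (k - w) ((inner ℂ (v j) k : ℂ) • v j) = 0 := fun j => by
      rw [innerSL_apply_apply, inner_smul_right, inner_eq_zero_symm.1 (horth j), mul_zero]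
    simp_rw [h3] at h2
    exact inner_eq_zero_symm.1 (h2.unique hasSum_zero)
  have h2 : inner ℂ (k - w) (k - w) = 0 := by
    rw [inner_sub_left, hk _ horth, h1, sub_zero]
  rw [sub_eq_zero.1 (inner_self_eq_zero.1 h2)]
  exact sub_eq_zero.1 (inner_self_eq_zero.1 h2) ▸ hw

section Expansion

variable {V₁ V₂ : Type*} [NormedAddCommGroup V₁] [InnerProductSpace ℝ V₁] [FiniteDimensional ℝ V₁]
  [MeasurableSpace V₁] [BorelSpace V₁]
  [NormedAddCommGroup V₂] [InnerProductSpace ℝ V₂] [FiniteDimensional ℝ V₂]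
  [MeasurableSpace V₂] [BorelSpace V₂]

/-- A series of Schwartz functions that converges uniformly and in `L²` has the same sum in both
senses. -/
theorem ae_eq_tsum {f : ℕ → 𝓢(V₁, ℂ)} {k : Lp ℂ 2 (volume : Measure V₁)}
    (hk : HasSum (fun j => (f j).toLp 2 volume) k) (hf : ∀ y, Summable fun j => f j y) :
    k =ᵐ[volume] fun y => ∑' j, f j y := by
  have h1 : Tendsto (fun n => (∑ j ∈ Finset.range n, f j).toLp 2 volume) atTop (𝓝 k) := by
    refine hk.tendsto_sum_nat.congr fun n => ?_
    exact (map_sum (toLpCLM ℂ ℂ 2 (volume : Measure V₁)) f (Finset.range n)).symm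
  obtain ⟨ns, hns, hae⟩ := (tendstoInMeasure_of_tendsto_Lp h1).exists_seq_tendsto_ae
  have hcoe : ∀ᵐ y, ∀ n, (∑ j ∈ Finset.range n, f j).toLp 2 volume y =
      (∑ j ∈ Finset.range n, f j) y := ae_all_iff.2 fun n => coeFn_toLp _ 2 volume
  filter_upwards [hae, hcoe] with y hy hy'
  have h2 : Tendsto (fun n => ∑ j ∈ Finset.range n, f j y) atTop (𝓝 (∑' j, f j y)) :=
    (hf y).hasSum.tendsto_sum_nat
  refine tendsto_nhds_unique hy ((h2.comp hns.tendsto_atTop).congr fun n => ?_)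
  rw [hy', sum_apply]
  rfl

/-- Pointwise convergence of the singular value expansion of a Schwartz kernel. -/
theorem IsSingularSystem.hasSum {K : 𝓢(V₂ × V₁, ℂ)} {v : ℕ → 𝓢(V₁, ℂ)} {u : ℕ → 𝓢(V₂, ℂ)}
    {s : ℕ → ℝ} (h : IsSingularSystem K v u s) (x : V₂) (hs : Summable fun j => s j * ‖u j x‖)
    {a : ℕ → ℝ} (ha : Summable a) (hb : ∀ j y, s j * ‖u j x‖ * ‖v j y‖ ≤ a j) (y : V₁) :
    HasSum (fun j => (s j : ℂ) * ((starRingEnd ℂ) (v j y) * u j x)) (K (x, y)) := by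
  have hcoef : ∀ j, inner ℂ ((v j).toLp 2 volume) (kernelSlice K x) =
      (starRingEnd ℂ) ((s j : ℂ) * u j x) := fun j => by
    rw [← inner_conj_symm, ← kernelCLM_apply, h.map₁]
    rfl
  have hnorm : ∀ j, ‖(starRingEnd ℂ) ((s j : ℂ) * u j x)‖ = s j * ‖u j x‖ := fun j => by
    rw [RCLike.norm_conj, norm_mul, Complex.norm_real, Real.norm_of_nonneg (h.nonneg j)]
  have h1 := hasSum_of_orthonormal h.orthonormal₁ (k := kernelSlice K x)
    (fun z hz => by rw [← kernelCLM_apply, h.map_eq_zero z hz]; rfl)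
    (by simp_rw [hcoef, hnorm]; exact hs)
  simp_rw [hcoef] at h1
  set f : ℕ → 𝓢(V₁, ℂ) := fun j => (starRingEnd ℂ) ((s j : ℂ) * u j x) • v j with hf
  have hfb : ∀ j y, ‖f j y‖ ≤ a j := fun j y => by
    rw [hf]
    simp only [smul_apply, smul_eq_mul, norm_mul (_ : ℂ) (v j y), hnorm]
    exact hb j y
  have hsum : ∀ y, Summable fun j => f j y := fun y =>
    Summable.of_norm_bounded ha fun j => hfb j y
  have h2 := ae_eq_tsum (f := f) h1 hsum
  have hcont : Continuous fun y => ∑' j, f j y :=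
    continuous_tsum (fun j => (f j).continuous) ha hfb
  -- The `L²` expansion of the slice identifies the two sides almost everywhere. Both are
  -- continuous, the series by uniform convergence, so they agree at every point.
  have h3 : (fun y => (starRingEnd ℂ) (K (x, y))) = fun y => ∑' j, f j y :=
    (Continuous.ae_eq_iff_eq volume (by fun_prop) hcont).1
      ((memLp_kernel K x).coeFn_toLp.symm.trans h2)
  have h4 := (hsum y).hasSum
  rw [← congrFun h3 y] at h4
  have h5 := h4.map (starRingEnd ℂ) Complex.continuous_conj
  rw [Complex.conj_conj] at h5
  refine h5.congr_fun ?_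
  intro j
  simp only [hf, Function.comp_apply, smul_apply, smul_eq_mul, map_mul, Complex.conj_conj]
  ring

end Expansion

/-! ### `L²` convergence from weighted uniform bounds -/

section L2Convergence

/-- Convergence in `L²` of a series of functions with a weighted uniform bound. -/
theorem tendsto_eLpNorm_sub_sum {W : Type*} [NormedAddCommGroup W] [MeasurableSpace W]
    [BorelSpace W] [SecondCountableTopology W] (μ : Measure W) [hμ : μ.HasTemperateGrowth] :
    ∃ m : ℕ, ∀ (K : W → ℂ) (g : ℕ → W → ℂ) (a : ℕ → ℝ), Summable a →
      (∀ j x, (1 + ‖x‖) ^ m * ‖g j x‖ ≤ a j) → (∀ x, HasSum (fun j => g j x) (K x)) →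
      Tendsto (fun n : ℕ => eLpNorm (fun x => K x - ∑ j ∈ Finset.range n, g j x) 2 μ)
        atTop (𝓝 0) := by
  obtain ⟨m, hm⟩ := hμ.exists_eLpNorm_lt_top 2
  refine ⟨m, fun K g a ha hg hK => ?_⟩
  have hbound : ∀ n : ℕ, eLpNorm (fun x => K x - ∑ j ∈ Finset.range n, g j x) 2 μ ≤
      ENNReal.ofReal (∑' j, a (j + n)) *
        eLpNorm (fun x : W => (1 + ‖x‖) ^ (-(m : ℝ))) 2 μ := fun n => by
    refine eLpNorm_le_mul_eLpNorm_of_ae_le_mul (ae_of_all _ fun x => ?_) 2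
    have hx : 0 < (1 + ‖x‖) ^ m := by positivity
    have h1 : K x - ∑ j ∈ Finset.range n, g j x = ∑' j, g (j + n) x := by
      rw [← (hK x).tsum_eq, ← (hK x).summable.sum_add_tsum_nat_add n, add_sub_cancel_left]
    have h2 : Summable fun j => a (j + n) / (1 + ‖x‖) ^ m :=
      ((summable_nat_add_iff n).2 ha).div_const _
    have h3 : ∀ j, ‖g (j + n) x‖ ≤ a (j + n) / (1 + ‖x‖) ^ m := fun j => by
      rw [le_div_iff₀ hx, mul_comm]
      exact hg _ x
    rw [h1, Real.norm_of_nonneg (by positivity), Real.rpow_neg (by positivity), Real.rpow_natCast,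
      ← div_eq_mul_inv, ← tsum_div_const]
    exact tsum_of_norm_bounded h2.hasSum h3
  have hlim : Tendsto (fun n : ℕ => ENNReal.ofReal (∑' j, a (j + n)) *
      eLpNorm (fun x : W => (1 + ‖x‖) ^ (-(m : ℝ))) 2 μ) atTop (𝓝 0) := by
    have h1 := ENNReal.tendsto_ofReal (tendsto_sum_nat_add a)
    rw [ENNReal.ofReal_zero] at h1
    have h2 := ENNReal.Tendsto.mul_const (b := eLpNorm (fun x : W => (1 + ‖x‖) ^ (-(m : ℝ))) 2 μ) h1
      (Or.inr hm.ne)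
    rwa [zero_mul] at h2
  exact tendsto_of_tendsto_of_tendsto_of_le_of_le tendsto_const_nhds hlim (fun n => zero_le)
    hbound

end L2Convergence

end KernelExpansion

/-! ### Iterated directional derivatives -/

namespace KernelExpansion

open LineDeriv

section IterDeriv

variable {W : Type*} [NormedAddCommGroup W] [NormedSpace ℝ W]

/-- The iterated directional derivative of `φ` along the vectors of the list `l`. -/
noncomputable def iterDeriv (l : List W) (φ : W → ℂ) : W → ℂ :=
  l.foldr (fun v ψ x => fderiv ℝ ψ x v) φ

theorem iterDeriv_cons (v : W) (l : List W) (φ : W → ℂ) :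
    iterDeriv (v :: l) φ = fun x => fderiv ℝ (iterDeriv l φ) x v := rfl

theorem iterDeriv_append (l₁ l₂ : List W) (φ : W → ℂ) :
    iterDeriv (l₁ ++ l₂) φ = iterDeriv l₁ (iterDeriv l₂ φ) := by
  simp [iterDeriv]

theorem contDiff_fderiv_apply {φ : W → ℂ} (hφ : ContDiff ℝ ∞ φ) (v : W) :
    ContDiff ℝ ∞ fun x => fderiv ℝ φ x v :=
  (hφ.fderiv_right (m := ∞) (by simp)).clm_apply contDiff_const

theorem hasCompactSupport_fderiv_apply {φ : W → ℂ} (hφ : HasCompactSupport φ) (v : W) :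
    HasCompactSupport fun x => fderiv ℝ φ x v :=
  (hφ.fderiv ℝ).comp_left (g := fun T : W →L[ℝ] ℂ => T v) rfl

theorem contDiff_iterDeriv {φ : W → ℂ} (hφ : ContDiff ℝ ∞ φ) (l : List W) :
    ContDiff ℝ ∞ (iterDeriv l φ) := by
  induction l with
  | nil => exact hφ
  | cons v l ih => exact contDiff_fderiv_apply ih v

theorem hasCompactSupport_iterDeriv {φ : W → ℂ} (hφ : HasCompactSupport φ) (l : List W) :
    HasCompactSupport (iterDeriv l φ) := by
  induction l with
  | nil => exact hφ
  | cons v l ih => exact hasCompactSupport_fderiv_apply ih v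

theorem fderiv_fderiv_comm {φ : W → ℂ} (hφ : ContDiff ℝ ∞ φ) (v w x : W) :
    fderiv ℝ (fun y => fderiv ℝ φ y v) x w = fderiv ℝ (fun y => fderiv ℝ φ y w) x v := by
  have hd : DifferentiableAt ℝ (fderiv ℝ φ) x :=
    ((hφ.fderiv_right (m := ∞) (by simp)).differentiable (by simp)) x
  rw [fderiv_clm_apply hd (by fun_prop), fderiv_clm_apply hd (by fun_prop)]
  have hsymm : IsSymmSndFDerivAt ℝ φ x := hφ.contDiffAt.isSymmSndFDerivAt (by
    rw [minSmoothness_of_isRCLikeNormedField]; exact ENat.LEInfty.out)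
  simpa using hsymm w v

theorem iterDeriv_perm {φ : W → ℂ} (hφ : ContDiff ℝ ∞ φ) {l₁ l₂ : List W} (h : l₁.Perm l₂) :
    iterDeriv l₁ φ = iterDeriv l₂ φ := by
  induction h with
  | nil => rfl
  | cons v _ ih => rw [iterDeriv_cons, iterDeriv_cons, ih]
  | swap v w l =>
    ext x
    exact fderiv_fderiv_comm (contDiff_iterDeriv hφ l) v w x
  | trans _ _ ih₁ ih₂ => rw [ih₁, ih₂]

/-- Integration by parts for iterated directional derivatives. -/
theorem integral_iterDeriv_mul [FiniteDimensional ℝ W] [MeasurableSpace W] [BorelSpace W]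
    (μ : Measure W) [μ.IsAddHaarMeasure] {f φ : W → ℂ} (hf : ContDiff ℝ ∞ f)
    (hφ : ContDiff ℝ ∞ φ) (hc : HasCompactSupport φ) (l : List W) :
    ∫ x, iterDeriv l f x * φ x ∂μ = (-1) ^ l.length * ∫ x, f x * iterDeriv l φ x ∂μ := by
  induction l generalizing φ with
  | nil => simp [iterDeriv]
  | cons v l ih =>
    have hf' := contDiff_iterDeriv hf l
    have hint : ∀ g ψ : W → ℂ, ContDiff ℝ ∞ g → ContDiff ℝ ∞ ψ → HasCompactSupport ψ →
        Integrable (fun x => g x * ψ x) μ := fun g ψ hg hψ hψc =>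
      (hg.continuous.mul hψ.continuous).integrable_of_hasCompactSupport hψc.mul_left
    have hparts := integral_mul_fderiv_eq_neg_fderiv_mul_of_integrable (μ := μ)
      (f := iterDeriv l f) (g := φ) (v := v)
      (hint _ _ (contDiff_fderiv_apply hf' v) hφ hc)
      (hint _ _ hf' (contDiff_fderiv_apply hφ v) (hasCompactSupport_fderiv_apply hc v))
      (hint _ _ hf' hφ hc) (fun x _ => hf'.differentiable (by simp) x)
      (fun x _ => hφ.differentiable (by simp) x)
    have h1 := ih (contDiff_fderiv_apply hφ v) (hasCompactSupport_fderiv_apply hc v)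
    -- The induction hypothesis places the new derivative innermost; symmetry of second derivatives
    -- moves it to the front.
    have h2 : iterDeriv l (fun x => fderiv ℝ φ x v) = iterDeriv (v :: l) φ := by
      rw [iterDeriv_perm hφ (List.perm_append_singleton v l).symm, iterDeriv_append]
      rfl
    rw [h2] at h1
    rw [← neg_eq_iff_eq_neg] at hparts
    simp only [iterDeriv_cons v l f, List.length_cons]
    rw [← hparts, h1]
    ring

/-- Iterated directional derivatives of Schwartz functions. -/
noncomputable def iterDerivCLM (l : List W) : 𝓢(W, ℂ) →L[ℝ] 𝓢(W, ℂ) :=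
  l.foldr (fun v T => lineDerivOpCLM ℝ 𝓢(W, ℂ) v ∘L T) (ContinuousLinearMap.id ℝ _)

theorem coe_iterDerivCLM (l : List W) (f : 𝓢(W, ℂ)) :
    (iterDerivCLM l f : W → ℂ) = iterDeriv l f := by
  induction l with
  | nil => rfl
  | cons v l ih =>
    rw [iterDeriv_cons, ← ih]
    ext x
    exact lineDerivOp_apply_eq_fderiv v (iterDerivCLM l f) x

end IterDeriv

/-! ### Multi-indices and weighted norms of weak derivatives -/

section MultiIndex

variable {d : ℕ}

/-- The list of indices that contains each `i` exactly `β i` times. -/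
def indexList (β : Fin d → ℕ) : List (Fin d) :=
  (List.finRange d).flatMap fun i => List.replicate (β i) i

theorem length_indexList (β : Fin d → ℕ) : (indexList β).length = ∑ i, β i := by
  simp [indexList, List.length_flatMap, List.sum_ofFn, Finset.sum_fin_eq_sum_range,
    ← List.ofFn_eq_map]

theorem count_indexList (β : Fin d → ℕ) (i : Fin d) : (indexList β).count i = β i := by
  have h1 : ∀ l : List (Fin d), l.Nodup → (l.flatMap fun i => List.replicate (β i) i).count i =
      if i ∈ l then β i else 0 := by
    intro l hl
    induction l with
    | nil => simp
    | cons k l ih =>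
      rw [List.nodup_cons] at hl
      rw [List.flatMap_cons, List.count_append, ih hl.2, List.count_replicate]
      by_cases hk : k = i
      · subst hk
        simp [hl.1]
      · simp [hk, Ne.symm hk]
  rw [indexList, h1 _ (List.nodup_finRange d), if_pos (List.mem_finRange i)]

theorem perm_indexList (l : List (Fin d)) : l.Perm (indexList fun i => l.count i) := by
  rw [List.perm_iff_count]
  intro i
  rw [count_indexList]

/-- The `i`-th standard basis vector. -/
noncomputable abbrev stdVec (i : Fin d) : E d := EuclideanSpace.single i 1

theorem multiDeriv_eq_iterDeriv (β : Fin d → ℕ) (φ : E d → ℂ) :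
    multiDeriv β φ = iterDeriv ((indexList β).map stdVec) φ := by
  have h1 : ∀ (n : ℕ) (i : Fin d) (ψ : E d → ℂ),
      (partialDeriv i)^[n] ψ = iterDeriv ((List.replicate n i).map stdVec) ψ := by
    intro n i ψ
    induction n with
    | zero => rfl
    | succ n ih =>
      rw [Function.iterate_succ_apply', ih]
      rfl
  rw [multiDeriv, indexList]
  induction List.finRange d with
  | nil => rfl
  | cons i l ih =>
    rw [List.foldr_cons, ih, h1, List.flatMap_cons, List.map_append, iterDeriv_append]

theorem hasTemperateGrowth_monomial (α : Fin d → ℕ) :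
    Function.HasTemperateGrowth (monomial α : E d → ℝ) := by
  have h : ∀ t : Finset (Fin d), Function.HasTemperateGrowth fun x : E d => ∏ i ∈ t, x i ^ α i := by
    intro t
    induction t using Finset.cons_induction with
    | empty => simp
    | cons i t hi ih =>
      simp_rw [Finset.prod_cons]
      exact (Function.HasTemperateGrowth.pow
        (EuclideanSpace.proj (𝕜 := ℝ) i).hasTemperateGrowth (α i)).mul ih
  exact h Finset.univ

theorem hasWeakDeriv_of_schwartz (β : Fin d → ℕ) (f : 𝓢(E d, ℂ)) :
    HasWeakDeriv β f (multiDeriv β f) := by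
  rw [multiDeriv_eq_iterDeriv, ← coe_iterDerivCLM]
  refine ⟨f.continuous.locallyIntegrable, SchwartzMap.continuous _ |>.locallyIntegrable,
    fun φ hφ hc => ?_⟩
  rw [coe_iterDerivCLM, integral_iterDeriv_mul volume (f.smooth ⊤) hφ hc, multiDeriv_eq_iterDeriv,
    List.length_map, length_indexList]

/-- The map `f ↦ x^α ∂^β f` is continuous from the Schwartz space to `L^p`, hence bounded by
finitely many seminorms. The classical derivative is an admissible competitor in the infimum. -/
theorem exists_weightedDerivNorm_le {p : ℝ≥0∞} (hp : 1 ≤ p) (α β : Fin d → ℕ) :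
    ∃ (t : Finset (ℕ × ℕ)) (C : ℝ), 0 ≤ C ∧ ∀ f : 𝓢(E d, ℂ), weightedDerivNorm p α β f ≤
      ENNReal.ofReal (C * ∑ i ∈ t, SchwartzMap.seminorm ℝ i.1 i.2 f) := by
  have : Fact (1 ≤ p) := ⟨hp⟩
  let T : 𝓢(E d, ℂ) →L[ℝ] Lp ℂ p (volume : Measure (E d)) := toLpCLM ℝ ℂ p volume ∘L
    smulLeftCLM ℂ (monomial α) ∘L iterDerivCLM ((indexList β).map stdVec)
  obtain ⟨t, C, -, hC⟩ := Seminorm.bound_of_continuous (schwartz_withSeminorms ℝ (E d) ℂ)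
    ((normSeminorm ℝ (Lp ℂ p (volume : Measure (E d)))).comp T.toLinearMap)
    (continuous_norm.comp T.continuous)
  refine ⟨t, C, C.2, fun f => ?_⟩
  refine (iInf₂_le _ (hasWeakDeriv_of_schwartz β f)).trans ?_
  have h1 : eLpNorm (fun x => (monomial α x : ℂ) * multiDeriv β f x) p volume =
      ENNReal.ofReal ‖T f‖ := by
    have h2 : (fun x => (monomial α x : ℂ) * multiDeriv β f x) =
        (smulLeftCLM ℂ (monomial α) (iterDerivCLM ((indexList β).map stdVec) f) : E d → ℂ) := by
      ext x
      rw [smulLeftCLM_apply_apply (hasTemperateGrowth_monomial α), coe_iterDerivCLM,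
        multiDeriv_eq_iterDeriv]
      simp
    rw [h2]
    change _ = ENNReal.ofReal ‖toLp _ p volume‖
    rw [norm_toLp, ENNReal.ofReal_toReal (eLpNorm_lt_top _ _ _).ne]
    rfl
  rw [h1]
  refine ENNReal.ofReal_le_ofReal ((hC f).trans ?_)
  rw [smul_apply, NNReal.smul_def, smul_eq_mul]
  refine mul_le_mul_of_nonneg_left ?_ C.2
  refine (Seminorm.finset_sup_le_sum _ t f).trans (le_of_eq ?_)
  rw [sum_apply]
  rfl

theorem SchwartzRapidDecay.funBound {p : ℝ≥0∞} (hp : 1 ≤ p) {f : ℕ → 𝓢(E d, ℂ)}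
    (hf : SchwartzRapidDecay f) (N : ℕ) : FunBound p N fun j => ⇑(f j) := by
  intro α β
  obtain ⟨t, C, hC0, hC⟩ := exists_weightedDerivNorm_le hp α β
  choose B hB0 hB using fun i : ℕ × ℕ => hf i.1 i.2 N
  refine lt_of_le_of_lt (iSup_le fun j => ?_)
    (ENNReal.ofReal_lt_top (r := C * ∑ i ∈ t, B i))
  have h1 : ((j : ℝ≥0∞) + 1) ^ N = ENNReal.ofReal (((j : ℝ) + 1) ^ N) := by
    rw [ENNReal.ofReal_pow (by positivity), ENNReal.ofReal_add (by positivity) zero_le_one,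
      ENNReal.ofReal_natCast, ENNReal.ofReal_one]
  calc ((j : ℝ≥0∞) + 1) ^ N * weightedDerivNorm p α β (f j)
      ≤ ENNReal.ofReal (((j : ℝ) + 1) ^ N) *
          ENNReal.ofReal (C * ∑ i ∈ t, SchwartzMap.seminorm ℝ i.1 i.2 (f j)) := by
        rw [h1]
        gcongr
        exact hC _
    _ = ENNReal.ofReal (C * ∑ i ∈ t, ((j : ℝ) + 1) ^ N *
          SchwartzMap.seminorm ℝ i.1 i.2 (f j)) := by
        rw [← ENNReal.ofReal_mul (by positivity), mul_left_comm, Finset.mul_sum]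
    _ ≤ ENNReal.ofReal (C * ∑ i ∈ t, B i) :=
        ENNReal.ofReal_le_ofReal
          (mul_le_mul_of_nonneg_left (Finset.sum_le_sum fun i _ => hB i j) hC0)

end MultiIndex

end KernelExpansion

/-! ### Assembly of the expansion of a Schwartz kernel -/

namespace KernelExpansion

theorem isOG_of_orthonormal {d : ℕ} {v f : ℕ → 𝓢(E d, ℂ)}
    (hv : Orthonormal ℂ fun j => (v j).toLp 2 volume) {c : ℕ → ℝ} (hc : ∀ j, 0 < c j)
    (hf : ∀ j, f j = (c j : ℂ) • v j) : IsOG fun j => (f j).toLp 2 volume := by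
  have hfc : ∀ j, (f j).toLp 2 volume = (c j : ℂ) • (v j).toLp 2 volume := fun j => by
    rw [hf]
    exact map_smul (toLpCLM ℂ ℂ 2 (volume : Measure (E d))) (c j : ℂ) (v j)
  refine ⟨fun j h0 => ?_, fun i j hij => ?_⟩
  · simp only [hfc, smul_eq_zero] at h0
    rcases h0 with h0 | h0
    · exact (hc j).ne' (by exact_mod_cast h0)
    · have := hv.1 j
      simp [h0] at this
  · simp only [hfc]
    rw [inner_smul_left, inner_smul_right, hv.2 hij, mul_zero, mul_zero]

theorem isOG_conj {d : ℕ} {f : ℕ → 𝓢(E d, ℂ)} (hf : IsOG fun j => (f j).toLp 2 volume) :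
    IsOG fun j => (conjCLM (E d) (f j)).toLp 2 volume := by
  have hinner : ∀ i j, inner ℂ ((conjCLM (E d) (f i)).toLp 2 volume)
      ((conjCLM (E d) (f j)).toLp 2 volume) =
      (starRingEnd ℂ) (inner ℂ ((f i).toLp 2 volume) ((f j).toLp 2 volume)) := fun i j => by
    rw [inner_toL2_toL2_eq _ _ volume, inner_toL2_toL2_eq _ _ volume, ← integral_conj]
    congr 1 with x
    simp [RCLike.inner_apply, conjCLM_apply]
  refine ⟨fun j h0 => hf.1 j ?_, fun i j hij => ?_⟩
  · have h1 := hinner j j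
    simp only at h0
    rw [h0, inner_zero_left, eq_comm, map_eq_zero] at h1
    exact inner_self_eq_zero.1 h1
  · simp only [hinner, hf.2 i j hij, map_zero]

/-- A Schwartz kernel has an expansion with rapidly decaying coefficients and Schwartz factors. -/
theorem exists_expansion_of_schwartz {d₁ d₂ : ℕ} (hd₁ : 1 ≤ d₁) (hd₂ : 1 ≤ d₂) {p : ℝ≥0∞}
    (hp : 1 ≤ p) (K : 𝓢(E d₂ × E d₁, ℂ)) :
    ∃ (lam : ℕ → ℝ) (f₁ : ℕ → 𝓢(E d₁, ℂ)) (f₂ : ℕ → 𝓢(E d₂, ℂ)),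
      (∀ j, 0 ≤ lam j) ∧
      ((∀ j, 0 < lam j) ∨ ∃ n, (∀ j, j < n → 0 < lam j) ∧ ∀ j, n ≤ j → lam j = 0) ∧
      IsOG (fun j => (f₁ j).toLp 2) ∧ IsOG (fun j => (f₂ j).toLp 2) ∧
      HasStrongExpansion K lam (fun j => ⇑(f₁ j)) (fun j => ⇑(f₂ j)) ∧
      ∀ N : ℕ, CoeffBound N lam ∧ FunBound p N (fun j => ⇑(f₁ j)) ∧
        FunBound p N (fun j => ⇑(f₂ j)) := by
  have : Nontrivial (E d₁) := by
    have : Nonempty (Fin d₁) := ⟨⟨0, hd₁⟩⟩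
    infer_instance
  have : Nontrivial (E d₂) := by
    have : Nonempty (Fin d₂) := ⟨⟨0, hd₂⟩⟩
    infer_instance
  obtain ⟨v, u, s, h⟩ := exists_isSingularSystem K
  have hrapid := h.rapidDecay
  obtain ⟨c, hc0, hc, hcv⟩ := exists_scaling h.nonneg hrapid h.orthonormal₁.1 h.exists_bound_left
  obtain ⟨e, he0, he, heu⟩ := exists_scaling h.nonneg hrapid h.orthonormal₂.1 h.exists_bound_right
  set lam : ℕ → ℝ := fun j => s j ^ (1 / 2 : ℝ) with hlam
  have hlam0 : ∀ j, 0 ≤ lam j := fun j => Real.rpow_nonneg (h.nonneg j) _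
  have hlamr : RapidDecay lam := hrapid.rpow h.nonneg (by norm_num)
  -- The exponents `1/2 + 1/4 + 1/4` add up to `1`. Where `s j = 0`, the coefficient vanishes, so
  -- the arbitrary positive scalings there do no harm.
  have hprod : ∀ j, lam j * (c j * e j) = s j := fun j => by
    rcases (h.nonneg j).eq_or_lt with h0 | hj
    · simp [hlam, ← h0]
    · rw [hc j hj, he j hj, ← Real.rpow_add hj, hlam]
      simp only
      rw [← Real.rpow_add hj]
      norm_num
  have hterm : ∀ j x, (lam j : ℂ) *
      tensor (conjCLM (E d₁) ((c j : ℂ) • v j)) ((e j : ℂ) • u j : 𝓢(E d₂, ℂ)) x =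
      (s j : ℂ) * ((starRingEnd ℂ) (v j x.2) * u j x.1) := fun j x => by
    rw [← hprod j]
    simp only [tensor, conjCLM_apply, smul_apply, smul_eq_mul, map_mul, Complex.conj_ofReal]
    push_cast
    ring
  obtain ⟨Cl, hCl0, hCl⟩ := hlamr 0
  simp only [pow_zero, one_mul] at hCl
  -- The whole factor `(j + 1) ^ 2` is taken from the decay of `e j • u j`. It gives the summable
  -- majorant `C / (j + 1) ^ 2` for both modes of convergence.
  have hwbound : ∀ m : ℕ, ∃ C, 0 ≤ C ∧ ∀ (j : ℕ) (x : E d₂ × E d₁), ((j : ℝ) + 1) ^ 2 *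
      ((1 + ‖x‖) ^ m * (s j * (‖v j x.2‖ * ‖u j x.1‖))) ≤ C := fun m => by
    obtain ⟨C₁, hC₁0, hC₁⟩ := hcv.exists_bound m 0
    obtain ⟨C₂, hC₂0, hC₂⟩ := heu.exists_bound m 2
    refine ⟨Cl * C₁ * C₂, by positivity, fun j x => ?_⟩
    have h1 := hC₁ j x.2
    have h2 := hC₂ j x.1
    simp only [smul_apply, norm_smul, Complex.norm_real, Real.norm_of_nonneg (hc0 j).le,
      Real.norm_of_nonneg (he0 j).le, pow_zero, one_mul] at h1 h2
    have hx : (1 + ‖x‖) ^ m ≤ (1 + ‖x.1‖) ^ m * (1 + ‖x.2‖) ^ m := by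
      rw [← mul_pow]
      gcongr
      rw [Prod.norm_def]
      have h3 := norm_nonneg x.1
      have h4 := norm_nonneg x.2
      rcases max_cases ‖x.1‖ ‖x.2‖ with ⟨h5, -⟩ | ⟨h5, -⟩ <;> rw [h5] <;> nlinarith
    have hcj := (hc0 j).le
    have hej := (he0 j).le
    have hlj := hlam0 j
    calc ((j : ℝ) + 1) ^ 2 * ((1 + ‖x‖) ^ m * (s j * (‖v j x.2‖ * ‖u j x.1‖)))
        ≤ ((j : ℝ) + 1) ^ 2 * (((1 + ‖x.1‖) ^ m * (1 + ‖x.2‖) ^ m) *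
            ((lam j * (c j * e j)) * (‖v j x.2‖ * ‖u j x.1‖))) := by
          rw [hprod]
          have := h.nonneg j
          gcongr
      _ = lam j * ((1 + ‖x.2‖) ^ m * (c j * ‖v j x.2‖)) *
            (((j : ℝ) + 1) ^ 2 * ((1 + ‖x.1‖) ^ m * (e j * ‖u j x.1‖))) := by ring
      _ ≤ Cl * C₁ * C₂ := by gcongr; exact hCl j
  have hpoint : ∀ x : E d₂ × E d₁,
      HasSum (fun j => (s j : ℂ) * ((starRingEnd ℂ) (v j x.2) * u j x.1)) (K x) := fun x => by
    obtain ⟨C, hC0, hC⟩ := hwbound 0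
    obtain ⟨C₂, hC₂0, hC₂⟩ := heu.exists_bound 0 2
    have hs34 := hrapid.rpow h.nonneg (show (0 : ℝ) < 3 / 4 by norm_num)
    obtain ⟨C₃, hC₃0, hC₃⟩ := hs34 0
    simp only [pow_zero, one_mul] at hC hC₃
    refine h.hasSum x.1 (a := fun j => C / ((j : ℝ) + 1) ^ 2) ?_ ?_ (fun j y => ?_) x.2
    · refine summable_of_sq_mul_le (C := C₃ * C₂) (fun j => mul_nonneg (h.nonneg j) (norm_nonneg _))
        fun j => ?_
      have h2 := hC₂ j x.1
      simp only [smul_apply, norm_smul, Complex.norm_real, Real.norm_of_nonneg (he0 j).le,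
        pow_zero, one_mul] at h2
      have hsj : s j = s j ^ (3 / 4 : ℝ) * e j := by
        rcases (h.nonneg j).eq_or_lt with h0 | hj
        · rw [← h0, Real.zero_rpow (by norm_num), zero_mul]
        · rw [he j hj, ← Real.rpow_add hj]
          norm_num
      have hsp := Real.rpow_nonneg (h.nonneg j) (3 / 4)
      have hej := (he0 j).le
      calc ((j : ℝ) + 1) ^ 2 * (s j * ‖u j x.1‖)
          = s j ^ (3 / 4 : ℝ) * (((j : ℝ) + 1) ^ 2 * (e j * ‖u j x.1‖)) := by
            conv_lhs => rw [hsj]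
            ring
        _ ≤ C₃ * C₂ := by gcongr; exact hC₃ j
    · refine summable_of_sq_mul_le (C := C) (fun j => by positivity) fun j => le_of_eq ?_
      field_simp
    · rw [le_div_iff₀ (by positivity)]
      refine le_trans (le_of_eq ?_) (hC j (x.1, y))
      ring
  refine ⟨lam, fun j => conjCLM (E d₁) ((c j : ℂ) • v j), fun j => (e j : ℂ) • u j, hlam0, ?_,
    isOG_conj (isOG_of_orthonormal h.orthonormal₁ hc0 fun j => rfl),
    isOG_of_orthonormal h.orthonormal₂ he0 fun j => rfl, ⟨fun x => ?_, ?_⟩, fun N => ⟨?_, ?_, ?_⟩⟩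
  · by_cases hpos : ∀ j, 0 < s j
    · exact Or.inl fun j => Real.rpow_pos_of_pos (hpos j) _
    · right
      push Not at hpos
      classical
      -- The singular values decrease, so all of them vanish from the first zero on.
      refine ⟨Nat.find hpos, fun j hj => ?_, fun j hj => ?_⟩
      · exact Real.rpow_pos_of_pos (not_le.1 (Nat.find_min hpos hj)) _
      · have h0 : s j = 0 :=
          le_antisymm ((h.antitone hj).trans (Nat.find_spec hpos)) (h.nonneg j)
        simp [hlam, h0]
  · simp_rw [hterm]
    exact hpoint x
  · have : (volume : Measure (E d₂ × E d₁)).IsAddHaarMeasure := by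
      rw [Measure.volume_eq_prod]
      infer_instance
    obtain ⟨m, hm⟩ := tendsto_eLpNorm_sub_sum (volume : Measure (E d₂ × E d₁))
    obtain ⟨C, hC0, hC⟩ := hwbound m
    simp_rw [hterm]
    refine hm K _ (fun j => C / ((j : ℝ) + 1) ^ 2) ?_ (fun j x => ?_) hpoint
    · refine summable_of_sq_mul_le (C := C) (fun j => by positivity) fun j => le_of_eq ?_
      field_simp
    · rw [le_div_iff₀ (by positivity), mul_comm]
      refine le_trans (le_of_eq ?_) (hC j x)
      rw [norm_mul, norm_mul, RCLike.norm_conj, Complex.norm_real, Real.norm_of_nonneg (h.nonneg j)]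
  · obtain ⟨C, -, hC⟩ := hlamr N
    exact ⟨C, by rintro _ ⟨j, rfl⟩; exact hC j⟩
  · exact hcv.conj.funBound hp N
  · exact heu.funBound hp N

end KernelExpansion

/-! ### From dual bounds to pointwise bounds by averaging at small scales -/

namespace KernelExpansion

section Sobolev

variable {W ι : Type*} [NormedAddCommGroup W] [NormedSpace ℝ W] [FiniteDimensional ℝ W]
  [MeasurableSpace W] [BorelSpace W] (μ : Measure W) [μ.IsAddHaarMeasure]

/-- The average of `G` near `x` at scale `t` against `φ`. -/
noncomputable def scaledAverage (G φ : W → ℂ) (x : W) (t : ℝ) : ℂ :=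
  ∫ y, G (x + t • y) * φ y ∂μ

variable [Fintype ι] (b : Module.Basis ι ℝ W)

/-- The `t`-derivative of `G (x + t • y)` is the sum of `y_i ∂_i G (x + t • y)`. Absorbing the
coordinate `y_i` into `φ` makes it a sum of averages of the same kind. -/
theorem hasDerivAt_scaledAverage {G φ : W → ℂ} (hG : ContDiff ℝ ∞ G) (hφ : Continuous φ)
    (hc : HasCompactSupport φ) (x : W) (t : ℝ) :
    HasDerivAt (scaledAverage μ G φ x)
      (∑ i, scaledAverage μ (fun z => fderiv ℝ G z (b i)) (fun y => (b.coord i y : ℂ) * φ y) x t)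
      t := by
  have hG' : Continuous (fderiv ℝ G) := hG.continuous_fderiv (by simp)
  have hGc := hG.continuous
  obtain ⟨C, hC⟩ := ((isCompact_closedBall t 1).prod hc).exists_bound_of_continuousOn
    (f := fun q : ℝ × W => fderiv ℝ G (x + q.1 • q.2)) (by fun_prop)
  have hC0 : ∀ τ ∈ Metric.ball t 1, ∀ y, ‖fderiv ℝ G (x + τ • y) y * φ y‖ ≤ C * ‖y‖ * ‖φ y‖ := by
    intro τ hτ y
    by_cases hy : y ∈ tsupport φ
    · rw [norm_mul]
      gcongr
      exact (ContinuousLinearMap.le_opNorm _ _).trans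
        (by gcongr; exact hC (τ, y) ⟨Metric.ball_subset_closedBall hτ, hy⟩)
    · simp [image_eq_zero_of_notMem_tsupport hy]
  have key := hasDerivAt_integral_of_dominated_loc_of_deriv_le (μ := μ)
    (F := fun τ y => G (x + τ • y) * φ y) (F' := fun τ y => fderiv ℝ G (x + τ • y) y * φ y)
    (x₀ := t) (bound := fun y => C * ‖y‖ * ‖φ y‖) (Metric.ball_mem_nhds t one_pos)
    (Eventually.of_forall fun τ => Continuous.aestronglyMeasurable (by fun_prop))
    (Continuous.integrable_of_hasCompactSupport (by fun_prop) hc.mul_left)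
    (Continuous.aestronglyMeasurable (by fun_prop))
    (ae_of_all _ fun y τ hτ => hC0 τ hτ y)
    (Continuous.integrable_of_hasCompactSupport (by fun_prop) hc.norm.mul_left)
    (ae_of_all _ fun y τ _ => by
      have h1 : HasDerivAt (fun τ : ℝ => x + τ • y) y τ := by
        simpa using ((hasDerivAt_id τ).smul_const y).const_add x
      exact (((hG.differentiable (by simp)) _).hasFDerivAt.comp_hasDerivAt τ h1).mul_const (φ y))
  refine HasDerivAt.congr_deriv (f := scaledAverage μ G φ x) key.2 ?_
  have hcoord : ∀ i, Continuous fun y => b.coord i y := fun i =>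
    LinearMap.continuous_of_finiteDimensional _
  simp only [scaledAverage]
  rw [← integral_finsetSum]
  · congr 1 with y
    conv_lhs => rw [← b.sum_repr y, map_sum, b.sum_repr y, Finset.sum_mul]
    refine Finset.sum_congr rfl fun i _ => ?_
    rw [map_smul, Complex.real_smul, Module.Basis.coord_apply]
    ring
  · intro i _
    have := hcoord i
    exact Continuous.integrable_of_hasCompactSupport (by fun_prop) hc.mul_left.mul_left

/-- A scale-`t` average is controlled by the dual weighted sup norm. -/
theorem exists_scaledAverage_le {G φ : W → ℂ} {k : ℕ} {C : ℝ} (hC0 : 0 ≤ C)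
    (hC : ∀ ψ : W → ℂ, ContDiff ℝ ∞ ψ → HasCompactSupport ψ → ∀ M, 0 ≤ M →
      (∀ y, ‖ψ y‖ ≤ M * (1 + ‖y‖) ^ k) → ‖∫ y, G y * ψ y ∂μ‖ ≤ C * M)
    (hφ : ContDiff ℝ ∞ φ) (hs : tsupport φ ⊆ Metric.closedBall 0 1) :
    ∃ C', 0 ≤ C' ∧ ∀ (x : W) (t : ℝ), 0 < t → t ≤ 1 →
      (1 + ‖x‖) ^ k * ‖scaledAverage μ G φ x t‖ ≤ C' * t ^ (-(Module.finrank ℝ W : ℝ)) := by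
  have hcs : HasCompactSupport φ := (isCompact_closedBall (0 : W) 1).of_isClosed_subset
    (isClosed_tsupport φ) hs
  obtain ⟨M, hM⟩ := hcs.exists_bound_of_continuous hφ.continuous
  have hM0 : 0 ≤ M := (norm_nonneg _).trans (hM 0)
  refine ⟨C * (M * 2 ^ k), by positivity, fun x t ht0 ht1 => ?_⟩
  -- The substitution `z = x + t • y` costs the factor `t ^ (-n)` in dimension `n`. On the support
  -- of `ψ` one has `‖z - x‖ ≤ 1`, so the weights at `x` and `z` differ by at most `2 ^ k`.
  let ψ : W → ℂ := fun z => φ (t⁻¹ • (z - x))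
  have hscale : scaledAverage μ G φ x t =
      |(t ^ Module.finrank ℝ W)⁻¹| • ∫ z, G z * ψ z ∂μ := by
    rw [← integral_add_left_eq_self (fun z => G z * ψ z) x,
      ← Measure.integral_comp_smul μ (fun w => G (x + w) * ψ (x + w)) t, scaledAverage]
    congr 1 with y
    simp only [ψ, add_sub_cancel_left, smul_smul, inv_mul_cancel₀ ht0.ne', one_smul]
  have hψs : ContDiff ℝ ∞ ψ := hφ.comp (by fun_prop)
  have hψz : ∀ z, ψ z ≠ 0 → ‖z - x‖ ≤ 1 := fun z hz => by
    have h1 := hs (subset_tsupport φ hz)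
    rw [mem_closedBall_zero_iff, norm_smul, norm_inv, Real.norm_of_nonneg ht0.le,
      inv_mul_le_iff₀ ht0, mul_one] at h1
    exact h1.trans ht1
  have hψc : HasCompactSupport ψ := by
    refine HasCompactSupport.intro (isCompact_closedBall x 1) fun z hz => ?_
    by_contra hne
    exact hz (by simpa [dist_eq_norm] using hψz z hne)
  have hx : 0 < (1 + ‖x‖) ^ k := by positivity
  have hb := hC ψ hψs hψc (M * 2 ^ k / (1 + ‖x‖) ^ k) (by positivity) fun z => by
    by_cases hz : ψ z = 0
    · rw [hz, norm_zero]
      positivity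
    · have h1 : 1 + ‖x‖ ≤ 2 * (1 + ‖z‖) := by
        have h2 := hψz z hz
        have h3 := norm_sub_norm_le x z
        rw [norm_sub_rev] at h3
        linarith [norm_nonneg z]
      have h2 : (1 + ‖x‖) ^ k ≤ 2 ^ k * (1 + ‖z‖) ^ k := by
        rw [← mul_pow]
        gcongr
      rw [div_mul_eq_mul_div, le_div_iff₀ hx, mul_assoc]
      exact mul_le_mul (hM _) h2 hx.le hM0
  rw [hscale, norm_smul, Real.norm_eq_abs, abs_abs, abs_of_nonneg (by positivity),
    Real.rpow_neg ht0.le, Real.rpow_natCast]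
  calc (1 + ‖x‖) ^ k * ((t ^ Module.finrank ℝ W)⁻¹ * ‖∫ z, G z * ψ z ∂μ‖)
      ≤ (1 + ‖x‖) ^ k * ((t ^ Module.finrank ℝ W)⁻¹ * (C * (M * 2 ^ k / (1 + ‖x‖) ^ k))) := by
        gcongr
    _ = _ := by field_simp

/-- One power of `t` is gained until the exponent reaches `0`; the excluded case `a = 1` would give
a logarithm. -/
theorem integral_rpow_neg_le {a t : ℝ} (ha : a ≠ 1) (ht0 : 0 < t) (ht1 : t ≤ 1) :
    ∫ τ in t..1, τ ^ (-a) ≤ |1 - a|⁻¹ * t ^ (-max (a - 1) 0) := by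
  rw [integral_rpow (Or.inr ⟨by intro h; apply ha; linarith, by
    rw [Set.uIcc_of_le ht1]; exact fun h => absurd h.1 (not_le.2 ht0)⟩), Real.one_rpow,
    show -a + 1 = 1 - a by ring]
  rcases lt_or_gt_of_ne ha with h | h
  · rw [max_eq_right (by linarith), neg_zero, Real.rpow_zero, abs_of_pos (by linarith), mul_one,
      ← one_div]
    have h2 : 0 ≤ t ^ (1 - a) := by positivity
    have : 0 < 1 - a := by linarith
    gcongr
    linarith
  · rw [max_eq_left (by linarith), abs_of_neg (by linarith), neg_sub, neg_sub, inv_mul_eq_div,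
      ← neg_div_neg_eq, neg_sub, neg_sub]
    have : 0 < a - 1 := by linarith
    gcongr
    linarith

variable {μ b}

/-- Integrating the derivative of the scaled averages improves their growth as `t → 0`. -/
theorem scaledAverage_bound_improve {𝒢 : Set (W → ℂ)} (h1 : ∀ G ∈ 𝒢, ContDiff ℝ ∞ G)
    (h2 : ∀ G ∈ 𝒢, ∀ i, (fun x => fderiv ℝ G x (b i)) ∈ 𝒢) {k : ℕ} {a : ℝ} (ha : a ≠ 1)
    (h : ∀ G ∈ 𝒢, ∀ φ : W → ℂ, ContDiff ℝ ∞ φ → tsupport φ ⊆ Metric.closedBall 0 1 →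
      ∃ C, 0 ≤ C ∧ ∀ (x : W) (t : ℝ), 0 < t → t ≤ 1 →
        (1 + ‖x‖) ^ k * ‖scaledAverage μ G φ x t‖ ≤ C * t ^ (-a)) :
    ∀ G ∈ 𝒢, ∀ φ : W → ℂ, ContDiff ℝ ∞ φ → tsupport φ ⊆ Metric.closedBall 0 1 →
      ∃ C, 0 ≤ C ∧ ∀ (x : W) (t : ℝ), 0 < t → t ≤ 1 →
        (1 + ‖x‖) ^ k * ‖scaledAverage μ G φ x t‖ ≤ C * t ^ (-max (a - 1) 0) := by
  intro G hG φ hφ hs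
  have hcoord : ∀ i, ContDiff ℝ ∞ fun y => ((b.coord i y : ℝ) : ℂ) := fun i =>
    Complex.ofRealCLM.contDiff.comp (LinearMap.toContinuousLinearMap (b.coord i)).contDiff
  have hcs : ∀ ψ : W → ℂ, tsupport ψ ⊆ Metric.closedBall 0 1 → HasCompactSupport ψ := fun ψ hψ =>
    (isCompact_closedBall (0 : W) 1).of_isClosed_subset (isClosed_tsupport ψ) hψ
  have hsi : ∀ i, tsupport (fun y => ((b.coord i y : ℝ) : ℂ) * φ y) ⊆ Metric.closedBall 0 1 :=
    fun i => tsupport_mul_subset_right.trans hs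
  choose C hC0 hC using fun i => h _ (h2 G hG i) _ ((hcoord i).mul hφ) (hsi i)
  obtain ⟨C₁, hC₁0, hC₁⟩ := h G hG φ hφ hs
  have hsum0 : 0 ≤ ∑ i, C i := Finset.sum_nonneg fun i _ => hC0 i
  refine ⟨C₁ + (∑ i, C i) * |1 - a|⁻¹, by positivity, fun x t ht0 ht1 => ?_⟩
  set w := (1 + ‖x‖) ^ k with hw
  have hw0 : 0 < w := by positivity
  let D : ℝ → ℂ := fun τ => ∑ i, scaledAverage μ (fun z => fderiv ℝ G z (b i))
    (fun y => (b.coord i y : ℂ) * φ y) x τ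
  have hD : ∀ τ, HasDerivAt (scaledAverage μ G φ x) (D τ) τ := fun τ =>
    hasDerivAt_scaledAverage μ b (h1 G hG) hφ.continuous (hcs φ hs) x τ
  have hDc : Continuous D := continuous_finsetSum _ fun i _ => continuous_iff_continuousAt.2 fun τ =>
    (hasDerivAt_scaledAverage μ b (h1 _ (h2 G hG i)) ((hcoord i).mul hφ).continuous
      (hcs _ (hsi i)) x τ).continuousAt
  have hDb : ∀ τ ∈ Set.Ioc t 1, ‖D τ‖ ≤ (∑ i, C i) / w * τ ^ (-a) := fun τ hτ => by
    have hτ0 : 0 < τ := ht0.trans hτ.1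
    refine (norm_sum_le _ _).trans ?_
    rw [Finset.sum_div, Finset.sum_mul]
    refine Finset.sum_le_sum fun i _ => ?_
    rw [div_mul_eq_mul_div, le_div_iff₀ hw0, mul_comm]
    exact hC i x τ hτ0 hτ.2
  have hint : IntervalIntegrable (fun τ : ℝ => (∑ i, C i) / w * τ ^ (-a)) volume t 1 := by
    refine (intervalIntegral.intervalIntegrable_rpow (Or.inr ?_)).const_mul _
    rw [Set.uIcc_of_le ht1]
    exact fun h => absurd h.1 (not_le.2 ht0)
  have hftc : ∫ τ in t..1, D τ = scaledAverage μ G φ x 1 - scaledAverage μ G φ x t :=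
    intervalIntegral.integral_eq_sub_of_hasDerivAt (fun τ _ => hD τ) (hDc.intervalIntegrable t 1)
  have hle := intervalIntegral.norm_integral_le_of_norm_le ht1
    (ae_of_all _ fun τ hτ => hDb τ hτ) hint
  rw [hftc, intervalIntegral.integral_const_mul] at hle
  have h3 : ‖scaledAverage μ G φ x t‖ ≤ ‖scaledAverage μ G φ x 1‖ +
      (∑ i, C i) / w * ∫ τ in t..1, τ ^ (-a) := by
    have := norm_sub_norm_le (scaledAverage μ G φ x t) (scaledAverage μ G φ x 1)
    rw [norm_sub_rev] at this
    linarith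
  have h4 := hC₁ x 1 one_pos le_rfl
  rw [Real.one_rpow, mul_one] at h4
  have h5 : 1 ≤ t ^ (-max (a - 1) 0) :=
    Real.one_le_rpow_of_pos_of_le_one_of_nonpos ht0 ht1 (by simp)
  calc w * ‖scaledAverage μ G φ x t‖
      ≤ w * (‖scaledAverage μ G φ x 1‖ +
          (∑ i, C i) / w * (|1 - a|⁻¹ * t ^ (-max (a - 1) 0))) := by
        gcongr
        refine h3.trans ?_
        gcongr
        exact integral_rpow_neg_le ha ht0 ht1
    _ = w * ‖scaledAverage μ G φ x 1‖ +
          (∑ i, C i) * |1 - a|⁻¹ * t ^ (-max (a - 1) 0) := by field_simp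
    _ ≤ C₁ * t ^ (-max (a - 1) 0) + (∑ i, C i) * |1 - a|⁻¹ * t ^ (-max (a - 1) 0) := by
        exact add_le_add (h4.trans (le_mul_of_one_le_right hC₁0 h5)) le_rfl
    _ = _ := by ring

/-- A family of smooth functions that is closed under partial derivatives and whose members are
bounded as functionals on test functions in a weighted sup norm decays pointwise. -/
theorem exists_pointwise_bound_of_dual_bound {𝒢 : Set (W → ℂ)} (h1 : ∀ G ∈ 𝒢, ContDiff ℝ ∞ G)
    (h2 : ∀ G ∈ 𝒢, ∀ i, (fun x => fderiv ℝ G x (b i)) ∈ 𝒢) {k : ℕ}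
    (h3 : ∀ G ∈ 𝒢, ∃ C, 0 ≤ C ∧ ∀ ψ : W → ℂ, ContDiff ℝ ∞ ψ → HasCompactSupport ψ →
      ∀ M, 0 ≤ M → (∀ y, ‖ψ y‖ ≤ M * (1 + ‖y‖) ^ k) → ‖∫ y, G y * ψ y ∂μ‖ ≤ C * M)
    {G : W → ℂ} (hG : G ∈ 𝒢) : ∃ C, ∀ x, (1 + ‖x‖) ^ k * ‖G x‖ ≤ C := by
  let P : ℝ → Prop := fun a => ∀ G ∈ 𝒢, ∀ φ : W → ℂ, ContDiff ℝ ∞ φ →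
    tsupport φ ⊆ Metric.closedBall 0 1 → ∃ C, 0 ≤ C ∧ ∀ (x : W) (t : ℝ), 0 < t → t ≤ 1 →
      (1 + ‖x‖) ^ k * ‖scaledAverage μ G φ x t‖ ≤ C * t ^ (-a)
  have himp : ∀ a, a ≠ 1 → P a → P (max (a - 1) 0) := fun a ha hP =>
    scaledAverage_bound_improve h1 h2 ha hP
  -- The growth exponent is weakened by `1 / 2` so that the descent in unit steps reaches `1 / 2`
  -- and then `0` without ever meeting the logarithmic exponent `1`.
  have hstart : P ((Module.finrank ℝ W : ℝ) + 1 / 2) := fun G hG φ hφ hs => by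
    obtain ⟨C, hC0, hC⟩ := h3 G hG
    obtain ⟨C', hC'0, hC'⟩ := exists_scaledAverage_le μ hC0 hC hφ hs
    refine ⟨C', hC'0, fun x t ht0 ht1 => (hC' x t ht0 ht1).trans ?_⟩
    exact mul_le_mul_of_nonneg_left
      (Real.rpow_le_rpow_of_exponent_ge ht0 ht1 (by linarith)) hC'0
  have hdesc : ∀ n : ℕ, P ((n : ℝ) + 1 / 2) → P (1 / 2) := by
    intro n
    induction n with
    | zero => intro h; simpa using h
    | succ n ih =>
      intro h
      refine ih ?_
      have h4 := himp _ (fun he => ?_) h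
      · rwa [max_eq_left (by push_cast; linarith [(Nat.cast_nonneg n : (0 : ℝ) ≤ n)]),
          show ((n + 1 : ℕ) : ℝ) + 1 / 2 - 1 = n + 1 / 2 by push_cast; ring] at h4
      · push_cast at he
        linarith [(Nat.cast_nonneg n : (0 : ℝ) ≤ n)]
  have hP0 : P 0 := by
    have h4 := himp _ (by norm_num) (hdesc _ hstart)
    rwa [max_eq_right (by norm_num)] at h4
  -- For a bump of integral one supported in the unit ball, the averages tend to `G x` as `t → 0`,
  -- so the bound with exponent `0` passes to `G x`.
  let β : ContDiffBump (0 : W) := ⟨1 / 2, 1, by norm_num, by norm_num⟩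
  let φ : W → ℂ := fun y => (β.normed μ y : ℂ)
  have hφ : ContDiff ℝ ∞ φ := Complex.ofRealCLM.contDiff.comp β.contDiff_normed
  have hsupp : tsupport φ ⊆ Metric.closedBall 0 1 := by
    refine (tsupport_comp_subset (g := Complex.ofReal) Complex.ofReal_zero (β.normed μ)).trans ?_
    rw [β.tsupport_normed_eq]
  have hcs : HasCompactSupport φ := (isCompact_closedBall (0 : W) 1).of_isClosed_subset
    (isClosed_tsupport φ) hsupp
  have hint : ∫ y, φ y ∂μ = 1 := by
    change ∫ y, ((β.normed μ y : ℝ) : ℂ) ∂μ = 1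
    rw [integral_complex_ofReal, β.integral_normed, Complex.ofReal_one]
  obtain ⟨C, hC0, hC⟩ := hP0 G hG φ hφ hsupp
  refine ⟨C, fun x => ?_⟩
  have hzero : scaledAverage μ G φ x 0 = G x := by
    simp only [scaledAverage, zero_smul, add_zero]
    rw [integral_const_mul, hint, mul_one]
  have hcont : Tendsto (scaledAverage μ G φ x) (𝓝[>] 0) (𝓝 (G x)) := by
    rw [← hzero]
    exact (hasDerivAt_scaledAverage μ b (h1 G hG) hφ.continuous hcs x 0).continuousAt.tendsto.mono_left
      nhdsWithin_le_nhds
  refine le_of_tendsto (hcont.norm.const_mul _) ?_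
  filter_upwards [Ioc_mem_nhdsGT (zero_lt_one' ℝ)] with t ht
  simpa using hC x t ht.1 ht.2

end Sobolev

/-! ### Decay of all derivatives -/

section Decay

variable {W ι : Type*} [NormedAddCommGroup W] [NormedSpace ℝ W] [FiniteDimensional ℝ W]
  [Fintype ι] {b : Module.Basis ι ℝ W}

theorem exists_decay_of_pointwise_bound {𝒢 : Set (W → ℂ)} (h1 : ∀ G ∈ 𝒢, ContDiff ℝ ∞ G)
    (h2 : ∀ G ∈ 𝒢, ∀ i, (fun x => fderiv ℝ G x (b i)) ∈ 𝒢)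
    (h3 : ∀ G ∈ 𝒢, ∀ k : ℕ, ∃ C, ∀ x, (1 + ‖x‖) ^ k * ‖G x‖ ≤ C) (k n : ℕ) :
    ∀ G ∈ 𝒢, ∃ C, ∀ x, ‖x‖ ^ k * ‖iteratedFDeriv ℝ n G x‖ ≤ C := by
  induction n with
  | zero =>
    intro G hG
    obtain ⟨C, hC⟩ := h3 G hG k
    refine ⟨C, fun x => le_trans ?_ (hC x)⟩
    rw [norm_iteratedFDeriv_zero]
    gcongr
    linarith
  | succ n ih =>
    intro G hG
    obtain ⟨C, hC0, hC⟩ := exists_norm_iteratedFDeriv_succ_le b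
    choose C' hC' using fun i => ih _ (h2 G hG i)
    refine ⟨C * ∑ i, C' i, fun x => ?_⟩
    calc ‖x‖ ^ k * ‖iteratedFDeriv ℝ (n + 1) G x‖
        ≤ ‖x‖ ^ k * (C * ∑ i, ‖iteratedFDeriv ℝ n (fun y => fderiv ℝ G y (b i)) x‖) := by
          gcongr
          exact hC G (h1 G hG) n x
      _ = C * ∑ i, ‖x‖ ^ k * ‖iteratedFDeriv ℝ n (fun y => fderiv ℝ G y (b i)) x‖ := by
          rw [mul_left_comm, Finset.mul_sum]
      _ ≤ C * ∑ i, C' i :=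
          mul_le_mul_of_nonneg_left (Finset.sum_le_sum fun i _ => hC' i x) hC0

end Decay

end KernelExpansion

/-! ### Weak derivatives in weighted `L¹` spaces -/

namespace KernelExpansion

section WeakDerivative

variable {d : ℕ} {β : Fin d → ℕ} {f g g' : E d → ℂ}

theorem HasWeakDeriv.ae_eq (h : HasWeakDeriv β f g) (h' : HasWeakDeriv β f g') :
    g =ᵐ[volume] g' := by
  refine ae_eq_of_integral_contDiff_smul_eq h.2.1 h'.2.1 fun φ hφ hc => ?_
  have hφ' : ContDiff ℝ ∞ fun x => (φ x : ℂ) := Complex.ofRealCLM.contDiff.comp hφ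
  have hc' : HasCompactSupport fun x => (φ x : ℂ) := hc.comp_left (g := Complex.ofReal) rfl
  have h1 := (h.2.2 _ hφ' hc').trans (h'.2.2 _ hφ' hc').symm
  simpa only [Complex.real_smul, mul_comm] using h1

/-- Uniqueness of weak derivatives lets one fixed `g` serve for all `α` at once, although each norm
is an infimum of its own. -/
theorem HasWeakDeriv.eLpNorm_le (h : HasWeakDeriv β f g) (p : ℝ≥0∞) (α : Fin d → ℕ) :
    eLpNorm (fun x => (monomial α x : ℂ) * g x) p volume ≤ weightedDerivNorm p α β f :=
  le_iInf₂ fun g' h' => (eLpNorm_congr_ae (by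
    filter_upwards [h.ae_eq h'] with x hx
    rw [hx])).le

theorem exists_hasWeakDeriv_of_lt_top {p : ℝ≥0∞} {α : Fin d → ℕ}
    (h : weightedDerivNorm p α β f < ⊤) : ∃ g, HasWeakDeriv β f g := by
  by_contra! hne
  exact h.ne (by simp [weightedDerivNorm, hne])

/-- The exponents of the monomials `1` and `x_i ^ r`. -/
def powerExponent (r : ℕ) (o : Option (Fin d)) : Fin d → ℕ :=
  o.elim 0 fun i => Pi.single i r

theorem abs_monomial_powerExponent (r : ℕ) (o : Option (Fin d)) (x : E d) :
    |monomial (powerExponent r o) x| = (o.elim 1 fun i => |x i|) ^ r := by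
  cases o with
  | none => simp [powerExponent, monomial]
  | some i =>
    simp only [powerExponent, monomial, Option.elim_some]
    rw [Finset.prod_eq_single i (fun j _ hj => by simp [hj]) (by simp), Pi.single_eq_same, abs_pow]

/-- The norm is at most the sum of the `|x i|`. The power mean inequality for the `d + 1` numbers
`1, |x i|` then produces the constant. -/
theorem one_add_norm_pow_le_sum_monomial (r : ℕ) (x : E d) :
    (1 + ‖x‖) ^ (r + 1) ≤ ((d : ℝ) + 1) ^ r *
      ∑ o, |monomial (powerExponent (r + 1) o) x| := by
  have h1 : 1 + ‖x‖ ≤ ∑ o : Option (Fin d), o.elim 1 fun i => |x i| := by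
    rw [Fintype.sum_option]
    simp only [Option.elim_none, Option.elim_some]
    gcongr
    conv_lhs => rw [← (EuclideanSpace.basisFun (Fin d) ℝ).sum_repr x]
    refine (norm_sum_le _ _).trans (Finset.sum_le_sum fun i _ => ?_)
    rw [norm_smul]
    simp
  have h3 := pow_sum_div_card_le_sum_pow (s := Finset.univ)
    (f := fun o : Option (Fin d) => o.elim 1 fun i => |x i|)
    (fun o _ => by cases o <;> simp) r
  rw [div_le_iff₀ (by simp; positivity)] at h3
  simp_rw [abs_monomial_powerExponent]
  refine (pow_le_pow_left₀ (by positivity) h1 _).trans (h3.trans (le_of_eq ?_))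
  rw [mul_comm]
  simp

/-- Weighted `L¹` norms are controlled by `L^p` norms with monomial weights. -/
theorem exists_eLpNorm_one_le {p : ℝ≥0∞} (hp : 1 ≤ p) (d k : ℕ) :
    ∃ (C : ℝ≥0∞) (r : ℕ), C ≠ ⊤ ∧ ∀ g : E d → ℂ, AEStronglyMeasurable g volume →
      eLpNorm (fun x => (1 + ‖x‖) ^ k * ‖g x‖) 1 volume ≤
        C * ∑ o, eLpNorm (fun x => (monomial (powerExponent r o) x : ℂ) * g x) p volume := by
  -- Hölder: a factor `(1 + ‖x‖) ^ (-m)` is placed in `L^q` with `q` conjugate to `p`, and the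
  -- compensating growth is dominated by the monomials of degree `k + m + 1` together with `1`.
  have hconj := ENNReal.HolderConjugate.conjExponent hp
  set q := ENNReal.conjExponent p
  obtain ⟨m, hm⟩ :=
    (inferInstance : (volume : Measure (E d)).HasTemperateGrowth).exists_eLpNorm_lt_top q
  let c : ℝ := ((d : ℝ) + 1) ^ (k + m)
  have hcw : ∀ s : ℝ, Continuous fun x : E d => (1 + ‖x‖) ^ s := fun s =>
    .rpow_const (by fun_prop) fun x => .inl (by positivity)
  refine ⟨ENNReal.ofReal c * eLpNorm (fun x : E d => (1 + ‖x‖) ^ (-m : ℝ)) q volume, k + m + 1,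
    ENNReal.mul_ne_top ENNReal.ofReal_ne_top hm.ne, fun g hg => ?_⟩
  let G : Option (Fin d) → E d → ℝ := fun o x =>
    ‖(monomial (powerExponent (k + m + 1) o) x : ℂ) * g x‖
  have hG : ∀ o, AEStronglyMeasurable (G o) volume := fun o => by
    refine AEStronglyMeasurable.norm (AEStronglyMeasurable.mul ?_ hg)
    exact (Complex.continuous_ofReal.comp
      (hasTemperateGrowth_monomial _).1.continuous).aestronglyMeasurable
  have : ENNReal.HolderTriple q p 1 := hconj.symm
  calc eLpNorm (fun x => (1 + ‖x‖) ^ k * ‖g x‖) 1 volume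
      ≤ eLpNorm (c • ((fun x : E d => (1 + ‖x‖) ^ (-m : ℝ)) • ∑ o, G o)) 1 volume := by
        refine eLpNorm_mono fun x => ?_
        have hx : 0 < 1 + ‖x‖ := by positivity
        rw [Pi.smul_apply, Pi.smul_apply', Finset.sum_apply]
        simp only [smul_eq_mul, G, norm_mul, Complex.norm_real, Real.norm_eq_abs]
        rw [abs_of_nonneg (a := c) (by positivity), abs_of_nonneg (a := (1 + ‖x‖) ^ (-m : ℝ))
          (by positivity), ← Finset.sum_mul, abs_mul, abs_norm, abs_of_nonneg (by positivity),
          abs_of_nonneg (a := ∑ o, _) (by positivity), Real.rpow_neg hx.le, Real.rpow_natCast]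
        have h1 := one_add_norm_pow_le_sum_monomial (k + m) x
        have h2 : (1 + ‖x‖) ^ (k + m) ≤ (1 + ‖x‖) ^ (k + m + 1) :=
          pow_le_pow_right₀ (by linarith [norm_nonneg x]) (by omega)
        have h3 := h2.trans h1
        rw [pow_add, ← le_div_iff₀ (by positivity)] at h3
        calc (1 + ‖x‖) ^ k * ‖g x‖ ≤ _ * ‖g x‖ := mul_le_mul_of_nonneg_right h3 (norm_nonneg _)
          _ = _ := by simp only [c]; ring
    _ = ENNReal.ofReal c *
          eLpNorm ((fun x : E d => (1 + ‖x‖) ^ (-m : ℝ)) • ∑ o, G o) 1 volume := by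
        rw [eLpNorm_const_smul, Real.enorm_of_nonneg (by positivity)]
    _ ≤ ENNReal.ofReal c * (eLpNorm (fun x : E d => (1 + ‖x‖) ^ (-m : ℝ)) q volume *
          ∑ o, eLpNorm (G o) p volume) := by
        refine mul_le_mul_right ?_ _
        refine (eLpNorm_smul_le_mul_eLpNorm (p := q) (q := p) (Finset.aestronglyMeasurable_sum _ fun o _ => hG o)
          (hcw _).aestronglyMeasurable).trans ?_
        gcongr
        exact eLpNorm_sum_le (fun o _ => hG o) hp
    _ = _ := by
        rw [mul_assoc]
        simp only [G, eLpNorm_norm]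

/-- The weak derivatives of a sequence with bounded weighted `L^p` norms are uniformly bounded in
weighted `L¹` norms. -/
theorem FunBound.exists_weakDeriv {p : ℝ≥0∞} (hp : 1 ≤ p) {N : ℕ} {f : ℕ → E d → ℂ}
    (hf : FunBound p N f) (β : Fin d → ℕ) (k : ℕ) :
    ∃ (g : ℕ → E d → ℂ) (B : ℝ), 0 ≤ B ∧ ∀ j, HasWeakDeriv β (f j) (g j) ∧
      Integrable (fun x => (1 + ‖x‖) ^ k * ‖g j x‖) ∧ ∫ x, (1 + ‖x‖) ^ k * ‖g j x‖ ≤ B := by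
  have hle : ∀ α j, weightedDerivNorm p α β (f j) ≤
      ⨆ j : ℕ, ((j : ℝ≥0∞) + 1) ^ N * weightedDerivNorm p α β (f j) := fun α j => by
    refine le_trans ?_ (le_iSup (fun j : ℕ => ((j : ℝ≥0∞) + 1) ^ N *
      weightedDerivNorm p α β (f j)) j)
    exact le_mul_of_one_le_left' (one_le_pow₀ (by simp))
  choose g hg using fun j => exists_hasWeakDeriv_of_lt_top ((hle 0 j).trans_lt (hf 0 β))
  obtain ⟨C, r, hC, hCb⟩ := exists_eLpNorm_one_le hp d k
  set B := C * ∑ o : Option (Fin d), ⨆ j : ℕ, ((j : ℝ≥0∞) + 1) ^ N *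
    weightedDerivNorm p (powerExponent r o) β (f j) with hBdef
  have hB : B ≠ ⊤ := ENNReal.mul_ne_top hC
    (ENNReal.sum_ne_top.2 fun o _ => (hf (powerExponent r o) β).ne)
  have hm : ∀ j, AEStronglyMeasurable (g j) volume := fun j => (hg j).2.1.aestronglyMeasurable
  have hb : ∀ j, eLpNorm (fun x => (1 + ‖x‖) ^ k * ‖g j x‖) 1 volume ≤ B := fun j => by
    refine (hCb _ (hm j)).trans ?_
    rw [hBdef]
    gcongr with o
    exact ((hg j).eLpNorm_le p _).trans (hle _ j)
  refine ⟨g, B.toReal, ENNReal.toReal_nonneg, fun j => ⟨hg j, ?_, ?_⟩⟩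
  · refine memLp_one_iff_integrable.1 ⟨?_, (hb j).trans_lt hB.lt_top⟩
    exact (Continuous.aestronglyMeasurable (by fun_prop)).mul (hm j).norm
  · have h1 := integral_eq_lintegral_of_nonneg_ae (μ := volume)
      (f := fun x => (1 + ‖x‖) ^ k * ‖g j x‖) (ae_of_all _ fun x => by positivity)
      ((Continuous.aestronglyMeasurable (by fun_prop)).mul (hm j).norm)
    rw [h1]
    refine ENNReal.toReal_mono hB (le_trans (le_of_eq ?_) (hb j))
    rw [eLpNorm_one_eq_lintegral_enorm]
    congr 1 with x
    rw [Real.enorm_of_nonneg (by positivity)]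

end WeakDerivative

/-! ### Tensor products tested against smooth functions -/

section Tensor

variable {d₁ d₂ : ℕ}

/-- The support of `ψ` lies in the product of its two compact projections, so both factors can be
cut off to integrable functions. -/
theorem integrable_tensor_mul {f : E d₁ → ℂ} {h : E d₂ → ℂ} (hf : LocallyIntegrable f)
    (hh : LocallyIntegrable h) {ψ : E d₂ × E d₁ → ℂ} (hψ : Continuous ψ)
    (hc : HasCompactSupport ψ) : Integrable fun x => tensor f h x * ψ x := by
  have hK₁ : IsCompact (Prod.snd '' tsupport ψ) := hc.image continuous_snd
  have hK₂ : IsCompact (Prod.fst '' tsupport ψ) := hc.image continuous_fst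
  have hf' := (hf.integrableOn_isCompact hK₁).integrable_indicator hK₁.measurableSet
  have hh' := (hh.integrableOn_isCompact hK₂).integrable_indicator hK₂.measurableSet
  obtain ⟨M, hM⟩ := hc.exists_bound_of_continuous hψ
  have h1 := (hh'.mul_prod hf').mul_bdd (c := M) hψ.aestronglyMeasurable (ae_of_all _ hM)
  rw [Measure.volume_eq_prod]
  refine h1.congr (ae_of_all _ fun x => ?_)
  by_cases hx : x ∈ tsupport ψ
  · simp only [tensor]
    rw [Set.indicator_of_mem (Set.mem_image_of_mem _ hx),
      Set.indicator_of_mem (Set.mem_image_of_mem _ hx), mul_comm (f _)]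
  · simp [image_eq_zero_of_notMem_tsupport hx]

theorem iterDeriv_comp_add {V W : Type*} [NormedAddCommGroup V] [NormedSpace ℝ V]
    [NormedAddCommGroup W] [NormedSpace ℝ W] (A : V →L[ℝ] W) (w : W) {φ : W → ℂ}
    (hφ : ContDiff ℝ ∞ φ) (l : List V) :
    iterDeriv l (fun v => φ (w + A v)) = fun v => iterDeriv (l.map A) φ (w + A v) := by
  induction l with
  | nil => rfl
  | cons u l ih =>
    rw [iterDeriv_cons, ih, List.map_cons, iterDeriv_cons]
    ext v
    have h1 : HasFDerivAt (fun v => w + A v) A v := A.hasFDerivAt.const_add w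
    have h2 := ((contDiff_iterDeriv hφ (l.map A)).differentiable (by simp)
      (w + A v)).hasFDerivAt.comp v h1
    exact congrArg (fun T : V →L[ℝ] ℂ => T u) h2.fderiv

/-- The unit vectors of the first factor. -/
noncomputable abbrev leftVec (i : Fin d₂) : E d₂ × E d₁ := (stdVec i, 0)

/-- The unit vectors of the second factor. -/
noncomputable abbrev rightVec (i : Fin d₁) : E d₂ × E d₁ := (0, stdVec i)

theorem iterDeriv_slice_right {ψ : E d₂ × E d₁ → ℂ} (hψ : ContDiff ℝ ∞ ψ) (l : List (Fin d₁))
    (x : E d₂) : (fun y => iterDeriv (l.map rightVec) ψ (x, y)) =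
      iterDeriv (l.map stdVec) fun y => ψ (x, y) := by
  have h := iterDeriv_comp_add (ContinuousLinearMap.inr ℝ (E d₂) (E d₁)) (x, 0) hψ (l.map stdVec)
  rw [List.map_map] at h
  simpa using! h.symm

theorem iterDeriv_slice_left {ψ : E d₂ × E d₁ → ℂ} (hψ : ContDiff ℝ ∞ ψ) (l : List (Fin d₂))
    (y : E d₁) : (fun x => iterDeriv (l.map leftVec) ψ (x, y)) =
      iterDeriv (l.map stdVec) fun x => ψ (x, y) := by
  have h := iterDeriv_comp_add (ContinuousLinearMap.inl ℝ (E d₂) (E d₁)) (0, y) hψ (l.map stdVec)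
  rw [List.map_map] at h
  simpa using! h.symm

theorem HasWeakDeriv.integral_mul_iterDeriv {d : ℕ} {l : List (Fin d)} {f g : E d → ℂ}
    (h : HasWeakDeriv (fun i => l.count i) f g) {φ : E d → ℂ} (hφ : ContDiff ℝ ∞ φ)
    (hc : HasCompactSupport φ) :
    ∫ x, f x * iterDeriv (l.map stdVec) φ x = (-1) ^ l.length * ∫ x, g x * φ x := by
  rw [h.2.2 φ hφ hc, multiDeriv_eq_iterDeriv, ← length_indexList,
    ← (perm_indexList l).length_eq, ← mul_assoc, ← mul_pow, neg_one_mul, neg_neg, one_pow, one_mul,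
    iterDeriv_perm hφ ((perm_indexList l).map stdVec)]

theorem hasCompactSupport_slice_right {ψ : E d₂ × E d₁ → ℂ} (hc : HasCompactSupport ψ)
    (x : E d₂) : HasCompactSupport fun y => ψ (x, y) :=
  HasCompactSupport.intro (hc.image continuous_snd) fun y hy => by
    by_contra hne
    exact hy ⟨(x, y), subset_tsupport ψ hne, rfl⟩

theorem hasCompactSupport_slice_left {ψ : E d₂ × E d₁ → ℂ} (hc : HasCompactSupport ψ)
    (y : E d₁) : HasCompactSupport fun x => ψ (x, y) :=
  HasCompactSupport.intro (hc.image continuous_fst) fun x hx => by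
    by_contra hne
    exact hx ⟨(x, y), subset_tsupport ψ hne, rfl⟩

/-- Fubini with the inner integral over the second variable: each slice of `ψ` is a test function
for the weak derivative of `f`. The lemma for the other factor integrates in the opposite order. -/
theorem integral_tensor_mul_iterDeriv_right {l : List (Fin d₁)} {f g : E d₁ → ℂ} {h : E d₂ → ℂ}
    (hfg : HasWeakDeriv (fun i => l.count i) f g) (hh : LocallyIntegrable h)
    {ψ : E d₂ × E d₁ → ℂ} (hψ : ContDiff ℝ ∞ ψ) (hc : HasCompactSupport ψ) :
    ∫ x, tensor f h x * iterDeriv (l.map rightVec) ψ x =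
      (-1) ^ l.length * ∫ x, tensor g h x * ψ x := by
  have h1 := integrable_tensor_mul hfg.1 hh (contDiff_iterDeriv hψ (l.map rightVec)).continuous
    (hasCompactSupport_iterDeriv hc _)
  have h2 := integrable_tensor_mul hfg.2.1 hh hψ.continuous hc
  rw [Measure.volume_eq_prod] at h1 h2 ⊢
  rw [integral_prod _ h1, integral_prod _ h2, ← integral_const_mul]
  congr 1 with x
  have h3 := hfg.integral_mul_iterDeriv (φ := fun y => ψ (x, y)) (hψ.comp (by fun_prop))
    (hasCompactSupport_slice_right hc x)
  rw [← iterDeriv_slice_right hψ] at h3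
  simp only [tensor]
  simp_rw [mul_comm (f _), mul_comm (g _), mul_assoc]
  rw [integral_const_mul, integral_const_mul, h3]
  ring

theorem integral_tensor_mul_iterDeriv_left {l : List (Fin d₂)} {f g : E d₂ → ℂ} {h : E d₁ → ℂ}
    (hfg : HasWeakDeriv (fun i => l.count i) f g) (hh : LocallyIntegrable h)
    {ψ : E d₂ × E d₁ → ℂ} (hψ : ContDiff ℝ ∞ ψ) (hc : HasCompactSupport ψ) :
    ∫ x, tensor h f x * iterDeriv (l.map leftVec) ψ x =
      (-1) ^ l.length * ∫ x, tensor h g x * ψ x := by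
  have h1 := integrable_tensor_mul hh hfg.1 (contDiff_iterDeriv hψ (l.map leftVec)).continuous
    (hasCompactSupport_iterDeriv hc _)
  have h2 := integrable_tensor_mul hh hfg.2.1 hψ.continuous hc
  rw [Measure.volume_eq_prod] at h1 h2 ⊢
  rw [integral_prod_symm _ h1, integral_prod_symm _ h2, ← integral_const_mul]
  congr 1 with y
  have h3 := hfg.integral_mul_iterDeriv (φ := fun x => ψ (x, y)) (hψ.comp (by fun_prop))
    (hasCompactSupport_slice_left hc y)
  rw [← iterDeriv_slice_left hψ] at h3
  simp only [tensor]
  simp_rw [mul_assoc]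
  rw [integral_const_mul, integral_const_mul, h3]
  ring

theorem norm_integral_tensor_mul_le {k : ℕ} {g₁ : E d₁ → ℂ} {g₂ : E d₂ → ℂ} {B₁ B₂ M : ℝ}
    (h₁ : Integrable fun x => (1 + ‖x‖) ^ k * ‖g₁ x‖) (hB₁ : ∫ x, (1 + ‖x‖) ^ k * ‖g₁ x‖ ≤ B₁)
    (h₂ : Integrable fun x => (1 + ‖x‖) ^ k * ‖g₂ x‖) (hB₂ : ∫ x, (1 + ‖x‖) ^ k * ‖g₂ x‖ ≤ B₂)
    (hM : 0 ≤ M) {φ : E d₂ × E d₁ → ℂ} (hφ : ∀ x, ‖φ x‖ ≤ M * (1 + ‖x‖) ^ k) :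
    ‖∫ x, tensor g₁ g₂ x * φ x‖ ≤ M * (B₂ * B₁) := by
  have hint := (h₂.mul_prod h₁).const_mul M
  have h3 := norm_integral_le_of_norm_le (f := fun x => tensor g₁ g₂ x * φ x) hint
    (ae_of_all _ fun x => by
      have h4 : 1 + ‖x‖ ≤ (1 + ‖x.1‖) * (1 + ‖x.2‖) := by
        have := norm_nonneg x.1
        have := norm_nonneg x.2
        rw [Prod.norm_def]
        rcases max_cases ‖x.1‖ ‖x.2‖ with h | h <;> nlinarith
      calc ‖tensor g₁ g₂ x * φ x‖ = ‖g₁ x.2‖ * ‖g₂ x.1‖ * ‖φ x‖ := by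
            rw [norm_mul, tensor, norm_mul]
        _ ≤ ‖g₁ x.2‖ * ‖g₂ x.1‖ * (M * ((1 + ‖x.1‖) * (1 + ‖x.2‖)) ^ k) := by
            gcongr
            exact (hφ x).trans (by gcongr)
        _ = _ := by rw [mul_pow]; ring)
  rw [← Measure.volume_eq_prod, integral_const_mul, Measure.volume_eq_prod,
    integral_prod_mul (fun x : E d₂ => (1 + ‖x‖) ^ k * ‖g₂ x‖)
    (fun x : E d₁ => (1 + ‖x‖) ^ k * ‖g₁ x‖)] at h3
  refine h3.trans ?_
  have h5 : 0 ≤ ∫ x, (1 + ‖x‖) ^ k * ‖g₁ x‖ := integral_nonneg fun x => by positivity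
  have h6 : 0 ≤ ∫ x, (1 + ‖x‖) ^ k * ‖g₂ x‖ := integral_nonneg fun x => by positivity
  exact mul_le_mul_of_nonneg_left (mul_le_mul hB₂ hB₁ h5 (h6.trans hB₂)) hM

end Tensor

end KernelExpansion

/-! ### The converse: rapidly decreasing expansions give Schwartz kernels -/

namespace KernelExpansion

section Converse

variable {d₁ d₂ : ℕ}

/-- The partial derivatives of `K`. -/
def partialDerivs (K : E d₂ × E d₁ → ℂ) : Set (E d₂ × E d₁ → ℂ) :=
  Set.range fun l : List (Fin d₂) × List (Fin d₁) =>
    iterDeriv (l.1.map leftVec ++ l.2.map rightVec) K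

/-- The standard basis of `ℝ^{d₂} × ℝ^{d₁}`. -/
noncomputable def prodBasis (d₁ d₂ : ℕ) : Module.Basis (Fin d₂ ⊕ Fin d₁) ℝ (E d₂ × E d₁) :=
  (EuclideanSpace.basisFun (Fin d₂) ℝ).toBasis.prod (EuclideanSpace.basisFun (Fin d₁) ℝ).toBasis

theorem fderiv_mem_partialDerivs {K : E d₂ × E d₁ → ℂ} (hK : ContDiff ℝ ∞ K) :
    ∀ G ∈ partialDerivs K, ∀ i, (fun x => fderiv ℝ G x (prodBasis d₁ d₂ i)) ∈ partialDerivs K := by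
  rintro _ ⟨⟨l₂, l₁⟩, rfl⟩ (i | i)
  · refine ⟨(i :: l₂, l₁), ?_⟩
    simp [iterDeriv_cons, prodBasis]
  · refine ⟨(l₂, i :: l₁), ?_⟩
    simp only [List.map_cons]
    rw [iterDeriv_perm hK List.perm_middle, iterDeriv_cons]
    simp [prodBasis]

theorem integral_tensor_mul_iterDeriv {l₁ : List (Fin d₁)} {l₂ : List (Fin d₂)}
    {f₁ g₁ : E d₁ → ℂ} {f₂ g₂ : E d₂ → ℂ} (h₁ : HasWeakDeriv (fun i => l₁.count i) f₁ g₁)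
    (h₂ : HasWeakDeriv (fun i => l₂.count i) f₂ g₂) {φ : E d₂ × E d₁ → ℂ} (hφ : ContDiff ℝ ∞ φ)
    (hc : HasCompactSupport φ) :
    ∫ x, tensor f₁ f₂ x * iterDeriv (l₂.map leftVec ++ l₁.map rightVec) φ x =
      (-1) ^ (l₂.length + l₁.length) * ∫ x, tensor g₁ g₂ x * φ x := by
  rw [iterDeriv_append, integral_tensor_mul_iterDeriv_left h₂ h₁.1 (contDiff_iterDeriv hφ _)
    (hasCompactSupport_iterDeriv hc _), integral_tensor_mul_iterDeriv_right h₁ h₂.2.1 hφ hc,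
    pow_add, mul_assoc]

/-- Partial derivatives of a kernel with a rapidly decreasing expansion are bounded as functionals
on test functions with weighted sup norms. -/
theorem exists_dual_bound {p : ℝ≥0∞} (hp : 1 ≤ p) {K : E d₂ × E d₁ → ℂ} (hK : ContDiff ℝ ∞ K)
    {lam : ℕ → ℝ} {f₁ : ℕ → E d₁ → ℂ} {f₂ : ℕ → E d₂ → ℂ} (h0 : ∀ j, 0 ≤ lam j)
    (hexp : HasExpansion K lam f₁ f₂) (hlam : CoeffBound 2 lam) {N₁ N₂ : ℕ}
    (hf₁ : FunBound p N₁ f₁) (hf₂ : FunBound p N₂ f₂) (k : ℕ) :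
    ∀ G ∈ partialDerivs K, ∃ C, 0 ≤ C ∧ ∀ ψ : E d₂ × E d₁ → ℂ, ContDiff ℝ ∞ ψ →
      HasCompactSupport ψ → ∀ M, 0 ≤ M → (∀ y, ‖ψ y‖ ≤ M * (1 + ‖y‖) ^ k) →
        ‖∫ y, G y * ψ y‖ ≤ C * M := by
  rintro _ ⟨⟨l₂, l₁⟩, rfl⟩
  obtain ⟨g₁, B₁, hB₁, hg₁⟩ := hf₁.exists_weakDeriv hp (fun i => l₁.count i) k
  obtain ⟨g₂, B₂, hB₂, hg₂⟩ := hf₂.exists_weakDeriv hp (fun i => l₂.count i) k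
  obtain ⟨C, hC⟩ := hlam
  have hsum : Summable lam := summable_of_sq_mul_le h0 fun j => hC ⟨j, rfl⟩
  have htsum : 0 ≤ ∑' j, lam j := tsum_nonneg h0
  refine ⟨(∑' j, lam j) * (B₂ * B₁), by positivity, fun ψ hψ hc M hM hb => ?_⟩
  have : (volume : Measure (E d₂ × E d₁)).IsAddHaarMeasure := by
    rw [Measure.volume_eq_prod]
    infer_instance
  have h1 := integral_iterDeriv_mul volume hK hψ hc
    (l₂.map leftVec ++ l₁.map rightVec)
  simp only
  rw [h1, norm_mul, norm_pow, norm_neg, norm_one, one_pow, one_mul]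
  -- The expansion is tested against a derivative of `ψ`. In each term the derivatives return to the
  -- factors as weak derivatives, so the final bound involves only the weighted size of `ψ`,
  -- uniformly in `n`.
  refine le_of_tendsto (hexp _ (contDiff_iterDeriv hψ _) (hasCompactSupport_iterDeriv hc _)).norm
    (Eventually.of_forall fun n => ?_)
  calc ‖∑ j ∈ Finset.range n, (lam j : ℂ) * ∫ x, tensor (f₁ j) (f₂ j) x *
          iterDeriv (l₂.map leftVec ++ l₁.map rightVec) ψ x‖
      ≤ ∑ j ∈ Finset.range n, lam j * (M * (B₂ * B₁)) := by
        refine (norm_sum_le _ _).trans (Finset.sum_le_sum fun j _ => ?_)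
        rw [integral_tensor_mul_iterDeriv (hg₁ j).1 (hg₂ j).1 hψ hc, norm_mul, norm_mul, norm_pow,
          norm_neg, norm_one, one_pow, one_mul, Complex.norm_real, Real.norm_of_nonneg (h0 j)]
        exact mul_le_mul_of_nonneg_left (norm_integral_tensor_mul_le (hg₁ j).2.1 (hg₁ j).2.2
          (hg₂ j).2.1 (hg₂ j).2.2 hM hb) (h0 j)
    _ = (∑ j ∈ Finset.range n, lam j) * (M * (B₂ * B₁)) := by rw [Finset.sum_mul]
    _ ≤ (∑' j, lam j) * (M * (B₂ * B₁)) := by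
        gcongr
        exact hsum.sum_le_tsum _ fun j _ => h0 j
    _ = _ := by ring

theorem isSchwartz_of_hasExpansion {p : ℝ≥0∞} (hp : 1 ≤ p) {K : E d₂ × E d₁ → ℂ}
    (hK : ContDiff ℝ ∞ K) {lam : ℕ → ℝ} {f₁ : ℕ → E d₁ → ℂ} {f₂ : ℕ → E d₂ → ℂ}
    (h0 : ∀ j, 0 ≤ lam j) (hexp : HasExpansion K lam f₁ f₂) (hlam : CoeffBound 2 lam) {N₁ N₂ : ℕ}
    (hf₁ : FunBound p N₁ f₁) (hf₂ : FunBound p N₂ f₂) : IsSchwartz K := by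
  have : (volume : Measure (E d₂ × E d₁)).IsAddHaarMeasure := by
    rw [Measure.volume_eq_prod]
    infer_instance
  have hsmooth : ∀ G ∈ partialDerivs K, ContDiff ℝ ∞ G := by
    rintro _ ⟨l, rfl⟩
    exact contDiff_iterDeriv hK _
  have hclosed := fderiv_mem_partialDerivs hK
  have hdecay := fun k n => exists_decay_of_pointwise_bound hsmooth hclosed
    (fun G hG k => exists_pointwise_bound_of_dual_bound hsmooth hclosed
      (exists_dual_bound hp hK h0 hexp hlam hf₁ hf₂ k) hG) k n K ⟨([], []), rfl⟩
  exact ⟨⟨K, hK, hdecay⟩, rfl⟩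

end Converse

end KernelExpansion

theorem theorem5p1 (d₁ d₂ : ℕ) (hd₁ : 1 ≤ d₁) (hd₂ : 1 ≤ d₂) (p : ℝ≥0∞) (hp : 1 ≤ p)
    (K : KernelExpansion.E d₂ × KernelExpansion.E d₁ → ℂ) (hK : ContDiff ℝ ∞ K) :
    (KernelExpansion.IsSchwartz K →
      ∃ (lam : ℕ → ℝ) (f₁ : ℕ → 𝓢(KernelExpansion.E d₁, ℂ)) (f₂ : ℕ → 𝓢(KernelExpansion.E d₂, ℂ)),
        (∀ j, 0 ≤ lam j) ∧
        ((∀ j, 0 < lam j) ∨ ∃ n, (∀ j, j < n → 0 < lam j) ∧ ∀ j, n ≤ j → lam j = 0) ∧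
        KernelExpansion.IsOG (fun j => (f₁ j).toLp 2) ∧
        KernelExpansion.IsOG (fun j => (f₂ j).toLp 2) ∧
        KernelExpansion.HasStrongExpansion K lam (fun j => ⇑(f₁ j)) (fun j => ⇑(f₂ j)) ∧
        ∀ N : ℕ, KernelExpansion.CoeffBound N lam ∧
          KernelExpansion.FunBound p N (fun j => ⇑(f₁ j)) ∧
          KernelExpansion.FunBound p N (fun j => ⇑(f₂ j))) ∧
    (∀ (lam : ℕ → ℝ) (f₁ : ℕ → KernelExpansion.E d₁ → ℂ) (f₂ : ℕ → KernelExpansion.E d₂ → ℂ),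
        (∀ j, 0 ≤ lam j) →
        KernelExpansion.HasExpansion K lam f₁ f₂ →
        (∀ N : ℕ, 1 ≤ N → KernelExpansion.CoeffBound N lam ∧
          KernelExpansion.FunBound p N f₁ ∧ KernelExpansion.FunBound p N f₂) →
        KernelExpansion.IsSchwartz K) := by
  constructor
  · rintro ⟨S, rfl⟩
    exact KernelExpansion.exists_expansion_of_schwartz hd₁ hd₂ hp S
  · intro lam f₁ f₂ h0 hexp hb
    exact KernelExpansion.isSchwartz_of_hasExpansion hp hK h0 hexp (hb 2 one_le_two).1
      (hb 1 le_rfl).2.1 (hb 1 le_rfl).2.2
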